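/- Call a complex number algebraic if it is a root of a nonzero polynomial with rational coefficients. Fix the standard computable presentation of the algebraic numbers, so that finite matrices with algebraic entries, and finite sets of vectors with algebraic entries, have indices in $\mathbb{N}$. A real $r$ is computable if there is a computable $f:\mathbb{N}\to\mathbb{Q}$ with $|f(k)-r|<2^{-k}$ for all $k$. A state is a sequence $\rho=(\rho_n)_{n\in\mathbb{N}}$ of density matrices, $\rho_n$ acting on $\mathbb{C}^{2^n}$, such that tracing out the last qubit of $\rho_{n+1}$ gives $\rho_n$ for every $n$. Let $\tau$ be the tracial state, $\tau_n=2^{-n}I$. A special projection is a Hermitian projection $S$ on some $\mathbb{C}^{2^n}$ with algebraic entries; for a state $\rho$ put $\rho(S)=\mathrm{Tr}(\rho_nS)$. A quantum Schnorr test is a computable sequence $(S^m)_{m\in\mathbb{N}}$ of special projections (the number of qubits may vary with $m$) such that $\sum_m\tau(S^m)$ is finite and is a computable real. A state $\rho$ is quantum Schnorr random if, for every quantum Schnorr test $(S^m)_m$ and every $\delta>0$, there are only finitely many $m$ with $\rho(S^m)>\delta$. A computable measure machine is a partial computable function $C$ on finite bitstrings with prefix-free domain such that the Lebesgue (fair coin)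 measure of the set of infinite bitstrings extending an element of $\mathrm{dom}(C)$ is a computable real. For $\epsilon>0$ and a density matrix $\sigma$ on $\mathbb{C}^{2^n}$ let $$QK_C^{\epsilon}(\sigma)=\inf\Big\{|\pi|+\log_2|F| \;:\; C(\pi)\text{ is defined and is an index of } F,\ F\subseteq\mathbb{C}^{2^n}\text{ a finite orthonormal set of vectors with algebraic entries},\ \sum_{v\in F}\langle v|\sigma|v\rangle>\epsilon\Big\},$$ with $\inf\emptyset=\infty$. Theorem. A state $\rho$ is quantum Schnorr random if and only if for every computable measure machine $C$ and every $\epsilon>0$ there is a constant $d>0$ such that $QK_C^{\epsilon}(\rho_n)>n-d$ for all $n\in\mathbb{N}$. -/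

import Mathlib

open scoped ComplexOrder
open MeasureTheory Filter

noncomputable section

namespace QuantumSchnorr

/-! ### Computable reals -/

/-- A sequence of rationals is computable if numerators and (positive) denominators representing it
can be computed. -/
def IsComputableRatSeq (f : ℕ → ℚ) : Prop :=
  ∃ (p : ℕ → ℤ) (q : ℕ → ℕ), Computable p ∧ Computable q ∧
    ∀ n, f n = (p n : ℚ) / ((q n : ℚ) + 1)

/-- A real number is computable if some computable sequence of rationals `f` satisfies
`|f n - r| < 2 ^ (-n)` for all `n`. -/
def IsComputableReal (r : ℝ) : Prop :=
  ∃ f : ℕ → ℚ, IsComputableRatSeq f ∧ ∀ n : ℕ, |(f n : ℝ) - r| < (2⁻¹ : ℝ) ^ n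

/-! ### A computable indexing of algebraic numbers, vectors, finite sets of vectors, matrices -/

/-- A code `(p, a, b, m)` of an algebraic number: integer coefficients `p` of a polynomial (lowest
degree first) together with the disc with centre `(a + b i) / (m + 1)` and radius `1 / (m + 1)`. -/
abbrev AlgCode : Type := List ℤ × ℤ × ℤ × ℕ

/-- The value at `z` of the polynomial with the given list of coefficients (lowest degree first). -/
def evalCoeffs (p : List ℤ) (z : ℂ) : ℂ :=
  p.foldr (fun (c : ℤ) (acc : ℂ) => (c : ℂ) + z * acc) 0

/-- `z` is a root of the coded polynomial lying in the coded open disc. -/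
def AlgCode.IsRootInDisc (c : AlgCode) (z : ℂ) : Prop :=
  evalCoeffs c.1 z = 0 ∧
    ‖z - ((c.2.1 : ℂ) + (c.2.2.1 : ℂ) * Complex.I) / ((c.2.2.2 : ℂ) + 1)‖ <
      1 / ((c.2.2.2 : ℝ) + 1)

/-- The code `c` denotes `z` if `z` is the only root of the coded polynomial in the coded disc.
(In particular that polynomial is not zero.) -/
def AlgCode.Denotes (c : AlgCode) (z : ℂ) : Prop :=
  c.IsRootInDisc z ∧ ∀ w : ℂ, c.IsRootInDisc w → w = z

/-- A list of codes denotes a vector if it has the same length and denotes it entry by entry. -/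
def VecDenotes {d : ℕ} (c : List AlgCode) (v : Fin d → ℂ) : Prop :=
  List.Forall₂ AlgCode.Denotes c (List.ofFn v)

/-- A list of lists of codes denotes a matrix if it denotes it row by row. -/
def MatDenotes {d e : ℕ} (c : List (List AlgCode)) (A : Matrix (Fin d) (Fin e) ℂ) : Prop :=
  List.Forall₂ VecDenotes c (List.ofFn fun i => A i)

/-- A list of lists of codes denotes the finite set of the vectors denoted by its members. -/
def SetDenotes {d : ℕ} (c : List (List AlgCode)) (F : Finset (EuclideanSpace ℂ (Fin d))) : Prop :=
  (∀ l ∈ c, ∃ v ∈ F, VecDenotes l (fun i => v i)) ∧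
    ∀ v ∈ F, ∃ l ∈ c, VecDenotes l (fun i => v i)

/-- The natural number `k` is an index of the matrix `A` (with algebraic entries). -/
def IsMatIndex {d e : ℕ} (k : ℕ) (A : Matrix (Fin d) (Fin e) ℂ) : Prop :=
  ∃ c : List (List AlgCode), Encodable.decode k = some c ∧ MatDenotes c A

/-- The natural number `k` is an index of the finite set `F` of vectors (with algebraic entries). -/
def IsSetIndex {d : ℕ} (k : ℕ) (F : Finset (EuclideanSpace ℂ (Fin d))) : Prop :=
  ∃ c : List (List AlgCode), Encodable.decode k = some c ∧ SetDenotes c F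

/-! ### States -/

/-- The index `2 * i + b` of the basis vector `e_i ⊗ e_b` of `ℂ ^ (2 ^ n) ⊗ ℂ ^ 2`. -/
def appendBit {n : ℕ} (i : Fin (2 ^ n)) (b : Fin 2) : Fin (2 ^ (n + 1)) :=
  ⟨2 * i.1 + b.1, by have := i.2; have := b.2; rw [pow_succ]; omega⟩

/-- The partial trace over the last qubit. -/
def partialTraceLast {n : ℕ} (A : Matrix (Fin (2 ^ (n + 1))) (Fin (2 ^ (n + 1))) ℂ) :
    Matrix (Fin (2 ^ n)) (Fin (2 ^ n)) ℂ :=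
  fun i j => ∑ b : Fin 2, A (appendBit i b) (appendBit j b)

/-- A state: a sequence of density matrices, `mat n` on `n` qubits, coherent under tracing out the
last qubit. -/
structure QState where
  mat : (n : ℕ) → Matrix (Fin (2 ^ n)) (Fin (2 ^ n)) ℂ
  posSemidef : ∀ n, (mat n).PosSemidef
  trace_eq_one : ∀ n, (mat n).trace = 1
  coherent : ∀ n, partialTraceLast (mat (n + 1)) = mat n

/-- The tracial state `τ`, with `τ_n = 2 ^ (-n) I`. -/
def tracialState : QState where
  mat n := ((2 : ℂ) ^ n)⁻¹ • (1 : Matrix (Fin (2 ^ n)) (Fin (2 ^ n)) ℂ)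
  posSemidef n := Matrix.PosSemidef.one.smul (by positivity)
  trace_eq_one n := by simp [Matrix.trace_smul, Matrix.trace_one]
  coherent n := by
    ext i j
    by_cases h : i = j
    · subst h
      simp [partialTraceLast, pow_succ]
    · have h' : ∀ b : Fin 2, appendBit i b ≠ appendBit j b := by
        intro b hb
        apply h
        have := congrArg Fin.val hb
        simp only [appendBit] at this
        exact Fin.ext (by omega)
      simp [partialTraceLast, h, h']

/-! ### Quantum Schnorr randomness -/

/-- A special projection: a Hermitian projection on finitely many qubits with algebraic entries. -/
structure SpecialProjection where
  qubits : ℕ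
  mat : Matrix (Fin (2 ^ qubits)) (Fin (2 ^ qubits)) ℂ
  isHermitian : mat.IsHermitian
  isIdempotentElem : IsIdempotentElem mat
  isAlgebraic : ∀ i j, IsAlgebraic ℚ (mat i j)

/-- `ρ(S) = Tr (ρ_n S)` for a special projection `S` on `n` qubits. -/
def QState.measure (ρ : QState) (S : SpecialProjection) : ℝ :=
  (ρ.mat S.qubits * S.mat).trace.re

/-- A sequence of special projections is computable if indices can be computed. -/
def IsComputableProjSeq (S : ℕ → SpecialProjection) : Prop :=
  ∃ f : ℕ → ℕ, Computable f ∧ ∀ m, IsMatIndex (f m) (S m).mat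

/-- A strong Solovay test: a computable sequence of special projections with
`∑ m, τ(S m) < ∞`. -/
def IsStrongSolovayTest (S : ℕ → SpecialProjection) : Prop :=
  IsComputableProjSeq S ∧ Summable fun m => tracialState.measure (S m)

/-- A quantum Schnorr test: a strong Solovay test for which `∑ m, τ(S m)` is a computable real. -/
def IsQuantumSchnorrTest (S : ℕ → SpecialProjection) : Prop :=
  IsStrongSolovayTest S ∧ IsComputableReal (∑' m, tracialState.measure (S m))

/-- `ρ` fails the test at `δ` if `ρ(S m) > δ` for infinitely many `m`. -/
def QState.FailsAt (ρ : QState) (S : ℕ → SpecialProjection) (δ : ℝ) : Prop :=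
  ∃ᶠ m in atTop, ρ.measure (S m) > δ

/-- A state is quantum Schnorr random if it fails no quantum Schnorr test at any `δ > 0`. -/
def QState.IsQuantumSchnorrRandom (ρ : QState) : Prop :=
  ∀ S, IsQuantumSchnorrTest S → ∀ δ : ℝ, 0 < δ → ¬ ρ.FailsAt S δ

/-! ### Computable measure machines and `QK` -/

/-- A prefix-free machine: a partial computable function on bitstrings, no two distinct elements of
whose domain are comparable. Outputs are natural numbers, read as indices of finite objects. -/
structure PrefixFreeMachine where
  run : List Bool →. ℕ
  partrec : Partrec run
  prefixFree : ∀ σ τ, (run σ).Dom → (run τ).Dom → σ <+: τ → σ = τ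

/-- Lebesgue measure (fair coin tossing) on the space of infinite bitstrings. -/
def cantorMeasure : Measure (ℕ → Bool) :=
  Measure.infinitePi fun _ => (PMF.uniformOfFintype Bool).toMeasure

/-- The infinite bitstrings that extend some element of the domain of `C`. -/
def PrefixFreeMachine.domainOpen (C : PrefixFreeMachine) : Set (ℕ → Bool) :=
  {X | ∃ σ : List Bool, (C.run σ).Dom ∧ ∀ (i : ℕ) (h : i < σ.length), X i = σ[i]}

/-- A computable measure machine: a prefix-free machine whose domain has computable measure. -/
def PrefixFreeMachine.IsComputableMeasure (C : PrefixFreeMachine) : Prop :=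
  IsComputableReal (cantorMeasure.real C.domainOpen)

/-- `QK_C^ε(A)` for a matrix `A` on `n` qubits: the infimum of `|σ| + log₂ |F|` over all `σ` such
that `C(σ)` is defined and is an index of an orthonormal set `F` of vectors in `ℂ ^ (2 ^ n)` with
algebraic entries, with `∑ v ∈ F, ⟨v|A|v⟩ > ε`. It is `⊤` if there is no such `σ`. -/
def PrefixFreeMachine.QK (C : PrefixFreeMachine) (ε : ℝ) {n : ℕ}
    (A : Matrix (Fin (2 ^ n)) (Fin (2 ^ n)) ℂ) : EReal :=
  sInf {x : EReal | ∃ (σ : List Bool) (k : ℕ) (F : Finset (EuclideanSpace ℂ (Fin (2 ^ n)))),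
    k ∈ C.run σ ∧ IsSetIndex k F ∧
    Orthonormal ℂ (fun v : F => (v : EuclideanSpace ℂ (Fin (2 ^ n)))) ∧
    (∑ v ∈ F, (star v.ofLp ⬝ᵥ A.mulVec v.ofLp).re) > ε ∧
    x = (((σ.length : ℝ) + Real.logb 2 (F.card : ℝ) : ℝ) : EReal)}

end QuantumSchnorr

end

/-!
Both directions compare two ways of spending the same amount of measure: a projection of rank `r` on
`n` qubits has tracial measure `r / 2 ^ n`, and a program `σ` for an orthonormal set `F` with
`|σ| + log₂ |F| = n - d` has Lebesgue measure `2 ^ (-|σ|) = 2 ^ d * |F| / 2 ^ n`.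

*From complexity to randomness.* Let a Schnorr test be failed at `δ`. Its projections are replaced
by nearby projections of the same rank whose range has an orthonormal basis of Gaussian rational
vectors, a *frame* (`exists_computable_frames`). Since the sum of the test is computable, its terms
can be multiplied by computable weights tending to infinity without spoiling this
(`exists_slow_weights`). An effective Kraft inequality turns the weighted terms into a computable
measure machine that describes the frames (`exists_machine`). Along the infinitely many projections
at which the test is failed the machine compresses by more than any constant.

*From randomness to complexity.* Given a machine `C` of computable measure, the halting computations
are enumerated without repetitions (`exists_halting_stages`). An output is a list of codes of
vectors; it may well denote nothing, and there is no need to decide whether it does. Codes of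
algebraic numbers are approximated by Gaussian rationals, and the projection onto the span of the
approximations is used as a member of the test, provided that its rank is small enough for its
tracial measure not to exceed the measure of the program (`exists_computable_span`,
`exists_quantumSchnorrTest`). This makes sense for arbitrary outputs. For an output that does denote
an orthonormal set, the rank is at most the size of the set and the expectations differ little
(`sum_le_trace_mul_listMat`). The sum of the test is computable because it is dominated term by term
by the series of the measures of the programs, whose sum is computable.

*Effective ingredients.* The number denoted by a code has to be approximated computably
(`AlgCode.approx`), knowing only that the code's polynomial has a single root in an open disc. A
small value of the polynomial at a point indicates a root near it (`exists_root_near`), and that this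
root lies in the disc follows if the point is not too close to the boundary; a Liouville inequality
(`inv_le_one_sub_normSq`) bounds the distance of the root from the boundary and so tells how close
is too close. Frames are dense among orthonormal families because the Cayley transform is a rational
parametrization of the unitary group (`mem_closure_rationalUnitaries`), whereas spans need no
normalization and are handled by the Gram–Schmidt process
(`exists_gaussianRational_projection`).
-/

open scoped ComplexOrder
open MeasureTheory Filter

namespace QuantumSchnorr

/-! ### Computability of arithmetic -/

-- With these attributes `fun_prop` proves computability of composite functions.
attribute [fun_prop] Computable
attribute [fun_prop] Computable.id Computable.const Computable.comp Computable.fst Computable.snd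
  Computable.pair

section Basic
variable {α β : Type*} [Primcodable α] [Primcodable β]

@[fun_prop]
theorem Computable.natAdd {f g : α → ℕ} (hf : Computable f) (hg : Computable g) :
    Computable fun x => f x + g x :=
  Primrec.nat_add.to_comp.comp hf hg

@[fun_prop]
theorem Computable.natSub {f g : α → ℕ} (hf : Computable f) (hg : Computable g) :
    Computable fun x => f x - g x :=
  Primrec.nat_sub.to_comp.comp hf hg

@[fun_prop]
theorem Computable.natMul {f g : α → ℕ} (hf : Computable f) (hg : Computable g) :
    Computable fun x => f x * g x :=
  Primrec.nat_mul.to_comp.comp hf hg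

@[fun_prop]
theorem Computable.natDiv {f g : α → ℕ} (hf : Computable f) (hg : Computable g) :
    Computable fun x => f x / g x :=
  Primrec.nat_div.to_comp.comp hf hg

@[fun_prop]
theorem Computable.natMod {f g : α → ℕ} (hf : Computable f) (hg : Computable g) :
    Computable fun x => f x % g x :=
  Primrec.nat_mod.to_comp.comp hf hg

@[fun_prop]
theorem Computable.natPow {f g : α → ℕ} (hf : Computable f) (hg : Computable g) :
    Computable fun x => f x ^ g x :=
  (Primrec₂.unpaired'.1 Nat.Primrec.pow).to_comp.comp hf hg

@[fun_prop]
theorem Computable.boolAnd {f g : α → Bool} (hf : Computable f) (hg : Computable g) :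
    Computable fun x => f x && g x :=
  Primrec.and.to_comp.comp hf hg

@[fun_prop]
theorem Computable.boolOr {f g : α → Bool} (hf : Computable f) (hg : Computable g) :
    Computable fun x => f x || g x :=
  Primrec.or.to_comp.comp hf hg

@[fun_prop]
theorem Computable.boolNot {f : α → Bool} (hf : Computable f) :
    Computable fun x => !f x :=
  Primrec.not.to_comp.comp hf

@[fun_prop]
theorem Computable.decideNatLt {f g : α → ℕ} (hf : Computable f) (hg : Computable g) :
    Computable fun x => decide (f x < g x) :=
  (Primrec.nat_lt.decide).to_comp.comp hf hg

@[fun_prop]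
theorem Computable.decideNatLe {f g : α → ℕ} (hf : Computable f) (hg : Computable g) :
    Computable fun x => decide (f x ≤ g x) :=
  (Primrec.nat_le.decide).to_comp.comp hf hg

@[fun_prop]
theorem Computable.decideEq [DecidableEq β] {f g : α → β} (hf : Computable f)
    (hg : Computable g) : Computable fun x => decide (f x = g x) :=
  (Primrec.eq.decide).to_comp.comp hf hg

@[fun_prop]
theorem Computable.bif {c : α → Bool} {f g : α → β} (hc : Computable c) (hf : Computable f)
    (hg : Computable g) : Computable fun x => bif c x then f x else g x :=
  Computable.cond hc hf hg

@[fun_prop]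
theorem Computable.optionGetD {f : α → Option β} {g : α → β} (hf : Computable f)
    (hg : Computable g) : Computable fun x => (f x).getD (g x) :=
  Computable.option_getD hf hg

@[fun_prop]
theorem Computable.optionIsSome {f : α → Option β} (hf : Computable f) :
    Computable fun x => (f x).isSome :=
  Primrec.option_isSome.to_comp.comp hf

@[fun_prop]
theorem Computable.encodeComp {f : α → β} (hf : Computable f) :
    Computable fun x => Encodable.encode (f x) :=
  Computable.encode.comp hf

@[fun_prop]
theorem Computable.decodeComp {f : α → ℕ} (hf : Computable f) :
    Computable fun x => (Encodable.decode (f x) : Option β) :=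
  Computable.decode.comp hf

@[fun_prop]
theorem Computable.listGetD {f : α → List β} {n : α → ℕ} {d : β} (hf : Computable f)
    (hn : Computable n) : Computable fun x => (f x).getD (n x) d :=
  (Primrec.list_getD d).to_comp.comp hf hn

@[fun_prop]
theorem Computable.listLength {f : α → List β} (hf : Computable f) :
    Computable fun x => (f x).length :=
  Primrec.list_length.to_comp.comp hf

@[fun_prop]
theorem Computable.listCons {f : α → β} {g : α → List β} (hf : Computable f)
    (hg : Computable g) : Computable fun x => f x :: g x :=
  Primrec.list_cons.to_comp.comp hf hg

@[fun_prop]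
theorem Computable.listAppend {f g : α → List β} (hf : Computable f)
    (hg : Computable g) : Computable fun x => f x ++ g x :=
  Primrec.list_append.to_comp.comp hf hg

theorem Computable.natRec {n : α → ℕ} {f : α → β} {h : α → ℕ → β → β} (hn : Computable n)
    (hf : Computable f) (hh : Computable fun p : α × ℕ × β => h p.1 p.2.1 p.2.2) :
    Computable fun x => (Nat.rec (f x) (h x) (n x) : β) :=
  Computable.nat_rec (h := fun x q => h x q.1 q.2) hn hf hh

/-! ### Integers -/

theorem Computable.intOfNat : Computable (fun n : ℕ => (n : ℤ)) := by
  refine (Computable.encode_iff.1 ?_)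
  refine (Primrec.nat_double.to_comp).of_eq fun n => ?_
  rfl

theorem Computable.intNegSucc : Computable (fun n : ℕ => Int.negSucc n) := by
  refine (Computable.encode_iff.1 ?_)
  refine (Primrec.nat_double_succ.to_comp).of_eq fun n => ?_
  rfl

@[fun_prop]
theorem Computable.intCast {f : α → ℕ} (hf : Computable f) : Computable fun x => (f x : ℤ) :=
  Computable.intOfNat.comp hf

theorem Computable.intToNat : Computable Int.toNat := by
  have h : Computable fun z : ℤ =>
      bif decide (Encodable.encode z % 2 = 0) then Encodable.encode z / 2 else 0 := by fun_prop
  refine h.of_eq fun z => ?_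
  cases z with
  | ofNat n =>
    have : Encodable.encode (n : ℤ) = 2 * n := rfl
    simp [this]
  | negSucc n =>
    have : Encodable.encode (Int.negSucc n) = 2 * n + 1 := rfl
    simp [this, Nat.add_mod]

theorem Computable.intNegToNat : Computable fun z : ℤ => (-z).toNat := by
  have h : Computable fun z : ℤ =>
      bif decide (Encodable.encode z % 2 = 0) then 0 else Encodable.encode z / 2 + 1 := by
    fun_prop
  refine h.of_eq fun z => ?_
  cases z with
  | ofNat n =>
    have : Encodable.encode (n : ℤ) = 2 * n := rfl
    simp [this]
  | negSucc n =>
    have : Encodable.encode (Int.negSucc n) = 2 * n + 1 := rfl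
    simp [this, Nat.add_mod]
    omega

theorem Computable.natCastSub {f g : α → ℕ} (hf : Computable f) (hg : Computable g) :
    Computable fun x => (f x : ℤ) - (g x : ℤ) := by
  have h : Computable fun x : α =>
      bif decide (g x ≤ f x) then ((f x - g x : ℕ) : ℤ) else Int.negSucc (g x - f x - 1) := by
    have := Computable.intNegSucc
    fun_prop
  refine h.of_eq fun x => ?_
  by_cases hx : g x ≤ f x
  · simp [hx]
  · simp only [hx, decide_false, cond_false, Int.negSucc_eq]
    omega

@[fun_prop]
theorem Computable.intAdd {f g : α → ℤ} (hf : Computable f) (hg : Computable g) :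
    Computable fun x => f x + g x := by
  have h1 := Computable.intToNat
  have h2 := Computable.intNegToNat
  have h := Computable.natCastSub (α := α) (f := fun x => (f x).toNat + (g x).toNat)
    (g := fun x => (-f x).toNat + (-g x).toNat)
    (Computable.natAdd (h1.comp hf) (h1.comp hg)) (Computable.natAdd (h2.comp hf) (h2.comp hg))
  exact h.of_eq fun x => by push_cast; omega

@[fun_prop]
theorem Computable.intNeg {f : α → ℤ} (hf : Computable f) : Computable fun x => -f x := by
  have h := Computable.natCastSub (Computable.intNegToNat.comp hf) (Computable.intToNat.comp hf)
  exact h.of_eq fun x => by omega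

@[fun_prop]
theorem Computable.intSub {f g : α → ℤ} (hf : Computable f) (hg : Computable g) :
    Computable fun x => f x - g x := by
  simp only [sub_eq_add_neg]
  fun_prop

@[fun_prop]
theorem Computable.intMul {f g : α → ℤ} (hf : Computable f) (hg : Computable g) :
    Computable fun x => f x * g x := by
  have h1 := Computable.intToNat
  have h2 := Computable.intNegToNat
  have a := h1.comp hf
  have b := h2.comp hf
  have c := h1.comp hg
  have d := h2.comp hg
  have h := Computable.natCastSub
    (Computable.natAdd (Computable.natMul a c) (Computable.natMul b d))
    (Computable.natAdd (Computable.natMul a d) (Computable.natMul b c))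
  refine h.of_eq fun x => ?_
  have e1 : f x = ((f x).toNat : ℤ) - ((-f x).toNat : ℤ) := by omega
  have e2 : g x = ((g x).toNat : ℤ) - ((-g x).toNat : ℤ) := by omega
  conv_rhs => rw [e1, e2]
  push_cast
  ring

@[fun_prop]
theorem Computable.intNatAbs {f : α → ℤ} (hf : Computable f) :
    Computable fun x => (f x).natAbs := by
  have h := Computable.natAdd (Computable.intToNat.comp hf) (Computable.intNegToNat.comp hf)
  exact h.of_eq fun x => by omega

/-! ### Bounded sums, quantifiers and searches -/

/-- `f 0 && ⋯ && f (n - 1)` -/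
def ball (n : ℕ) (f : ℕ → Bool) : Bool := Nat.rec true (fun i acc => acc && f i) n

/-- The list `[f 0, …, f (n - 1)]`. -/
def tabulate {β : Type*} (n : ℕ) (f : ℕ → β) : List β := Nat.rec [] (fun i acc => acc ++ [f i]) n

/-- Boolean comparison, kept apart from `decide` so that `fun_prop` does not unfold instances. -/
def leB (a b : ℕ) : Bool := decide (a ≤ b)

@[simp] theorem leB_eq_true {a b : ℕ} : leB a b = true ↔ a ≤ b := by simp [leB]

/-- Boolean equality of natural numbers. -/
def eqB (a b : ℕ) : Bool := decide (a = b)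

@[simp] theorem eqB_eq_true {a b : ℕ} : eqB a b = true ↔ a = b := by simp [eqB]

/-- The sum `f 0 + ⋯ + f (n - 1)`. -/
def natSum (n : ℕ) (f : ℕ → ℕ) : ℕ := Nat.rec 0 (fun i acc => acc + f i) n

/-- The least `i < n` with `f i`, or `n` if there is none. -/
def firstBelow (n : ℕ) (f : ℕ → Bool) : ℕ :=
  Nat.rec 0 (fun i acc => bif decide (acc < i) || f acc then acc else i + 1) n

@[fun_prop]
theorem Computable.leB {f g : α → ℕ} (hf : Computable f) (hg : Computable g) :
    Computable fun x => leB (f x) (g x) :=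
  Computable.decideNatLe hf hg

@[fun_prop]
theorem Computable.eqB {f g : α → ℕ} (hf : Computable f) (hg : Computable g) :
    Computable fun x => eqB (f x) (g x) :=
  Computable.decideEq hf hg

@[fun_prop]
theorem Computable.ball {n : α → ℕ} {f : α → ℕ → Bool} (hn : Computable n)
    (hf : Computable fun p : α × ℕ => f p.1 p.2) :
    Computable fun x => ball (n x) fun i => f x i :=
  Computable.natRec hn (Computable.const true) (h := fun x i acc => acc && f x i) (by fun_prop)

@[fun_prop]
theorem Computable.tabulate {n : α → ℕ} {f : α → ℕ → β} (hn : Computable n)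
    (hf : Computable fun p : α × ℕ => f p.1 p.2) :
    Computable fun x => tabulate (n x) fun i => f x i :=
  Computable.natRec hn (Computable.const []) (h := fun x i acc => acc ++ [f x i]) (by fun_prop)

@[fun_prop]
theorem Computable.natSum {n : α → ℕ} {f : α → ℕ → ℕ} (hn : Computable n)
    (hf : Computable fun p : α × ℕ => f p.1 p.2) :
    Computable fun x => natSum (n x) fun i => f x i :=
  Computable.natRec hn (Computable.const 0) (h := fun x i acc => acc + f x i) (by fun_prop)

@[fun_prop]
theorem Computable.firstBelow {n : α → ℕ} {f : α → ℕ → Bool} (hn : Computable n)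
    (hf : Computable fun p : α × ℕ => f p.1 p.2) :
    Computable fun x => firstBelow (n x) fun i => f x i :=
  Computable.natRec hn (Computable.const 0)
    (h := fun x i acc => bif decide (acc < i) || f x acc then acc else i + 1) (by fun_prop)

@[simp]
theorem ball_eq_true {n : ℕ} {f : ℕ → Bool} : ball n f = true ↔ ∀ i < n, f i = true := by
  induction n with
  | zero => simp [ball]
  | succ n ih =>
    have : ball (n + 1) f = (ball n f && f n) := rfl
    rw [this, Bool.and_eq_true, ih, Nat.forall_lt_succ_right]

theorem tabulate_eq {β : Type*} (n : ℕ) (f : ℕ → β) : tabulate n f = (List.range n).map f := by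
  induction n with
  | zero => rfl
  | succ n ih =>
    have : tabulate (n + 1) f = tabulate n f ++ [f n] := rfl
    rw [this, ih, List.range_succ, List.map_append, List.map_singleton]

theorem natSum_eq (n : ℕ) (f : ℕ → ℕ) : natSum n f = ∑ i ∈ Finset.range n, f i := by
  induction n with
  | zero => rfl
  | succ n ih => rw [Finset.sum_range_succ, ← ih]; rfl

theorem firstBelow_spec (n : ℕ) (f : ℕ → Bool) :
    (firstBelow n f ≤ n) ∧ (∀ i < firstBelow n f, f i = false) ∧
      (firstBelow n f < n → f (firstBelow n f) = true) := by
  induction n with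
  | zero => simp [firstBelow]
  | succ n ih =>
    have e : firstBelow (n + 1) f =
      bif decide (firstBelow n f < n) || f (firstBelow n f) then firstBelow n f else n + 1 := rfl
    obtain ⟨h1, h2, h3⟩ := ih
    by_cases hlt : firstBelow n f < n
    · have : firstBelow (n + 1) f = firstBelow n f := by rw [e]; simp [hlt]
      rw [this]
      exact ⟨by omega, h2, fun _ => h3 hlt⟩
    · have hn : firstBelow n f = n := by omega
      rw [hn] at e h2
      cases hf : f n with
      | true =>
        have : firstBelow (n + 1) f = n := by rw [e]; simp [hf]
        rw [this]
        exact ⟨by omega, h2, fun _ => hf⟩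
      | false =>
        have : firstBelow (n + 1) f = n + 1 := by rw [e]; simp [hf]
        rw [this]
        refine ⟨le_rfl, fun i hi => ?_, fun h => absurd h (lt_irrefl _)⟩
        rcases Nat.lt_succ_iff_lt_or_eq.1 hi with h | h
        · exact h2 i h
        · rw [h, hf]

theorem firstBelow_lt {n i : ℕ} {f : ℕ → Bool} (hi : i < n) (hf : f i = true) :
    firstBelow n f < n ∧ f (firstBelow n f) = true ∧ firstBelow n f ≤ i := by
  obtain ⟨h1, h2, h3⟩ := firstBelow_spec n f
  have hle : firstBelow n f ≤ i := by
    by_contra hlt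
    rw [h2 i (by omega)] at hf
    cases hf
  exact ⟨by omega, h3 (by omega), hle⟩

/-- Unbounded search for a number satisfying a computable predicate is computable if it always
succeeds. -/
theorem Computable.exists_search {p : α → ℕ → Bool}
    (hp : Computable fun q : α × ℕ => p q.1 q.2) (hex : ∀ x, ∃ n, p x n = true) :
    ∃ f : α → ℕ, Computable f ∧ ∀ x, p x (f x) = true := by
  have h := Computable.find (P := fun x n => p x n = true)
    (ComputablePred.computable_iff.2 ⟨_, hp, rfl⟩) hex
  exact ⟨_, h, fun x => Nat.find_spec (hex x)⟩

end Basic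

/-! ### Formal Gaussian rationals -/

/-- `(x, y, d)` stands for the Gaussian rational `(x + y i) / (d + 1)`. The representation is not
unique, so that arithmetic needs no normalization. -/
abbrev GRat : Type := ℤ × ℤ × ℕ

namespace GRat

/-- The complex number represented by a formal Gaussian rational. -/
noncomputable def val (g : GRat) : ℂ := ((g.1 : ℂ) + (g.2.1 : ℂ) * Complex.I) / ((g.2.2 : ℂ) + 1)

/-- An integer as a formal Gaussian rational. -/
def ofInt (z : ℤ) : GRat := (z, 0, 0)

/-- Addition over the product of the denominators `a.2.2 + 1` and `b.2.2 + 1`. -/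
def add (a b : GRat) : GRat :=
  (a.1 * (b.2.2 + 1 : ℕ) + b.1 * (a.2.2 + 1 : ℕ),
    a.2.1 * (b.2.2 + 1 : ℕ) + b.2.1 * (a.2.2 + 1 : ℕ), (a.2.2 + 1) * (b.2.2 + 1) - 1)

def mul (a b : GRat) : GRat :=
  (a.1 * b.1 - a.2.1 * b.2.1, a.1 * b.2.1 + a.2.1 * b.1, (a.2.2 + 1) * (b.2.2 + 1) - 1)

def neg (a : GRat) : GRat := (-a.1, -a.2.1, a.2.2)

def conj (a : GRat) : GRat := (a.1, -a.2.1, a.2.2)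

def sub (a b : GRat) : GRat := a.add b.neg

/-- `g` represents zero. -/
def isZero (g : GRat) : Bool := decide (g.1 = 0) && decide (g.2.1 = 0)

/-- The number represented by `g` has absolute value less than `1 / T`; no condition if `T = 0`. -/
def small (g : GRat) (T : ℕ) : Bool :=
  decide ((g.1.natAbs * g.1.natAbs + g.2.1.natAbs * g.2.1.natAbs) * (T * T) <
    (g.2.2 + 1) * (g.2.2 + 1))

/-- The sum `f 0 + ⋯ + f (n - 1)`. -/
def sum (n : ℕ) (f : ℕ → GRat) : GRat := Nat.rec (ofInt 0) (fun i acc => acc.add (f i)) n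

/-- The power `g ^ n`. -/
def pow (g : GRat) (n : ℕ) : GRat := Nat.rec (ofInt 1) (fun _ acc => acc.mul g) n

theorem den_ne_zero (d : ℕ) : ((d : ℂ) + 1) ≠ 0 := Nat.cast_add_one_ne_zero d

theorem cast_den (a b : ℕ) : (((a + 1) * (b + 1) - 1 : ℕ) : ℂ) + 1 = (a + 1) * (b + 1) := by
  have : (a + 1) * (b + 1) - 1 + 1 = (a + 1) * (b + 1) :=
    Nat.sub_add_cancel (Nat.mul_pos a.succ_pos b.succ_pos)
  exact_mod_cast this

@[simp] theorem val_ofInt (z : ℤ) : (ofInt z).val = z := by simp [val, ofInt]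

@[simp] theorem val_add (a b : GRat) : (a.add b).val = a.val + b.val := by
  have h1 := den_ne_zero a.2.2
  have h2 := den_ne_zero b.2.2
  simp only [val, add, cast_den]
  push_cast
  field_simp
  ring

@[simp] theorem val_mul (a b : GRat) : (a.mul b).val = a.val * b.val := by
  have h1 := den_ne_zero a.2.2
  have h2 := den_ne_zero b.2.2
  simp only [val, mul, cast_den]
  push_cast
  field_simp
  linear_combination (-(a.2.1 : ℂ) * b.2.1) * Complex.I_sq

@[simp] theorem val_neg (a : GRat) : a.neg.val = -a.val := by
  simp only [val, neg]
  push_cast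
  ring

@[simp] theorem val_conj (a : GRat) : a.conj.val = star a.val := by
  simp [val, conj]

@[simp] theorem val_sub (a b : GRat) : (a.sub b).val = a.val - b.val := by
  simp [sub, sub_eq_add_neg]

@[simp] theorem val_sum (n : ℕ) (f : ℕ → GRat) :
    (sum n f).val = ∑ i ∈ Finset.range n, (f i).val := by
  induction n with
  | zero => simp [sum]
  | succ n ih =>
    have : sum (n + 1) f = (sum n f).add (f n) := rfl
    rw [this, val_add, ih, Finset.sum_range_succ]

@[simp] theorem val_pow (g : GRat) (n : ℕ) : (pow g n).val = g.val ^ n := by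
  induction n with
  | zero => simp [pow]
  | succ n ih =>
    have : pow g (n + 1) = (pow g n).mul g := rfl
    rw [this, val_mul, ih, pow_succ]

theorem normSq_val (g : GRat) :
    ‖g.val‖ ^ 2 = ((g.1 : ℝ) ^ 2 + (g.2.1 : ℝ) ^ 2) / ((g.2.2 : ℝ) + 1) ^ 2 := by
  have h1 : ‖(g.1 : ℂ) + (g.2.1 : ℂ) * Complex.I‖ ^ 2 = (g.1 : ℝ) ^ 2 + (g.2.1 : ℝ) ^ 2 := by
    rw [← Complex.normSq_eq_norm_sq, Complex.normSq_apply]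
    simp
    ring
  have h2 : ‖(g.2.2 : ℂ) + 1‖ = (g.2.2 : ℝ) + 1 := by
    have := Complex.norm_natCast (g.2.2 + 1)
    push_cast at this
    exact this
  rw [val, norm_div, div_pow, h1, h2]

theorem small_eq_true {g : GRat} {T : ℕ} : small g T = true ↔ ‖g.val‖ * T < 1 := by
  have hd : (0 : ℝ) < (g.2.2 : ℝ) + 1 := by positivity
  have key : ‖g.val‖ * T < 1 ↔ (‖g.val‖ * T) ^ 2 < 1 := by
    rw [sq_lt_one_iff₀ (by positivity)]
  rw [key, mul_pow, normSq_val, div_mul_eq_mul_div, div_lt_one (by positivity), small,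
    decide_eq_true_iff, ← Nat.cast_lt (α := ℝ)]
  push_cast
  simp only [Nat.cast_natAbs, Int.cast_abs, abs_mul_abs_self]
  simp only [sq]

theorem isZero_eq_true {g : GRat} : isZero g = true ↔ g.val = 0 := by
  have h : g.val = 0 ↔ ‖g.val‖ ^ 2 = 0 := by simp
  rw [h, normSq_val, div_eq_zero_iff, isZero, Bool.and_eq_true, decide_eq_true_iff,
    decide_eq_true_iff]
  have hd : ((g.2.2 : ℝ) + 1) ^ 2 ≠ 0 := by positivity
  simp only [hd, or_false]
  constructor
  · rintro ⟨h1, h2⟩; simp [h1, h2]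
  · intro h0
    have h1 := sq_nonneg (g.1 : ℝ)
    have h2 := sq_nonneg (g.2.1 : ℝ)
    constructor
    · have : (g.1 : ℝ) ^ 2 = 0 := by linarith
      exact_mod_cast pow_eq_zero_iff (two_ne_zero) |>.1 this
    · have : (g.2.1 : ℝ) ^ 2 = 0 := by linarith
      exact_mod_cast pow_eq_zero_iff (two_ne_zero) |>.1 this

/-- Every complex number with rational real and imaginary part is represented. -/
theorem exists_val_eq (a b : ℚ) : ∃ g : GRat, g.val = (a : ℂ) + (b : ℂ) * Complex.I := by
  refine ⟨(a.num * b.den, b.num * a.den, a.den * b.den - 1), ?_⟩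
  have h : ((a.den * b.den - 1 : ℕ) : ℂ) + 1 = a.den * b.den := by
    have : a.den * b.den - 1 + 1 = a.den * b.den :=
      Nat.sub_add_cancel (Nat.mul_pos a.den_pos b.den_pos)
    exact_mod_cast this
  have ha : (a.den : ℂ) ≠ 0 := by exact_mod_cast a.den_nz
  have hb : (b.den : ℂ) ≠ 0 := by exact_mod_cast b.den_nz
  simp only [val, h]
  rw [Rat.cast_def a, Rat.cast_def b]
  push_cast
  field_simp

section Computability
variable {α : Type*} [Primcodable α]

@[fun_prop]
theorem computable_ofInt {f : α → ℤ} (hf : Computable f) : Computable fun x => ofInt (f x) := by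
  unfold ofInt; fun_prop

@[fun_prop]
theorem computable_add {f g : α → GRat} (hf : Computable f) (hg : Computable g) :
    Computable fun x => (f x).add (g x) := by
  unfold add; fun_prop

@[fun_prop]
theorem computable_mul {f g : α → GRat} (hf : Computable f) (hg : Computable g) :
    Computable fun x => (f x).mul (g x) := by
  unfold mul; fun_prop

@[fun_prop]
theorem computable_neg {f : α → GRat} (hf : Computable f) : Computable fun x => (f x).neg := by
  unfold neg; fun_prop

@[fun_prop]
theorem computable_conj {f : α → GRat} (hf : Computable f) :
    Computable fun x => (f x).conj := by
  unfold conj; fun_prop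

@[fun_prop]
theorem computable_sub {f g : α → GRat} (hf : Computable f) (hg : Computable g) :
    Computable fun x => (f x).sub (g x) := by
  unfold sub; fun_prop

@[fun_prop]
theorem computable_isZero {f : α → GRat} (hf : Computable f) :
    Computable fun x => (f x).isZero := by
  unfold isZero; fun_prop

@[fun_prop]
theorem computable_small {f : α → GRat} {T : α → ℕ} (hf : Computable f) (hT : Computable T) :
    Computable fun x => (f x).small (T x) := by
  unfold small; fun_prop

@[fun_prop]
theorem computable_sum {n : α → ℕ} {f : α → ℕ → GRat} (hn : Computable n)
    (hf : Computable fun p : α × ℕ => f p.1 p.2) :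
    Computable fun x => sum (n x) fun i => f x i :=
  Computable.natRec hn (Computable.const (ofInt 0)) (h := fun x i (acc : GRat) => acc.add (f x i))
    (by fun_prop)

@[fun_prop]
theorem computable_pow {f : α → GRat} {n : α → ℕ} (hf : Computable f) (hn : Computable n) :
    Computable fun x => pow (f x) (n x) :=
  Computable.natRec hn (Computable.const (ofInt 1)) (h := fun x _ (acc : GRat) => acc.mul (f x))
    (by fun_prop)

end Computability

end GRat

/-! ### A separation bound for algebraic numbers -/

open Polynomial in
/-- The integer polynomial with the given list of coefficients. -/
noncomputable def listPoly (p : List ℤ) : ℤ[X] :=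
  p.foldr (fun (c : ℤ) (acc : ℤ[X]) => C c + X * acc) 0

/-- The sum of the absolute values of the coefficients, plus one. -/
def height (p : List ℤ) : ℕ := natSum p.length (fun i => (p.getD i 0).natAbs) + 1

theorem height_cons (c : ℤ) (p : List ℤ) : height (c :: p) = c.natAbs + height p := by
  simp only [height, natSum_eq, List.length_cons, Finset.sum_range_succ']
  simp
  ring

theorem aeval_listPoly (p : List ℤ) (z : ℂ) :
    Polynomial.aeval z (listPoly p) = evalCoeffs p z := by
  induction p with
  | nil => simp [listPoly, evalCoeffs]
  | cons c p ih =>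
    simp only [listPoly, evalCoeffs, List.foldr_cons, map_add, map_mul, Polynomial.aeval_X] at ih ⊢
    rw [ih]
    simp

theorem natDegree_listPoly_le (p : List ℤ) : (listPoly p).natDegree ≤ p.length := by
  induction p with
  | nil => simp [listPoly]
  | cons c p ih =>
    simp only [listPoly, List.foldr_cons, List.length_cons] at ih ⊢
    refine (Polynomial.natDegree_add_le _ _).trans (max_le (by simp) ?_)
    refine (Polynomial.natDegree_mul_le).trans ?_
    have := Polynomial.natDegree_X_le (R := ℤ)
    omega

theorem abs_coeff_listPoly_lt (p : List ℤ) (i : ℕ) : |(listPoly p).coeff i| < height p := by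
  induction p generalizing i with
  | nil => simp [listPoly, height]
  | cons c p ih =>
    have e : listPoly (c :: p) = Polynomial.C c + Polynomial.X * listPoly p := rfl
    rw [e, height_cons]
    cases i with
    | zero =>
      have h1 : 0 < height p := by simp [height]
      have h2 := Int.natCast_natAbs c
      simp only [Polynomial.coeff_add, Polynomial.coeff_C_zero, Polynomial.mul_coeff_zero,
        Polynomial.coeff_X_zero, zero_mul, add_zero]
      push_cast
      omega
    | succ i =>
      have h1 := ih i
      have h2 := Int.natCast_natAbs c
      have h3 := abs_nonneg c
      simp only [Polynomial.coeff_add, Polynomial.coeff_C_succ, Polynomial.coeff_X_mul, zero_add]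
      push_cast
      omega

/-- Cauchy's bound for the roots of an integer polynomial. -/
theorem norm_le_of_root {p : List ℤ} (hp : listPoly p ≠ 0) {z : ℂ} (hz : evalCoeffs p z = 0) :
    ‖z‖ ≤ height p + 1 := by
  set P : Polynomial ℂ := (listPoly p).map (Int.castRingHom ℂ) with hP
  have hP0 : P ≠ 0 := (Polynomial.map_ne_zero_iff (RingHom.injective_int _)).2 hp
  have hroot : P.IsRoot z := by
    rw [Polynomial.IsRoot, hP, Polynomial.eval_map, ← hz, ← aeval_listPoly]
    rfl
  have h1 := (hroot.norm_lt_cauchyBound hP0).le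
  have h2 : P.cauchyBound ≤ height p + 1 := by
    unfold Polynomial.cauchyBound
    gcongr
    rw [div_le_iff₀ (by simpa using hP0)]
    have hl : (1 : NNReal) ≤ ‖P.leadingCoeff‖₊ := by
      rw [hP, Polynomial.leadingCoeff_map_of_injective (RingHom.injective_int _)]
      have : (listPoly p).leadingCoeff ≠ 0 := by simpa using hp
      have := Int.one_le_abs this
      rw [← NNReal.coe_le_coe]
      simp only [NNReal.coe_one, coe_nnnorm, eq_intCast, Complex.norm_intCast]
      exact_mod_cast this
    refine le_trans ?_ (le_mul_of_one_le_right (by positivity) hl)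
    refine Finset.sup_le fun i _ => ?_
    have := (abs_coeff_listPoly_lt p i).le
    rw [← NNReal.coe_le_coe]
    simp only [hP, Polynomial.coeff_map, coe_nnnorm, eq_intCast, Complex.norm_intCast,
      NNReal.coe_natCast]
    exact_mod_cast this
  exact_mod_cast NNReal.coe_le_coe.2 (h1.trans h2)

open scoped IntermediateField in
/-- Liouville's inequality: a nonzero algebraic integer is bounded below in terms of an upper bound
for its conjugates and of the degree of a number field containing it, because its norm is a nonzero
integer. -/
theorem inv_pow_le_norm_of_isIntegral (K : IntermediateField ℚ ℂ) [FiniteDimensional ℚ K] (y : K)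
    (hy : IsIntegral ℤ y) (hy0 : y ≠ 0) {B : ℝ} (hB1 : 1 ≤ B)
    (hB : ∀ φ : K →ₐ[ℚ] ℂ, ‖φ y‖ ≤ B) {D : ℕ} (hD : Module.finrank ℚ K ≤ D) :
    (B ^ D)⁻¹ ≤ ‖(y : ℂ)‖ := by
  classical
  have hn := Algebra.norm_eq_prod_embeddings ℚ ℂ y
  have hint : IsIntegral ℤ (Algebra.norm ℚ y) := Algebra.isIntegral_norm ℚ hy
  obtain ⟨k, hk⟩ := IsIntegrallyClosed.isIntegral_iff.1 hint
  have hne : Algebra.norm ℚ y ≠ 0 := by simpa [Algebra.norm_eq_zero_iff] using hy0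
  have hk0 : k ≠ 0 := by
    rintro rfl
    simp at hk
    exact hne hk.symm
  have h1 : (1 : ℝ) ≤ ‖∏ φ : K →ₐ[ℚ] ℂ, φ y‖ := by
    rw [← hn, ← hk]
    simp only [eq_intCast, eq_ratCast, Rat.cast_intCast, Complex.norm_intCast]
    exact_mod_cast Int.one_le_abs hk0
  let ι : K →ₐ[ℚ] ℂ := K.val
  rw [norm_prod, ← Finset.mul_prod_erase _ _ (Finset.mem_univ ι)] at h1
  have h2 : ∏ φ ∈ Finset.univ.erase ι, ‖φ y‖ ≤ B ^ D := by
    calc _ ≤ ∏ φ ∈ Finset.univ.erase ι, B :=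
          Finset.prod_le_prod (fun _ _ => norm_nonneg _) fun φ _ => hB φ
      _ = B ^ (Finset.univ.erase ι).card := Finset.prod_const _
      _ ≤ B ^ D := by
        refine pow_le_pow_right₀ hB1 ((Finset.card_le_univ _).trans ?_)
        rw [AlgHom.card]
        exact hD
  have h3 : ‖ι y‖ = ‖(y : ℂ)‖ := rfl
  rw [h3] at h1
  rw [inv_le_iff_one_le_mul₀ (by positivity)]
  exact h1.trans (mul_le_mul_of_nonneg_left h2 (norm_nonneg _))

/-- A bound for the conjugates in `inv_le_one_sub_normSq`. -/
def conjBound (p : List ℤ) (a b : ℤ) (m : ℕ) : ℕ :=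
  height p ^ 2 * (1 + ((m + 1) * (height p + 1) + a.natAbs + b.natAbs) ^ 2)

/-- A bound for the inverse distance of a root from the boundary of a disc containing it. -/
def sepBound (p : List ℤ) (a b : ℤ) (m : ℕ) : ℕ :=
  height p ^ 2 * conjBound p a b m ^ (2 * p.length * p.length)

open IntermediateField in
theorem finrank_adjoin_root_le {p : List ℤ} (hp : listPoly p ≠ 0) {z : ℂ}
    (hz : evalCoeffs p z = 0) :
    FiniteDimensional ℚ ℚ⟮z⟯ ∧ Module.finrank ℚ ℚ⟮z⟯ ≤ p.length := by
  set P : Polynomial ℚ := (listPoly p).map (Int.castRingHom ℚ) with hP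
  have hP0 : P ≠ 0 := (Polynomial.map_ne_zero_iff (RingHom.injective_int _)).2 hp
  have hroot : Polynomial.aeval z P = 0 := by
    rw [← hz, ← aeval_listPoly, hP]
    exact Polynomial.aeval_map_algebraMap ℚ z (listPoly p)
  have hint : IsIntegral ℚ z := (IsAlgebraic.isIntegral ⟨P, hP0, hroot⟩)
  refine ⟨adjoin.finiteDimensional hint, ?_⟩
  rw [adjoin.finrank hint]
  calc _ ≤ P.natDegree := Polynomial.natDegree_le_of_dvd (minpoly.dvd ℚ z hroot) hP0
    _ ≤ (listPoly p).natDegree := Polynomial.natDegree_map_le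
    _ ≤ _ := natDegree_listPoly_le p

theorem evalCoeffs_conj (p : List ℤ) (z : ℂ) :
    evalCoeffs p (star z) = star (evalCoeffs p z) := by
  induction p with
  | nil => simp [evalCoeffs]
  | cons c p ih =>
    simp only [evalCoeffs, List.foldr_cons] at ih ⊢
    rw [ih]
    simp

open IntermediateField in
/-- A root of an integer polynomial lying in the open unit disc, after the affine substitution that
normalizes the disc of an algebraic code, keeps an explicit distance from the unit circle. -/
theorem inv_le_one_sub_normSq {p : List ℤ} (hp : listPoly p ≠ 0) {z : ℂ}
    (hz : evalCoeffs p z = 0) (a b : ℤ) (m : ℕ)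
    (hu : ‖((m : ℂ) + 1) * z - (a + b * Complex.I)‖ < 1) :
    ((sepBound p a b m : ℕ) : ℝ)⁻¹ ≤ 1 - ‖((m : ℂ) + 1) * z - (a + b * Complex.I)‖ ^ 2 := by
  set u : ℂ := ((m : ℂ) + 1) * z - (a + b * Complex.I) with hudef
  have hz' : evalCoeffs p (star z) = 0 := by rw [evalCoeffs_conj, hz, star_zero]
  have hI : evalCoeffs [1, 0, 1] Complex.I = 0 := by simp [evalCoeffs]
  have hpI : listPoly [1, 0, 1] ≠ 0 := by
    intro h
    have := congrArg (Polynomial.aeval (0 : ℂ)) h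
    simp [aeval_listPoly, evalCoeffs] at this
  obtain ⟨f1, d1⟩ := finrank_adjoin_root_le hp hz
  obtain ⟨f2, d2⟩ := finrank_adjoin_root_le hp hz'
  have hIint : IsIntegral ℚ Complex.I := ⟨Polynomial.X ^ 2 + 1, by monicity!, by simp⟩
  have f3 : FiniteDimensional ℚ ℚ⟮Complex.I⟯ := adjoin.finiteDimensional hIint
  have d3 : Module.finrank ℚ ℚ⟮Complex.I⟯ ≤ 2 := by
    rw [adjoin.finrank hIint]
    have h2 : (Polynomial.X ^ 2 + 1 : Polynomial ℚ).natDegree = 2 := by compute_degree!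
    rw [← h2]
    refine Polynomial.natDegree_le_of_dvd (minpoly.dvd ℚ _ (by simp)) ?_
    intro h0
    rw [h0] at h2
    simp at h2
  set K : IntermediateField ℚ ℂ := (ℚ⟮z⟯ ⊔ ℚ⟮star z⟯) ⊔ ℚ⟮Complex.I⟯ with hK
  have hfin : Module.finrank ℚ K ≤ 2 * p.length * p.length := by
    calc _ ≤ Module.finrank ℚ ↥(ℚ⟮z⟯ ⊔ ℚ⟮star z⟯) * Module.finrank ℚ ℚ⟮Complex.I⟯ :=
          finrank_sup_le _ _
      _ ≤ (p.length * p.length) * 2 :=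
          Nat.mul_le_mul ((finrank_sup_le _ _).trans (Nat.mul_le_mul d1 d2)) d3
      _ = _ := by ring
  have zK : z ∈ K := (le_sup_left.trans le_sup_left : ℚ⟮z⟯ ≤ K) (mem_adjoin_simple_self ℚ z)
  have zK' : star z ∈ K :=
    (le_sup_right.trans le_sup_left : ℚ⟮star z⟯ ≤ K) (mem_adjoin_simple_self ℚ _)
  have IK : Complex.I ∈ K := (le_sup_right : ℚ⟮Complex.I⟯ ≤ K) (mem_adjoin_simple_self ℚ _)
  -- with `l` the leading coefficient, `y = l ^ 2 * (1 - u * star u)` is an algebraic integer of `K`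
  let l : ℤ := (listPoly p).leadingCoeff
  have hl0 : l ≠ 0 := by simpa [l] using hp
  have hlH : |(l : ℝ)| ≤ height p := by exact_mod_cast (abs_coeff_listPoly_lt p _).le
  let zk : K := ⟨z, zK⟩
  let zk' : K := ⟨star z, zK'⟩
  let Ik : K := ⟨Complex.I, IK⟩
  let y : K := l ^ 2 - (((m : K) + 1) * (l * zk) - l * (a + b * Ik)) *
    (((m : K) + 1) * (l * zk') - l * (a - b * Ik))
  have evalK : ∀ w : K, Polynomial.aeval w (listPoly p) = 0 ↔ evalCoeffs p (w : ℂ) = 0 := by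
    intro w
    have h := Polynomial.hom_eval₂ (listPoly p) (algebraMap ℤ K) (algebraMap K ℂ) w
    rw [Subsingleton.elim ((algebraMap K ℂ).comp (algebraMap ℤ K)) (algebraMap ℤ ℂ)] at h
    rw [← aeval_listPoly]
    change algebraMap K ℂ (Polynomial.aeval w (listPoly p)) =
      Polynomial.aeval (w : ℂ) (listPoly p) at h
    rw [← h, map_eq_zero_iff _ (algebraMap K ℂ).injective]
  have i1 : IsIntegral ℤ ((l : K) * zk) := by
    have := isIntegral_leadingCoeff_smul (listPoly p) zk ((evalK zk).2 hz)
    rwa [zsmul_eq_mul] at this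
  have i2 : IsIntegral ℤ ((l : K) * zk') := by
    have := isIntegral_leadingCoeff_smul (listPoly p) zk' ((evalK zk').2 hz')
    rwa [zsmul_eq_mul] at this
  have i3 : IsIntegral ℤ Ik := by
    refine ⟨Polynomial.X ^ 2 + 1, by monicity!, ?_⟩
    have : Ik ^ 2 + 1 = 0 := Subtype.ext (by simp [Ik])
    simpa using this
  have icast : ∀ k : ℤ, IsIntegral ℤ (k : K) := fun k => isIntegral_algebraMap (x := k)
  have icastn : IsIntegral ℤ ((m : K) + 1) := by exact_mod_cast icast (m + 1)
  have iy : IsIntegral ℤ y := by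
    refine ((icast l).pow 2).sub (((icastn.mul i1).sub ((icast l).mul
      ((icast a).add ((icast b).mul i3)))).mul ((icastn.mul i2).sub ((icast l).mul
      ((icast a).sub ((icast b).mul i3)))))
  have yval : (y : ℂ) = (l : ℂ) ^ 2 * ((1 - ‖u‖ ^ 2 : ℝ) : ℂ) := by
    have h1 : (‖u‖ ^ 2 : ℂ) = u * star u := by
      rw [← Complex.conj_mul', mul_comm]; rfl
    have h2 : star u = ((m : ℂ) + 1) * star z - (a - b * Complex.I) := by
      simp [u]
      ring
    have h3 : (y : ℂ) = (l : ℂ) ^ 2 - (((m : ℂ) + 1) * (l * z) - l * (a + b * Complex.I)) *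
      (((m : ℂ) + 1) * (l * star z) - l * (a - b * Complex.I)) := by simp [y, zk, zk', Ik]
    push_cast
    rw [h3, h1, h2, hudef]
    ring
  have hpos : 0 < 1 - ‖u‖ ^ 2 := by
    have := sq_lt_one_iff₀ (norm_nonneg u) |>.2 hu
    linarith
  have hlc : (l : ℂ) ≠ 0 := by exact_mod_cast hl0
  have hy0 : y ≠ 0 := by
    intro h
    have : (y : ℂ) = 0 := by rw [h]; rfl
    rw [yval] at this
    have h3 : ((1 - ‖u‖ ^ 2 : ℝ) : ℂ) ≠ 0 := by exact_mod_cast hpos.ne'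
    exact (mul_ne_zero (pow_ne_zero 2 hlc) h3) this
  have hH1 : (1 : ℝ) ≤ height p := by
    have : 1 ≤ height p := by simp [height]
    exact_mod_cast this
  have hB1 : (1 : ℝ) ≤ (conjBound p a b m : ℕ) := by
    have : 1 ≤ conjBound p a b m := by
      unfold conjBound
      have h1 : 1 ≤ height p := by simp [height]
      exact Nat.mul_pos (by positivity) (by positivity)
    exact_mod_cast this
  have hB : ∀ φ : K →ₐ[ℚ] ℂ, ‖φ y‖ ≤ (conjBound p a b m : ℕ) := by
    intro φ
    -- an embedding takes `z` and `star z` to roots of the same polynomial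
    have r : ∀ w : K, evalCoeffs p (w : ℂ) = 0 → ‖φ w‖ ≤ height p + 1 := by
      intro w hw
      refine norm_le_of_root hp ?_
      rw [← aeval_listPoly]
      have h1 := (evalK w).2 hw
      have := Polynomial.aeval_algHom_apply (φ.restrictScalars ℤ) w (listPoly p)
      rw [h1, map_zero] at this
      exact this
    have hφI : ‖φ Ik‖ = 1 := by
      have h1 : φ Ik ^ 2 = -1 := by
        rw [← map_pow]
        have : Ik ^ 2 = -1 := Subtype.ext (by simp [Ik])
        rw [this]; simp
      have h2 : ‖φ Ik‖ ^ 2 = 1 := by rw [← norm_pow, h1]; simp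
      exact (pow_eq_one_iff_of_nonneg (norm_nonneg _) two_ne_zero).1 h2
    have r1 := r zk hz
    have r2 := r zk' hz'
    have e : φ y = (l : ℂ) ^ 2 * (1 - (((m : ℂ) + 1) * φ zk - (a + b * φ Ik)) *
      (((m : ℂ) + 1) * φ zk' - (a - b * φ Ik))) := by
      simp only [y, map_sub, map_mul, map_add, map_pow, map_intCast, map_natCast, map_one]
      ring
    have hm : ‖(m : ℂ) + 1‖ = m + 1 := by
      have := Complex.norm_natCast (m + 1)
      push_cast at this
      exact this
    set U : ℝ := ((m : ℝ) + 1) * (height p + 1) + |(a : ℝ)| + |(b : ℝ)| with hU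
    have b1 : ‖((m : ℂ) + 1) * φ zk - (a + b * φ Ik)‖ ≤ U := by
      refine (norm_sub_le _ _).trans ?_
      have := norm_add_le (a : ℂ) (b * φ Ik)
      rw [norm_mul, hm]
      rw [norm_mul, hφI, Complex.norm_intCast, Complex.norm_intCast] at this
      have := mul_le_mul_of_nonneg_left r1 (by positivity : (0 : ℝ) ≤ m + 1)
      linarith
    have b2 : ‖((m : ℂ) + 1) * φ zk' - (a - b * φ Ik)‖ ≤ U := by
      refine (norm_sub_le _ _).trans ?_
      have := norm_sub_le (a : ℂ) (b * φ Ik)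
      rw [norm_mul, hm]
      rw [norm_mul, hφI, Complex.norm_intCast, Complex.norm_intCast] at this
      have := mul_le_mul_of_nonneg_left r2 (by positivity : (0 : ℝ) ≤ m + 1)
      linarith
    rw [e, norm_mul, norm_pow, Complex.norm_intCast]
    have c : ((conjBound p a b m : ℕ) : ℝ) = (height p : ℝ) ^ 2 * (1 + U ^ 2) := by
      simp [conjBound, hU, Nat.cast_natAbs]
    rw [c]
    have hU0 : 0 ≤ U := by positivity
    have b3 := (norm_sub_le (1 : ℂ) ((((m : ℂ) + 1) * φ zk - (a + b * φ Ik)) *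
      (((m : ℂ) + 1) * φ zk' - (a - b * φ Ik))))
    rw [norm_mul, norm_one] at b3
    have b4 := mul_le_mul b1 b2 (norm_nonneg _) hU0
    gcongr
    linarith
  have key := inv_pow_le_norm_of_isIntegral K y iy hy0 hB1 hB hfin
  rw [yval, norm_mul, norm_pow, Complex.norm_intCast, Complex.norm_real, Real.norm_of_nonneg
    hpos.le] at key
  have h2 : |(l : ℝ)| ^ 2 * (1 - ‖u‖ ^ 2) ≤ (height p : ℝ) ^ 2 * (1 - ‖u‖ ^ 2) := by gcongr
  have hB0 : (0 : ℝ) < (conjBound p a b m : ℕ) := by linarith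
  rw [sepBound]
  push_cast
  rw [mul_inv, ← div_eq_inv_mul, div_le_iff₀' (by positivity)]
  exact key.trans h2

/-! ### Approximating the number denoted by a code -/

/-- The value of an integer polynomial at a Gaussian rational. -/
def GRat.evalPoly (p : List ℤ) (g : GRat) : GRat :=
  GRat.sum p.length fun i => (GRat.ofInt (p.getD i 0)).mul (g.pow i)

theorem evalCoeffs_eq_sum (p : List ℤ) (z : ℂ) :
    evalCoeffs p z = ∑ i ∈ Finset.range p.length, ((p.getD i 0 : ℤ) : ℂ) * z ^ i := by
  induction p with
  | nil => simp [evalCoeffs]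
  | cons c p ih =>
    have e : evalCoeffs (c :: p) z = c + z * evalCoeffs p z := rfl
    rw [e, ih, List.length_cons, Finset.sum_range_succ', Finset.mul_sum]
    simp only [List.getD_cons_succ, List.getD_cons_zero, pow_zero, mul_one]
    rw [add_comm]
    congr 1
    exact Finset.sum_congr rfl fun i _ => by ring

@[simp]
theorem GRat.val_evalPoly (p : List ℤ) (g : GRat) :
    (GRat.evalPoly p g).val = evalCoeffs p g.val := by
  rw [evalPoly, val_sum, evalCoeffs_eq_sum]
  simp

/-- A small value of a nonzero integer polynomial forces a root nearby. -/
theorem exists_root_near {p : List ℤ} (hp : listPoly p ≠ 0) {q : ℂ} {W : ℝ} (hW : 1 ≤ W)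
    (hq : ‖evalCoeffs p q‖ * W ^ p.length < 1) :
    ∃ z, evalCoeffs p z = 0 ∧ ‖q - z‖ * W < 1 := by
  set P : Polynomial ℂ := (listPoly p).map (Int.castRingHom ℂ) with hP
  have hP0 : P ≠ 0 := (Polynomial.map_ne_zero_iff (RingHom.injective_int _)).2 hp
  have heval : ∀ z, P.eval z = evalCoeffs p z := by
    intro z
    rw [hP, Polynomial.eval_map, ← aeval_listPoly]
    rfl
  -- otherwise each factor `q - r` with `r` a root is at least `1 / W` in absolute value
  by_contra! hcon
  have hfar : ∀ s : Multiset ℂ, (∀ r ∈ s, 1 ≤ ‖q - r‖ * W) →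
      1 ≤ ‖(s.map fun r => q - r).prod‖ * W ^ s.card := by
    intro s
    induction s using Multiset.induction_on with
    | empty => simp
    | cons r s ih =>
      intro h
      have h1 := h r (Multiset.mem_cons_self r s)
      have h2 := ih fun r' hr' => h r' (Multiset.mem_cons_of_mem hr')
      rw [Multiset.map_cons, Multiset.prod_cons, norm_mul, Multiset.card_cons, pow_succ]
      calc (1 : ℝ) ≤ (‖q - r‖ * W) * (‖(s.map fun r => q - r).prod‖ * W ^ s.card) :=
            one_le_mul_of_one_le_of_one_le h1 h2
        _ = _ := by ring
  have hroots := hfar P.roots fun r hr => by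
    refine hcon r ?_
    rw [← heval]
    exact (Polynomial.mem_roots hP0).1 hr
  have hsplit := (IsAlgClosed.splits P).eval_eq_prod_roots q
  have hl : (1 : ℝ) ≤ ‖P.leadingCoeff‖ := by
    rw [hP, Polynomial.leadingCoeff_map_of_injective (RingHom.injective_int _)]
    have : (listPoly p).leadingCoeff ≠ 0 := by simpa using hp
    have := Int.one_le_abs this
    simp only [eq_intCast, Complex.norm_intCast]
    exact_mod_cast this
  have hcard : P.roots.card ≤ p.length :=
    (Polynomial.card_roots' P).trans (Polynomial.natDegree_map_le.trans (natDegree_listPoly_le p))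
  have : (1 : ℝ) ≤ ‖evalCoeffs p q‖ * W ^ p.length := by
    rw [← heval, hsplit, norm_mul]
    calc (1 : ℝ) ≤ ‖(P.roots.map fun r => q - r).prod‖ * W ^ P.roots.card := hroots
      _ ≤ (‖P.leadingCoeff‖ * ‖(P.roots.map fun r => q - r).prod‖) * W ^ p.length := by
        gcongr
        exact le_mul_of_one_le_left (norm_nonneg _) hl
  linarith

/-- A Lipschitz constant for an integer polynomial on a disc. -/
theorem norm_evalCoeffs_sub_le (p : List ℤ) {R : ℝ} (hR : 1 ≤ R) {q z : ℂ} (hq : ‖q‖ ≤ R)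
    (hz : ‖z‖ ≤ R) :
    ‖evalCoeffs p q - evalCoeffs p z‖ ≤ height p * p.length * R ^ p.length * ‖q - z‖ := by
  have hpow : ∀ i : ℕ, ‖q ^ i - z ^ i‖ ≤ i * R ^ i * ‖q - z‖ := by
    intro i
    induction i with
    | zero => simp
    | succ i ih =>
      have e : q ^ (i + 1) - z ^ (i + 1) = q * (q ^ i - z ^ i) + (q - z) * z ^ i := by ring
      rw [e]
      refine (norm_add_le _ _).trans ?_
      rw [norm_mul, norm_mul, norm_pow]
      have h1 : ‖q‖ * ‖q ^ i - z ^ i‖ ≤ R * (i * R ^ i * ‖q - z‖) := by gcongr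
      have h2 : ‖q - z‖ * ‖z‖ ^ i ≤ ‖q - z‖ * (R ^ i * R) := by
        gcongr
        exact (pow_le_pow_left₀ (norm_nonneg _) hz i).trans
          (le_mul_of_one_le_right (by positivity) hR)
      push_cast
      rw [pow_succ]
      linarith
  rw [evalCoeffs_eq_sum, evalCoeffs_eq_sum, ← Finset.sum_sub_distrib]
  refine (norm_sum_le _ _).trans ?_
  have hterm : ∀ i ∈ Finset.range p.length,
      ‖((p.getD i 0 : ℤ) : ℂ) * q ^ i - ((p.getD i 0 : ℤ) : ℂ) * z ^ i‖ ≤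
        ((p.getD i 0).natAbs : ℝ) * (p.length * R ^ p.length * ‖q - z‖) := by
    intro i hi
    have hi' := Finset.mem_range.1 hi
    rw [← mul_sub, norm_mul, Complex.norm_intCast, Nat.cast_natAbs, Int.cast_abs]
    refine mul_le_mul_of_nonneg_left ((hpow i).trans ?_) (abs_nonneg _)
    gcongr
  refine (Finset.sum_le_sum hterm).trans ?_
  rw [← Finset.sum_mul]
  have : (∑ i ∈ Finset.range p.length, ((p.getD i 0).natAbs : ℝ)) ≤ height p := by
    rw [height, natSum_eq]
    push_cast
    linarith
  calc _ ≤ (height p : ℝ) * (p.length * R ^ p.length * ‖q - z‖) := by gcongr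
    _ = _ := by ring

namespace AlgCode

/-- The reciprocal of the precision to which roots are located by the grid search. -/
def fineness (α : AlgCode) (T : ℕ) : ℕ :=
  2 * (α.2.2.2 + 1) * (2 * sepBound α.1 α.2.1 α.2.2.1 α.2.2.2) * (T + 1)

/-- An auxiliary factor making the grid fine enough for the polynomial to be small at some point
of the grid. -/
def gridFactor (α : AlgCode) (T : ℕ) : ℕ :=
  2 * (height α.1 * α.1.length * (α.2.1.natAbs + α.2.2.1.natAbs + 1) ^ α.1.length) *
    fineness α T ^ α.1.length + 2

/-- Half the number of grid points on a side of the square circumscribed about the disc. -/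
def gridSize (α : AlgCode) (T : ℕ) : ℕ := fineness α T * gridFactor α T

/-- The first integer coordinate of a grid point, relative to the centre of the disc. -/
def gridX (M j : ℕ) : ℤ := ((j / (2 * M + 1) : ℕ) : ℤ) - (M : ℤ)

/-- The second integer coordinate of a grid point, relative to the centre of the disc. -/
def gridY (M j : ℕ) : ℤ := ((j % (2 * M + 1) : ℕ) : ℤ) - (M : ℤ)

/-- The square of the absolute value of a Gaussian integer. -/
def sqAbs (x y : ℤ) : ℕ := x.natAbs ^ 2 + y.natAbs ^ 2

/-- The grid points, numbered by pairs coded as one number. -/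
def gridPoint (α : AlgCode) (T j : ℕ) : GRat :=
  (α.2.1 * (gridSize α T : ℤ) + gridX (gridSize α T) j,
    α.2.2.1 * (gridSize α T : ℤ) + gridY (gridSize α T) j,
    (α.2.2.2 + 1) * gridSize α T - 1)

/-- The squared radius, in grid units, of the disc in which grid points are accepted. -/
def gridRadiusSq (α : AlgCode) (T : ℕ) : ℕ :=
  (gridSize α T - (α.2.2.2 + 1) * gridFactor α T) ^ 2

/-- The test for a grid point: it is well inside the disc, and the polynomial is small there. -/
def gridTest (α : AlgCode) (T j : ℕ) : Bool :=
  decide (sqAbs (gridX (gridSize α T) j) (gridY (gridSize α T) j) ≤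
    gridRadiusSq α T) &&
  (GRat.evalPoly α.1 (gridPoint α T j)).small (fineness α T ^ α.1.length)

/-- An approximation to precision `1 / (T + 1)` of the number denoted by the code `α`; a value
without meaning if `α` denotes nothing. -/
def approx (α : AlgCode) (T : ℕ) : GRat :=
  gridPoint α T (firstBelow ((2 * gridSize α T + 1) * (2 * gridSize α T + 1)) (gridTest α T))

section Computability
variable {β : Type*} [Primcodable β]

@[fun_prop]
theorem computable_height {f : β → List ℤ} (hf : Computable f) :
    Computable fun x => height (f x) := by
  unfold height; fun_prop

@[fun_prop]
theorem computable_evalPoly {f : β → List ℤ} {g : β → GRat} (hf : Computable f)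
    (hg : Computable g) : Computable fun x => GRat.evalPoly (f x) (g x) := by
  unfold GRat.evalPoly; fun_prop

@[fun_prop]
theorem computable_sepBound {p : β → List ℤ} {a b : β → ℤ} {m : β → ℕ} (hp : Computable p)
    (ha : Computable a) (hb : Computable b) (hm : Computable m) :
    Computable fun x => sepBound (p x) (a x) (b x) (m x) := by
  unfold sepBound conjBound; fun_prop

@[fun_prop]
theorem computable_fineness {f : β → AlgCode} {T : β → ℕ} (hf : Computable f)
    (hT : Computable T) : Computable fun x => fineness (f x) (T x) := by
  unfold fineness; fun_prop

@[fun_prop]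
theorem computable_gridFactor {f : β → AlgCode} {T : β → ℕ} (hf : Computable f)
    (hT : Computable T) : Computable fun x => gridFactor (f x) (T x) := by
  unfold gridFactor; fun_prop

@[fun_prop]
theorem computable_gridSize {f : β → AlgCode} {T : β → ℕ} (hf : Computable f)
    (hT : Computable T) : Computable fun x => gridSize (f x) (T x) := by
  unfold gridSize; fun_prop

@[fun_prop]
theorem computable_gridRadiusSq {f : β → AlgCode} {T : β → ℕ} (hf : Computable f)
    (hT : Computable T) : Computable fun x => gridRadiusSq (f x) (T x) := by
  unfold gridRadiusSq; fun_prop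

@[fun_prop]
theorem computable_gridX {M j : β → ℕ} (hM : Computable M) (hj : Computable j) :
    Computable fun x => gridX (M x) (j x) := by
  unfold gridX; fun_prop

@[fun_prop]
theorem computable_gridY {M j : β → ℕ} (hM : Computable M) (hj : Computable j) :
    Computable fun x => gridY (M x) (j x) := by
  unfold gridY; fun_prop

@[fun_prop]
theorem computable_sqAbs {x y : β → ℤ} (hx : Computable x) (hy : Computable y) :
    Computable fun i => sqAbs (x i) (y i) := by
  unfold sqAbs; fun_prop

@[fun_prop]
theorem computable_gridPoint {f : β → AlgCode} {T j : β → ℕ} (hf : Computable f)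
    (hT : Computable T) (hj : Computable j) :
    Computable fun x => gridPoint (f x) (T x) (j x) := by
  unfold gridPoint; fun_prop

@[fun_prop]
theorem computable_gridTest {f : β → AlgCode} {T j : β → ℕ} (hf : Computable f)
    (hT : Computable T) (hj : Computable j) :
    Computable fun x => gridTest (f x) (T x) (j x) := by
  exact Computable.boolAnd (Computable.decideNatLe (by fun_prop) (by fun_prop)) (by fun_prop)

@[fun_prop]
theorem computable_approx {f : β → AlgCode} {T : β → ℕ} (hf : Computable f)
    (hT : Computable T) : Computable fun x => approx (f x) (T x) := by
  unfold approx; fun_prop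

end Computability

theorem listPoly_ne_zero_of_denotes {α : AlgCode} {z : ℂ} (h : α.Denotes z) :
    listPoly α.1 ≠ 0 := by
  -- otherwise two distinct points of the disc would both be roots
  intro h0
  have hall : ∀ w, evalCoeffs α.1 w = 0 := fun w => by rw [← aeval_listPoly, h0, map_zero]
  have hm : (0 : ℝ) < (α.2.2.2 : ℝ) + 1 := by positivity
  have hr : ∀ t : ℝ, 0 ≤ t → t < 1 → AlgCode.IsRootInDisc α
      (((α.2.1 : ℂ) + (α.2.2.1 : ℂ) * Complex.I) / ((α.2.2.2 : ℂ) + 1) +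
        ((t / ((α.2.2.2 : ℝ) + 1) : ℝ) : ℂ)) := by
    intro t ht0 ht
    refine ⟨hall _, ?_⟩
    rw [add_sub_cancel_left, Complex.norm_real, Real.norm_of_nonneg (by positivity)]
    gcongr
  have e1 := h.2 _ (hr 0 le_rfl one_pos)
  have e2 := h.2 _ (hr 2⁻¹ (by norm_num) (by norm_num))
  rw [← e1] at e2
  have e3 := add_left_cancel e2
  have e4 := Complex.ofReal_injective e3
  field_simp at e4
  norm_num at e4

theorem one_le_sepBound (p : List ℤ) (a b : ℤ) (m : ℕ) : 1 ≤ sepBound p a b m := by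
  have h1 : 0 < height p := by simp [height]
  unfold sepBound conjBound
  exact Nat.pos_of_ne_zero (by positivity)

theorem norm_gridPoint_sub (α : AlgCode) (T j : ℕ) (hM : 0 < gridSize α T) :
    (gridPoint α T j).val - ((α.2.1 : ℂ) + (α.2.2.1 : ℂ) * Complex.I) / ((α.2.2.2 : ℂ) + 1) =
      ((gridX (gridSize α T) j : ℂ) +
        (gridY (gridSize α T) j : ℂ) * Complex.I) /
        (((α.2.2.2 : ℂ) + 1) * gridSize α T) := by
  have hd : (((α.2.2.2 + 1) * gridSize α T - 1 : ℕ) : ℂ) + 1 =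
      ((α.2.2.2 : ℂ) + 1) * gridSize α T := by
    have : (α.2.2.2 + 1) * gridSize α T - 1 + 1 = (α.2.2.2 + 1) * gridSize α T :=
      Nat.sub_add_cancel (Nat.mul_pos (Nat.succ_pos _) hM)
    exact_mod_cast this
  have h1 := GRat.den_ne_zero α.2.2.2
  have h2 : (gridSize α T : ℂ) ≠ 0 := by exact_mod_cast hM.ne'
  simp only [GRat.val, gridPoint]
  rw [hd]
  push_cast
  field_simp
  ring

theorem sq_norm_int_add_int_mul_I (x y : ℤ) :
    ‖(x : ℂ) + (y : ℂ) * Complex.I‖ ^ 2 = sqAbs x y := by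
  rw [← Complex.normSq_eq_norm_sq, Complex.normSq_apply]
  simp [sqAbs, sq]

/-- Every point accepted by the grid test is close to the number denoted by the code: there is a
root near the point, and the point lies so far inside the disc that this root lies in the disc
too. -/
theorem norm_sub_lt_of_gridTest {α : AlgCode} {z : ℂ} (h : α.Denotes z) {T j : ℕ}
    (hj : gridTest α T j = true) : ‖(gridPoint α T j).val - z‖ * (T + 1) < 1 := by
  rw [gridTest, gridRadiusSq, Bool.and_eq_true, decide_eq_true_iff, GRat.small_eq_true,
    GRat.val_evalPoly] at hj
  obtain ⟨hj1, hj2⟩ := hj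
  have hs := one_le_sepBound α.1 α.2.1 α.2.2.1 α.2.2.2
  have hW1 : (α.2.2.2 + 1) * (T + 1) ≤ fineness α T := by
    unfold fineness
    nlinarith [Nat.mul_le_mul (Nat.le_refl ((α.2.2.2 + 1) * (T + 1))) hs]
  have hF : 0 < gridFactor α T := by simp [gridFactor]
  have hW0 : 0 < fineness α T := lt_of_lt_of_le (by positivity) hW1
  have hM : 0 < gridSize α T := Nat.mul_pos hW0 hF
  have hW2 : (α.2.2.2 + 1) ≤ fineness α T := le_trans (Nat.le_mul_of_pos_right _ T.succ_pos) hW1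
  have hW3 : (T + 1) ≤ fineness α T := le_trans (Nat.le_mul_of_pos_left _ (Nat.succ_pos _)) hW1
  push_cast at hj2
  obtain ⟨w, hw0, hw⟩ := exists_root_near (listPoly_ne_zero_of_denotes h)
    (by exact_mod_cast hW0 : (1 : ℝ) ≤ fineness α T) hj2
  have hWpos : (0 : ℝ) < fineness α T := by exact_mod_cast hW0
  have hFpos : (0 : ℝ) < gridFactor α T := by exact_mod_cast hF
  have hmpos : (0 : ℝ) < (α.2.2.2 : ℝ) + 1 := by positivity
  have hMr : (gridSize α T : ℝ) = fineness α T * gridFactor α T := by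
    exact_mod_cast (rfl : gridSize α T = fineness α T * gridFactor α T)
  have hdisc : ‖w - ((α.2.1 : ℂ) + (α.2.2.1 : ℂ) * Complex.I) / ((α.2.2.2 : ℂ) + 1)‖ <
      1 / ((α.2.2.2 : ℝ) + 1) := by
    have t := norm_sub_le_norm_sub_add_norm_sub w (gridPoint α T j).val
      (((α.2.1 : ℂ) + (α.2.2.1 : ℂ) * Complex.I) / ((α.2.2.2 : ℂ) + 1))
    have t1 : ‖w - (gridPoint α T j).val‖ < 1 / fineness α T := by
      rw [norm_sub_rev, lt_div_iff₀ hWpos]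
      exact hw
    have t2 : ‖(gridPoint α T j).val -
        ((α.2.1 : ℂ) + (α.2.2.1 : ℂ) * Complex.I) / ((α.2.2.2 : ℂ) + 1)‖ ≤
        1 / ((α.2.2.2 : ℝ) + 1) - 1 / fineness α T := by
      rw [norm_gridPoint_sub α T j hM, norm_div, norm_mul]
      have hm : ‖(α.2.2.2 : ℂ) + 1‖ = α.2.2.2 + 1 := by
        have := Complex.norm_natCast (α.2.2.2 + 1)
        push_cast at this
        exact this
      rw [hm, Complex.norm_natCast]
      have hsub : (α.2.2.2 + 1) * gridFactor α T ≤ gridSize α T :=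
        Nat.mul_le_mul_right _ hW2
      have hx := sq_norm_int_add_int_mul_I
        (gridX (gridSize α T) j) (gridY (gridSize α T) j)
      have hx2 := Nat.cast_le (α := ℝ).2 hj1
      rw [← hx] at hx2
      push_cast [Nat.cast_sub hsub] at hx2
      have hsub' : ((α.2.2.2 : ℝ) + 1) * gridFactor α T ≤ gridSize α T := by exact_mod_cast hsub
      have hx3 := abs_le_of_sq_le_sq' hx2 (by linarith)
      rw [div_le_iff₀ (by rw [hMr]; positivity)]
      refine hx3.2.trans (le_of_eq ?_)
      rw [hMr]
      field_simp
    linarith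
  have hwz : w = z := h.2 w ⟨hw0, hdisc⟩
  rw [hwz] at hw
  refine lt_of_le_of_lt ?_ hw
  gcongr
  exact_mod_cast hW3

set_option maxHeartbeats 1000000 in
/-- Some point passes the grid test. -/
theorem exists_gridTest {α : AlgCode} {z : ℂ} (h : α.Denotes z) (T : ℕ) :
    ∃ j < (2 * gridSize α T + 1) * (2 * gridSize α T + 1), gridTest α T j = true := by
  have hp := listPoly_ne_zero_of_denotes h
  obtain ⟨⟨hz0, hzd⟩, -⟩ := h
  obtain ⟨p, a, b, m⟩ := α
  simp only at hz0 hzd hp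
  have hs := one_le_sepBound p a b m
  set W := fineness (p, a, b, m) T with hWdef
  set F := gridFactor (p, a, b, m) T with hFdef
  set M := gridSize (p, a, b, m) T with hMdef
  have hMWF : M = W * F := rfl
  have hWeq : W = 2 * (m + 1) * (2 * sepBound p a b m) * (T + 1) := rfl
  have hFeq : F = 2 * (height p * p.length * (a.natAbs + b.natAbs + 1) ^ p.length) *
    W ^ p.length + 2 := rfl
  clear_value W F M
  have hmpos : (0 : ℝ) < (m : ℝ) + 1 := by positivity
  have hmC := GRat.den_ne_zero m
  have hm : ‖(m : ℂ) + 1‖ = m + 1 := by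
    have := Complex.norm_natCast (m + 1)
    push_cast at this
    exact this
  set c : ℂ := (a : ℂ) + (b : ℂ) * Complex.I with hc
  set u : ℂ := ((m : ℂ) + 1) * z - c with hu
  have hu1 : ‖u‖ < 1 := by
    have e : u = ((m : ℂ) + 1) * (z - c / ((m : ℂ) + 1)) := by rw [hu]; field_simp
    rw [e, norm_mul, hm]
    calc _ < ((m : ℝ) + 1) * (1 / ((m : ℝ) + 1)) := by gcongr
      _ = 1 := by field_simp
  have hsep := inv_le_one_sub_normSq hp hz0 a b m hu1
  have hspos : (0 : ℝ) < sepBound p a b m := by exact_mod_cast hs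
  have hu2 : ‖u‖ ≤ 1 - 1 / (2 * sepBound p a b m) := by
    have h0 := norm_nonneg u
    have e : (1 : ℝ) / (2 * sepBound p a b m) = (sepBound p a b m : ℝ)⁻¹ / 2 := by field_simp
    rw [e]
    nlinarith
  have hF2 : 2 ≤ F := by rw [hFeq]; omega
  have hWpos : 0 < W := by rw [hWeq]; positivity
  have hMpos : 0 < M := by
    rw [hMWF]
    exact Nat.mul_pos hWpos (by omega)
  have hMr : (M : ℝ) = W * F := by exact_mod_cast hMWF
  have hWr : (W : ℝ) = 2 * (m + 1) * (2 * sepBound p a b m) * (T + 1) := by exact_mod_cast hWeq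
  have hMpos' : (0 : ℝ) < M := by exact_mod_cast hMpos
  have hWpos' : (0 : ℝ) < W := by exact_mod_cast hWpos
  have hF2' : (2 : ℝ) ≤ F := by exact_mod_cast hF2
  -- the grid point is obtained by rounding `M * u` down
  set x : ℤ := ⌊(M : ℝ) * u.re⌋ with hx
  set y : ℤ := ⌊(M : ℝ) * u.im⌋ with hy
  have hbound : ∀ t : ℝ, |t| ≤ ‖u‖ → -(M : ℤ) ≤ ⌊(M : ℝ) * t⌋ ∧ ⌊(M : ℝ) * t⌋ ≤ (M : ℤ) := by
    intro t ht
    have ht' := abs_le.1 (ht.trans hu1.le)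
    constructor
    · rw [Int.le_floor]; push_cast; nlinarith
    · have : (M : ℝ) * t ≤ (M : ℤ) := by push_cast; nlinarith
      exact (Int.floor_le_floor this).trans (by rw [Int.floor_intCast])
  obtain ⟨hx1, hx2⟩ := hbound u.re (Complex.abs_re_le_norm u)
  obtain ⟨hy1, hy2⟩ := hbound u.im (Complex.abs_im_le_norm u)
  rw [← hx] at hx1 hx2
  rw [← hy] at hy1 hy2
  have hround : ‖((x : ℂ) + (y : ℂ) * Complex.I) - M * u‖ ≤ 2 := by
    refine (Complex.norm_le_abs_re_add_abs_im _).trans ?_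
    have e1 : (((x : ℂ) + (y : ℂ) * Complex.I) - M * u).re = x - M * u.re := by simp
    have e2 : (((x : ℂ) + (y : ℂ) * Complex.I) - M * u).im = y - M * u.im := by simp
    rw [e1, e2]
    have a1 := Int.floor_le ((M : ℝ) * u.re)
    have a2 := Int.lt_floor_add_one ((M : ℝ) * u.re)
    have a3 := Int.floor_le ((M : ℝ) * u.im)
    have a4 := Int.lt_floor_add_one ((M : ℝ) * u.im)
    rw [← hx] at a1 a2
    rw [← hy] at a3 a4
    have b1 : |(x : ℝ) - M * u.re| ≤ 1 := abs_le.2 ⟨by linarith, by linarith⟩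
    have b2 : |(y : ℝ) - M * u.im| ≤ 1 := abs_le.2 ⟨by linarith, by linarith⟩
    linarith
  have hxn : ((x + M).toNat : ℤ) = x + M := Int.toNat_of_nonneg (by omega)
  have hyn : ((y + M).toNat : ℤ) = y + M := Int.toNat_of_nonneg (by omega)
  have hylt : (y + M).toNat < 2 * M + 1 := by omega
  have hxlt : (x + M).toNat < 2 * M + 1 := by omega
  set j := (2 * M + 1) * (x + M).toNat + (y + M).toNat with hj
  have hdiv : j / (2 * M + 1) = (x + M).toNat := by
    rw [hj, Nat.mul_add_div (by omega), Nat.div_eq_of_lt hylt, add_zero]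
  have hmod : j % (2 * M + 1) = (y + M).toNat := by
    rw [hj, Nat.mul_add_mod, Nat.mod_eq_of_lt hylt]
  have ex : gridX M j = x := by rw [gridX, hdiv, hxn]; ring
  have ey : gridY M j = y := by rw [gridY, hmod, hyn]; ring
  refine ⟨j, ?_, ?_⟩
  · rw [hj]
    calc (2 * M + 1) * (x + M).toNat + (y + M).toNat
        < (2 * M + 1) * (x + M).toNat + (2 * M + 1) := by omega
      _ = (2 * M + 1) * ((x + M).toNat + 1) := by ring
      _ ≤ (2 * M + 1) * (2 * M + 1) := Nat.mul_le_mul_left _ (by omega)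
  -- the separation bound leaves room for the rounding
  have hnorm : ‖(x : ℂ) + (y : ℂ) * Complex.I‖ ≤ M - (m + 1) * F := by
    have h1 : ‖(x : ℂ) + (y : ℂ) * Complex.I‖ ≤
        ‖((x : ℂ) + (y : ℂ) * Complex.I) - M * u‖ + ‖(M : ℂ) * u‖ := by
      have := norm_add_le (((x : ℂ) + (y : ℂ) * Complex.I) - M * u) (M * u)
      rwa [sub_add_cancel] at this
    rw [norm_mul, Complex.norm_natCast] at h1
    have h2 : (M : ℝ) * ‖u‖ ≤ M * (1 - 1 / (2 * sepBound p a b m)) := by gcongr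
    have h3 : (M : ℝ) * (1 / (2 * sepBound p a b m)) = 2 * ((m + 1) * (T + 1) * F) := by
      rw [hMr, hWr]
      field_simp
    have h4 : ((m : ℝ) + 1) * F ≤ (m + 1) * (T + 1) * F := by
      have : ((m : ℝ) + 1) * 1 ≤ (m + 1) * (T + 1) := by
        gcongr
        have : (0 : ℝ) ≤ T := by positivity
        linarith
      nlinarith
    have h5 : (2 : ℝ) ≤ (m + 1) * F := by
      have : (0 : ℝ) ≤ m := by positivity
      nlinarith
    rw [mul_sub, h3] at h2
    linarith
  rw [gridTest, gridRadiusSq, Bool.and_eq_true, decide_eq_true_iff, GRat.small_eq_true,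
    GRat.val_evalPoly]
  constructor
  · simp only [← hMdef, ← hFdef]
    rw [ex, ey, ← Nat.cast_le (α := ℝ), ← sq_norm_int_add_int_mul_I]
    have hsub : (m + 1) * F ≤ M := by
      have := (norm_nonneg _).trans hnorm
      have h' : ((m + 1) * F : ℝ) ≤ M := by linarith
      exact_mod_cast h'
    push_cast [Nat.cast_sub hsub]
    exact pow_le_pow_left₀ (norm_nonneg _) hnorm 2
  · have hq := norm_gridPoint_sub (p, a, b, m) T j (by rw [← hMdef]; exact hMpos)
    simp only [← hMdef] at hq
    rw [ex, ey, ← hc] at hq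
    set q := (gridPoint (p, a, b, m) T j).val with hqdef
    have hz' : z = c / ((m : ℂ) + 1) + M * u / (((m : ℂ) + 1) * M) := by
      have hMC : (M : ℂ) ≠ 0 := by exact_mod_cast hMpos.ne'
      rw [hu]; field_simp; ring
    have hqz : ‖q - z‖ ≤ 2 / ((m + 1) * M) := by
      have e : q - z = (((x : ℂ) + (y : ℂ) * Complex.I) - M * u) / (((m : ℂ) + 1) * M) := by
        rw [sub_div, ← hq]
        conv_lhs => rw [hz']
        ring
      rw [e, norm_div, norm_mul, hm, Complex.norm_natCast]
      gcongr
    have hcn : ‖c / ((m : ℂ) + 1)‖ ≤ (a.natAbs + b.natAbs : ℕ) := by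
      rw [norm_div, hm]
      refine (div_le_self (norm_nonneg _) (by linarith [Nat.cast_nonneg (α := ℝ) m])).trans ?_
      refine (norm_add_le _ _).trans ?_
      simp [Nat.cast_natAbs]
    set R : ℝ := ((a.natAbs + b.natAbs + 1 : ℕ) : ℝ) with hR
    have hR1 : 1 ≤ R := by
      rw [hR]
      push_cast
      linarith [Nat.cast_nonneg (α := ℝ) a.natAbs, Nat.cast_nonneg (α := ℝ) b.natAbs]
    have hin : ∀ w : ℂ, ‖w - c / ((m : ℂ) + 1)‖ ≤ 1 → ‖w‖ ≤ R := by
      intro w hw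
      have := norm_add_le (w - c / ((m : ℂ) + 1)) (c / ((m : ℂ) + 1))
      rw [sub_add_cancel] at this
      rw [hR]
      push_cast at hcn ⊢
      linarith
    have hzR : ‖z‖ ≤ R := by
      refine hin z (hzd.le.trans ?_)
      rw [div_le_one hmpos]
      linarith [Nat.cast_nonneg (α := ℝ) m]
    have hqR : ‖q‖ ≤ R := by
      refine hin q ?_
      rw [hq, norm_div, norm_mul, hm, Complex.norm_natCast, div_le_one (by positivity)]
      have h1 : (M : ℝ) ≤ (m + 1) * M := by nlinarith [Nat.cast_nonneg (α := ℝ) m]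
      have h2 : (0 : ℝ) ≤ (m + 1) * F := by positivity
      linarith
    -- the polynomial vanishes at `z`, and the grid factor dominates its Lipschitz constant
    have hlip := norm_evalCoeffs_sub_le p hR1 hqR hzR
    rw [hz0, sub_zero] at hlip
    set Lp : ℝ := height p * p.length * R ^ p.length with hLp
    have hLp0 : 0 ≤ Lp := by positivity
    have hFr : (F : ℝ) = 2 * Lp * W ^ p.length + 2 := by
      rw [hFeq, hLp, hR]; push_cast; ring
    rw [← hWdef]
    push_cast
    calc ‖evalCoeffs p q‖ * (W : ℝ) ^ p.length
        ≤ (Lp * (2 / ((m + 1) * M))) * W ^ p.length := by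
          gcongr
          exact hlip.trans (by gcongr)
      _ = (2 * Lp * W ^ p.length) / ((m + 1) * M) := by ring
      _ < 1 := by
          rw [div_lt_one (by positivity)]
          have h1 : (1 : ℝ) ≤ W := by exact_mod_cast hWpos
          have h2 : (F : ℝ) ≤ M := by rw [hMr]; nlinarith
          have h3 : (M : ℝ) ≤ (m + 1) * M := by nlinarith [Nat.cast_nonneg (α := ℝ) m]
          linarith

/-- The number denoted by a code is approximated to any precision. -/
theorem norm_approx_sub_lt {α : AlgCode} {z : ℂ} (h : α.Denotes z) (T : ℕ) :
    ‖(approx α T).val - z‖ * (T + 1) < 1 := by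
  obtain ⟨j, hj, hjt⟩ := exists_gridTest h T
  exact norm_sub_lt_of_gridTest h (firstBelow_lt hj hjt).2.1

end AlgCode

/-! ### Density of Gaussian rational orthonormal families -/

/-- The field of Gaussian rationals. -/
def gaussianRationals : Subfield ℂ where
  carrier := {z | ∃ a b : ℚ, z = (a : ℂ) + (b : ℂ) * Complex.I}
  mul_mem' := by
    rintro _ _ ⟨a, b, rfl⟩ ⟨c, d, rfl⟩
    refine ⟨a * c - b * d, a * d + b * c, ?_⟩
    push_cast
    linear_combination ((b : ℂ) * d) * Complex.I_sq
  one_mem' := ⟨1, 0, by simp⟩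
  add_mem' := by
    rintro _ _ ⟨a, b, rfl⟩ ⟨c, d, rfl⟩
    exact ⟨a + c, b + d, by push_cast; ring⟩
  zero_mem' := ⟨0, 0, by simp⟩
  neg_mem' := by
    rintro _ ⟨a, b, rfl⟩
    exact ⟨-a, -b, by push_cast; ring⟩
  inv_mem' := by
    rintro _ ⟨a, b, rfl⟩
    refine ⟨a / (a ^ 2 + b ^ 2), -b / (a ^ 2 + b ^ 2), ?_⟩
    by_cases h : a ^ 2 + b ^ 2 = 0
    · have ha : a = 0 := by nlinarith [sq_nonneg a, sq_nonneg b]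
      have hb : b = 0 := by nlinarith [sq_nonneg a, sq_nonneg b]
      simp [ha, hb]
    · have hc : ((a : ℂ) ^ 2 + (b : ℂ) ^ 2) ≠ 0 := by exact_mod_cast h
      have hab : (a : ℂ) + b * Complex.I ≠ 0 := by
        intro h0
        apply hc
        have : ((a : ℂ) + b * Complex.I) * ((a : ℂ) - b * Complex.I) = 0 := by rw [h0, zero_mul]
        linear_combination this + (b : ℂ) ^ 2 * Complex.I_sq
      refine inv_eq_of_mul_eq_one_right ?_
      push_cast
      field_simp
      linear_combination (-(b : ℂ) ^ 2) * Complex.I_sq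

theorem star_mem_gaussianRationals {z : ℂ} (hz : z ∈ gaussianRationals) :
    star z ∈ gaussianRationals := by
  obtain ⟨a, b, rfl⟩ := hz
  exact ⟨a, -b, by simp⟩

theorem exists_val_of_mem {z : ℂ} (hz : z ∈ gaussianRationals) : ∃ g : GRat, g.val = z := by
  obtain ⟨a, b, rfl⟩ := hz
  exact GRat.exists_val_eq a b

theorem dense_gaussianRationals : Dense (gaussianRationals : Set ℂ) := by
  intro z
  rw [Metric.mem_closure_iff]
  intro ε hε
  obtain ⟨a, ha⟩ := exists_rat_near z.re (half_pos hε)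
  obtain ⟨b, hb⟩ := exists_rat_near z.im (half_pos hε)
  refine ⟨(a : ℂ) + (b : ℂ) * Complex.I, ⟨a, b, rfl⟩, ?_⟩
  rw [dist_eq_norm]
  refine lt_of_le_of_lt (Complex.norm_le_abs_re_add_abs_im _) ?_
  simp only [Complex.sub_re, Complex.add_re, Complex.ratCast_re, Complex.mul_re, Complex.I_re,
    mul_zero, Complex.ratCast_im, Complex.I_im, mul_one, sub_self, add_zero, Complex.sub_im,
    Complex.add_im, Complex.mul_im, zero_add]
  linarith

section Cayley

variable {n : Type*} [Fintype n] [DecidableEq n]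

theorem det_mem_subfield (S : Subfield ℂ) {A : Matrix n n ℂ} (hA : ∀ i j, A i j ∈ S) :
    A.det ∈ S := by
  rw [Matrix.det_apply]
  refine sum_mem fun σ _ => ?_
  rw [Units.smul_def]
  exact zsmul_mem (prod_mem fun i _ => hA _ _) _

theorem inv_mem_subfield (S : Subfield ℂ) {A : Matrix n n ℂ} (hA : ∀ i j, A i j ∈ S) (i j : n) :
    A⁻¹ i j ∈ S := by
  rw [Matrix.inv_def, Matrix.smul_apply, smul_eq_mul, Ring.inverse_eq_inv']
  refine S.mul_mem (S.inv_mem (det_mem_subfield S hA)) ?_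
  rw [Matrix.adjugate_apply]
  refine det_mem_subfield S fun k l => ?_
  rw [Matrix.updateRow_apply]
  split_ifs
  · rw [Pi.single_apply]
    split_ifs
    exacts [S.one_mem, S.zero_mem]
  · exact hA k l

theorem mul_mem_subfield {n : Type*} [Fintype n] (S : Subfield ℂ) {A B : Matrix n n ℂ}
    (hA : ∀ i j, A i j ∈ S) (hB : ∀ i j, B i j ∈ S) (i j : n) : (A * B) i j ∈ S := by
  rw [Matrix.mul_apply]
  exact sum_mem fun k _ => S.mul_mem (hA _ _) (hB _ _)

theorem one_mem_subfield {n : Type*} [DecidableEq n] (S : Subfield ℂ) (i j : n) :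
    (1 : Matrix n n ℂ) i j ∈ S := by
  rw [Matrix.one_apply]
  split_ifs
  exacts [S.one_mem, S.zero_mem]

/-- The Cayley transform `(1 - A) (1 + A)⁻¹`. -/
noncomputable def cayley (A : Matrix n n ℂ) : Matrix n n ℂ := (1 - A) * (1 + A)⁻¹

theorem isUnit_one_add_of_skew {A : Matrix n n ℂ} (hA : A.conjTranspose = -A) :
    IsUnit (1 + A).det := by
  have h : (1 + A).conjTranspose * (1 + A) = 1 + A.conjTranspose * A := by
    rw [Matrix.conjTranspose_add, Matrix.conjTranspose_one, hA]
    noncomm_ring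
  have hpd : ((1 + A).conjTranspose * (1 + A)).PosDef := by
    rw [h]
    exact Matrix.PosDef.one.add_posSemidef (Matrix.posSemidef_conjTranspose_mul_self A)
  have := (Matrix.isUnit_iff_isUnit_det _).1 hpd.isUnit
  rw [Matrix.det_mul] at this
  exact isUnit_of_mul_isUnit_right this

theorem cayley_unitary {A : Matrix n n ℂ} (hA : A.conjTranspose = -A) :
    (cayley A).conjTranspose * cayley A = 1 := by
  have h1 := isUnit_one_add_of_skew hA
  have h2 : IsUnit (1 - A).det := by
    have := isUnit_one_add_of_skew (A := -A) (by rw [Matrix.conjTranspose_neg, hA])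
    rwa [← sub_eq_add_neg] at this
  have hc : (1 + A) * (1 - A) = (1 - A) * (1 + A) := by noncomm_ring
  rw [cayley, Matrix.conjTranspose_mul, Matrix.conjTranspose_nonsing_inv, Matrix.conjTranspose_sub,
    Matrix.conjTranspose_add, Matrix.conjTranspose_one, hA, sub_neg_eq_add, ← sub_eq_add_neg]
  calc (1 - A)⁻¹ * (1 + A) * ((1 - A) * (1 + A)⁻¹)
      = (1 - A)⁻¹ * ((1 + A) * (1 - A)) * (1 + A)⁻¹ := by simp only [mul_assoc]
    _ = ((1 - A)⁻¹ * (1 - A)) * ((1 + A) * (1 + A)⁻¹) := by rw [hc]; simp only [mul_assoc]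
    _ = 1 := by rw [Matrix.nonsing_inv_mul _ h2, Matrix.mul_nonsing_inv _ h1, one_mul]

/-- The Cayley transform is an involution on unitary matrices without eigenvalue `-1`, and takes
skew-Hermitian values there. -/
theorem cayley_cayley {U : Matrix n n ℂ} (hU : U.conjTranspose * U = 1) (h : IsUnit (1 + U).det) :
    (cayley U).conjTranspose = -cayley U ∧ cayley (cayley U) = U := by
  have hU' : U * U.conjTranspose = 1 := mul_eq_one_comm.1 hU
  have hc : (1 + U) * (1 - U) = (1 - U) * (1 + U) := by noncomm_ring
  have hinv := Matrix.mul_nonsing_inv _ h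
  have hinv' := Matrix.nonsing_inv_mul _ h
  have hcomm : (1 + U)⁻¹ * (1 - U) = (1 - U) * (1 + U)⁻¹ := by
    calc (1 + U)⁻¹ * (1 - U) = (1 + U)⁻¹ * ((1 - U) * (1 + U)) * (1 + U)⁻¹ := by
          rw [mul_assoc, mul_assoc, hinv, mul_one]
      _ = _ := by rw [← hc, ← mul_assoc, hinv', one_mul]
  constructor
  · rw [cayley, Matrix.conjTranspose_mul, Matrix.conjTranspose_nonsing_inv,
      Matrix.conjTranspose_sub, Matrix.conjTranspose_add, Matrix.conjTranspose_one]
    have e1 : 1 + U.conjTranspose = U.conjTranspose * (1 + U) := by rw [mul_add, mul_one, hU]; abel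
    have e2 : 1 - U.conjTranspose = -(U.conjTranspose * (1 - U)) := by
      rw [mul_sub, mul_one, hU]; abel
    have e3 : (U.conjTranspose)⁻¹ = U := Matrix.inv_eq_right_inv hU
    rw [e1, e2, Matrix.mul_inv_rev, e3, mul_neg, ← hcomm]
    congr 1
    rw [mul_assoc, ← mul_assoc U, hU', one_mul]
  · have e1 : 1 + cayley U = (2 : ℂ) • (1 + U)⁻¹ := by
      have : (1 + cayley U) = ((1 + U) + (1 - U)) * (1 + U)⁻¹ := by rw [add_mul, hinv, cayley]
      rw [this, two_smul, ← one_mul (1 + U)⁻¹, ← add_mul, one_mul]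
      congr 1
      abel
    have e2 : 1 - cayley U = (2 : ℂ) • (U * (1 + U)⁻¹) := by
      have : (1 - cayley U) = ((1 + U) - (1 - U)) * (1 + U)⁻¹ := by rw [sub_mul, hinv, cayley]
      rw [this, two_smul, ← add_mul]
      congr 1
      abel
    have e3 : (1 + cayley U)⁻¹ = (2⁻¹ : ℂ) • (1 + U) := by
      refine Matrix.inv_eq_right_inv ?_
      rw [e1, Matrix.smul_mul, Matrix.mul_smul, hinv', smul_smul]
      norm_num
    rw [cayley, e2, e3, Matrix.smul_mul, Matrix.mul_smul, smul_smul, mul_assoc, hinv']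
    norm_num

/-- The unitary matrices with Gaussian rational entries. -/
def rationalUnitaries (n : Type*) [Fintype n] [DecidableEq n] : Set (Matrix n n ℂ) :=
  {V | V.conjTranspose * V = 1 ∧ ∀ i j, V i j ∈ gaussianRationals}

theorem mem_closure_rationalUnitaries_of_isUnit {U : Matrix n n ℂ}
    (hU : U.conjTranspose * U = 1) (h : IsUnit (1 + U).det) :
    U ∈ closure (rationalUnitaries n) := by
  obtain ⟨hA, hcc⟩ := cayley_cayley hU h
  set A := cayley U
  -- the skew-Hermitian part of a rational approximation of `A` is again rational
  let f : Matrix n n ℂ → Matrix n n ℂ := fun B => cayley ((2⁻¹ : ℂ) • (B - B.conjTranspose))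
  have hskew : ∀ B : Matrix n n ℂ, ((2⁻¹ : ℂ) • (B - B.conjTranspose)).conjTranspose =
      -((2⁻¹ : ℂ) • (B - B.conjTranspose)) := by
    intro B
    rw [Matrix.conjTranspose_smul, Matrix.conjTranspose_sub, Matrix.conjTranspose_conjTranspose,
      ← smul_neg, neg_sub]
    simp
  have hfA : f A = U := by
    simp only [f]
    rw [hA, sub_neg_eq_add, ← two_smul ℂ A, smul_smul]
    norm_num
    exact hcc
  have hcont : ContinuousAt f A := by
    have h1 : Continuous fun B : Matrix n n ℂ => (2⁻¹ : ℂ) • (B - B.conjTranspose) := by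
      fun_prop
    have h2 : ∀ B : Matrix n n ℂ, B.conjTranspose = -B → ContinuousAt cayley B := by
      intro B hB
      have h3 : ContinuousAt (fun C : Matrix n n ℂ => (1 + C)⁻¹) B := by
        refine ContinuousAt.comp (g := fun C : Matrix n n ℂ => C⁻¹) ?_ (by fun_prop)
        refine continuousAt_matrix_inv _ ?_
        have : (Ring.inverse : ℂ → ℂ) = fun z => z⁻¹ := funext Ring.inverse_eq_inv
        rw [this]
        exact continuousAt_inv₀ (isUnit_one_add_of_skew hB).ne_zero
      exact ContinuousAt.mul (f := fun C : Matrix n n ℂ => 1 - C) (by fun_prop) h3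
    exact ContinuousAt.comp (g := cayley) (h2 _ (hskew A)) h1.continuousAt
  have hdense : Dense {B : Matrix n n ℂ | ∀ i j, B i j ∈ gaussianRationals} := by
    have := dense_pi (Set.univ : Set n) (s := fun _ => Set.pi (Set.univ : Set n)
      fun _ => (gaussianRationals : Set ℂ))
      (fun _ _ => dense_pi _ fun _ _ => dense_gaussianRationals)
    refine Dense.mono ?_ this
    intro B hB i j
    exact hB i trivial j trivial
  have hmem := hcont.continuousWithinAt.mem_closure_image (hdense A)
  rw [hfA] at hmem
  refine closure_mono ?_ hmem
  rintro _ ⟨B, hB, rfl⟩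
  refine ⟨cayley_unitary (hskew B), ?_⟩
  have h2 : (2⁻¹ : ℂ) ∈ gaussianRationals := ⟨2⁻¹, 0, by simp⟩
  have hB' : ∀ i j, ((2⁻¹ : ℂ) • (B - B.conjTranspose)) i j ∈ gaussianRationals := by
    intro i j
    rw [Matrix.smul_apply, Matrix.sub_apply, Matrix.conjTranspose_apply, smul_eq_mul]
    exact mul_mem h2 (sub_mem (hB i j) (star_mem_gaussianRationals (hB j i)))
  refine mul_mem_subfield _ (fun i j => ?_) (inv_mem_subfield _ fun i j => ?_)
  · rw [Matrix.sub_apply]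
    exact sub_mem (one_mem_subfield _ i j) (hB' i j)
  · rw [Matrix.add_apply]
    exact add_mem (one_mem_subfield _ i j) (hB' i j)

/-- Unitary matrices with Gaussian rational entries are dense among the unitary matrices; a small
change of phase removes the eigenvalue `-1`. -/
theorem mem_closure_rationalUnitaries {U : Matrix n n ℂ} (hU : U.conjTranspose * U = 1) :
    U ∈ closure (rationalUnitaries n) := by
  rw [← closure_closure]
  let c : ℝ → ℂ := fun θ => Complex.exp (θ * Complex.I)
  have hc0 : ∀ θ, c θ ≠ 0 := fun θ => Complex.exp_ne_zero _
  have hcstar : ∀ θ, star (c θ) * c θ = 1 := by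
    intro θ
    have : ‖c θ‖ = 1 := Complex.norm_exp_ofReal_mul_I θ
    have h := Complex.conj_mul' (c θ)
    rw [this] at h
    simpa using h
  have hlim : Tendsto (fun θ => c θ • U) (nhdsWithin 0 {0}ᶜ) (nhds U) := by
    have h1 : Continuous fun θ : ℝ => c θ • U := by
      simp only [c]; fun_prop
    have h2 := h1.tendsto 0
    simp only [c, Complex.ofReal_zero, zero_mul, Complex.exp_zero, one_smul] at h2
    exact h2.mono_left nhdsWithin_le_nhds
  refine mem_closure_of_tendsto hlim ?_
  -- the phases for which `-1` is an eigenvalue are isolated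
  let bad : Set ℝ := {θ | θ ∈ Set.Ioc (-Real.pi) Real.pi ∧ -(c θ)⁻¹ ∈ U.charpoly.roots.toFinset}
  have hbad : bad.Finite := by
    refine Set.Finite.of_finite_image (f := fun θ => -(c θ)⁻¹)
      (U.charpoly.roots.toFinset.finite_toSet.subset ?_) ?_
    · rintro _ ⟨θ, hθ, rfl⟩
      exact hθ.2
    · intro θ hθ θ' hθ' h
      have h1 : c θ = c θ' := by simpa using h
      have e : ∀ t ∈ Set.Ioc (-Real.pi) Real.pi, Complex.arg (c t) = t := by
        intro t ht
        simp only [c]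
        rw [Complex.exp_mul_I, Complex.arg_cos_add_sin_mul_I ht]
      rw [← e θ hθ.1, ← e θ' hθ'.1, h1]
  have hev1 : ∀ᶠ θ in nhdsWithin (0 : ℝ) {0}ᶜ, θ ∉ bad \ {0} := by
    have hcl : IsClosed (bad \ {0}) := (hbad.subset Set.sdiff_subset).isClosed
    exact nhdsWithin_le_nhds (hcl.isOpen_compl.mem_nhds (by simp))
  have hev2 : ∀ᶠ θ in nhdsWithin (0 : ℝ) {0}ᶜ, θ ∈ Set.Ioc (-Real.pi) Real.pi :=
    nhdsWithin_le_nhds (Ioc_mem_nhds (by linarith [Real.pi_pos]) Real.pi_pos)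
  filter_upwards [hev1, hev2, self_mem_nhdsWithin] with θ h1 h2 h3
  have h4 : -(c θ)⁻¹ ∉ U.charpoly.roots.toFinset := fun h => h1 ⟨⟨h2, h⟩, h3⟩
  refine mem_closure_rationalUnitaries_of_isUnit ?_ ?_
  · rw [Matrix.conjTranspose_smul, Matrix.smul_mul, Matrix.mul_smul, smul_smul, hU, hcstar,
      one_smul]
  · rw [isUnit_iff_ne_zero]
    intro h0
    apply h4
    rw [Multiset.mem_toFinset, Polynomial.mem_roots (Matrix.charpoly_monic U).ne_zero,
      Polynomial.IsRoot, Matrix.eval_charpoly]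
    have e : Matrix.scalar n (-(c θ)⁻¹) - U = (-(c θ)⁻¹) • (1 + c θ • U) := by
      rw [smul_add, smul_smul, neg_mul, inv_mul_cancel₀ (hc0 θ), Matrix.scalar_apply,
        ← Matrix.smul_one_eq_diagonal]
      simp [sub_eq_add_neg]
    rw [e, Matrix.det_smul, h0, mul_zero]

end Cayley

/-- Every finite orthonormal family is approximated by exactly orthonormal families of vectors with
Gaussian rational entries. -/
theorem exists_gaussianRational_orthonormal {N : ℕ} {ι : Type*} [Fintype ι] [DecidableEq ι]
    (v : ι → EuclideanSpace ℂ (Fin N)) (hv : Orthonormal ℂ v) {ε : ℝ} (hε : 0 < ε) :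
    ∃ w : ι → Fin N → GRat,
      (∀ a b, ∑ i, star (w a i).val * (w b i).val = if a = b then 1 else 0) ∧
      ∀ a i, ‖(w a i).val - v a i‖ < ε := by
  classical
  have hcard : Fintype.card ι ≤ Fintype.card (Fin N) := by
    have := hv.linearIndependent.fintype_card_le_finrank
    simpa using this
  obtain ⟨e⟩ := Function.Embedding.nonempty_of_card_le hcard
  have hext : ∀ a, Function.extend e v 0 (e a) = v a := fun a => e.injective.extend_apply _ _ a
  have hv' : Orthonormal ℂ ((Set.range e).domRestrict (Function.extend e v 0)) := by
    rw [orthonormal_iff_ite]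
    rintro ⟨_, a, rfl⟩ ⟨_, b, rfl⟩
    simp only [Set.domRestrict_apply, hext]
    rw [orthonormal_iff_ite.1 hv a b]
    by_cases hab : a = b
    · simp [hab]
    · rw [if_neg hab, if_neg fun h => hab (e.injective (congrArg Subtype.val h))]
  obtain ⟨B, hB⟩ := hv'.exists_orthonormalBasis_extension_of_card_eq (by simp)
  have hBv : ∀ a, B (e a) = v a := fun a => by rw [hB _ ⟨a, rfl⟩, hext]
  -- the family is extended to an orthonormal basis, the columns of a unitary matrix
  let U : Matrix (Fin N) (Fin N) ℂ := Matrix.of fun i j => B j i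
  have hU : U.conjTranspose * U = 1 := by
    ext i j
    have h := orthonormal_iff_ite.1 B.orthonormal i j
    rw [Matrix.mul_apply, Matrix.one_apply, ← h, PiLp.inner_apply]
    refine Finset.sum_congr rfl fun k _ => ?_
    simp [U, mul_comm]
  have hopen : IsOpen {V : Matrix (Fin N) (Fin N) ℂ | ∀ i j, ‖V i j - U i j‖ < ε} := by
    simp only [Set.ofPred_forall]
    refine isOpen_iInter_of_finite fun i => isOpen_iInter_of_finite fun j => ?_
    exact isOpen_lt (by fun_prop) continuous_const
  obtain ⟨V, hVU, hV, hVr⟩ := mem_closure_iff.1 (mem_closure_rationalUnitaries hU) _ hopen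
    (fun i j => by simpa using hε)
  choose g hg using fun i j => exists_val_of_mem (hVr i j)
  refine ⟨fun a i => g i (e a), fun a b => ?_, fun a i => ?_⟩
  · have := congrFun (congrFun hV (e a)) (e b)
    rw [Matrix.mul_apply, Matrix.one_apply] at this
    have h2 : (if e a = e b then (1 : ℂ) else 0) = if a = b then 1 else 0 := by
      by_cases hab : a = b <;> simp [hab]
    rw [← h2, ← this]
    exact Finset.sum_congr rfl fun k _ => by simp [hg]
  · have := hVU i (e a)
    rw [hg]
    simpa [U, hBv] using this

/-! ### Codes of Gaussian rational vectors and matrices -/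

theorem vecDenotes_iff {d : ℕ} {c : List AlgCode} {v : Fin d → ℂ} :
    VecDenotes c v ↔
      c.length = d ∧ ∀ i : Fin d, (c.getD i ([], 0, 0, 0)).Denotes (v i) := by
  rw [VecDenotes, List.forall₂_iff_get]
  simp only [List.length_ofFn]
  refine and_congr_right fun hl => ?_
  constructor
  · intro h i
    have := h i (hl ▸ i.2) i.2
    rw [List.getD_eq_getElem _ _ (hl ▸ i.2)]
    simpa using this
  · intro h i h1 h2
    have := h ⟨i, h2⟩
    rw [List.getD_eq_getElem _ _ h1] at this
    simpa using this

theorem matDenotes_iff {d e : ℕ} {c : List (List AlgCode)} {A : Matrix (Fin d) (Fin e) ℂ} :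
    MatDenotes c A ↔ c.length = d ∧ ∀ i : Fin d, VecDenotes (c.getD i []) (A i) := by
  rw [MatDenotes, List.forall₂_iff_get]
  simp only [List.length_ofFn]
  refine and_congr_right fun hl => ?_
  constructor
  · intro h i
    have := h i (hl ▸ i.2) i.2
    rw [List.getD_eq_getElem _ _ (hl ▸ i.2)]
    simpa using this
  · intro h i h1 h2
    have := h ⟨i, h2⟩
    rw [List.getD_eq_getElem _ _ h1] at this
    simpa using this

/-- A code of a Gaussian rational `(x + y i) / (d + 1)`: the polynomial `((d + 1) Z - x)² + y²` and
the disc about the number itself with radius `1 / (d + 1)`, which excludes its conjugate. -/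
def GRat.toCode (g : GRat) : AlgCode :=
  ([g.1 * g.1 + g.2.1 * g.2.1, -(2 * g.1 * (g.2.2 + 1 : ℕ)), (g.2.2 + 1 : ℕ) * (g.2.2 + 1 : ℕ)],
    g.1, g.2.1, g.2.2)

theorem GRat.toCode_denotes (g : GRat) : (GRat.toCode g).Denotes g.val := by
  obtain ⟨x, y, d⟩ := g
  have hd := GRat.den_ne_zero d
  have heval : ∀ z : ℂ, evalCoeffs (GRat.toCode (x, y, d)).1 z =
      (((d : ℂ) + 1) * z - x - y * Complex.I) * (((d : ℂ) + 1) * z - x + y * Complex.I) := by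
    intro z
    simp only [evalCoeffs, GRat.toCode, List.foldr_cons, List.foldr_nil]
    push_cast
    linear_combination ((y : ℂ) ^ 2) * Complex.I_sq
  have hdR : (0 : ℝ) < (d : ℝ) + 1 := by positivity
  refine ⟨⟨?_, ?_⟩, ?_⟩
  · rw [heval]
    have : ((d : ℂ) + 1) * GRat.val (x, y, d) = x + y * Complex.I := by
      simp only [GRat.val]; field_simp
    rw [this]; ring
  · have : GRat.val (x, y, d) - ((x : ℂ) + (y : ℂ) * Complex.I) / ((d : ℂ) + 1) = 0 := sub_self _
    simp only [GRat.toCode]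
    rw [this, norm_zero]
    positivity
  · rintro w ⟨hw, hwd⟩
    rw [heval] at hw
    rcases mul_eq_zero.1 hw with h | h
    · simp only [GRat.val]
      field_simp
      linear_combination h
    · have hw' : w = ((x : ℂ) - y * Complex.I) / ((d : ℂ) + 1) := by
        field_simp
        linear_combination h
      simp only [GRat.toCode] at hwd
      have e : w - ((x : ℂ) + (y : ℂ) * Complex.I) / ((d : ℂ) + 1) =
          ((-(2 * y) : ℤ) : ℂ) * Complex.I / ((d + 1 : ℕ) : ℂ) := by
        rw [hw']; push_cast; field_simp; ring
      rw [e, norm_div, norm_mul, Complex.norm_I, mul_one, Complex.norm_intCast,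
        Complex.norm_natCast] at hwd
      push_cast at hwd
      have h1 := (div_lt_div_iff_of_pos_right hdR).1 hwd
      have h1' : |((-(2 * y) : ℤ) : ℝ)| < 1 := by push_cast; exact h1
      have h2 : |(-(2 * y) : ℤ)| < 1 := by exact_mod_cast h1'
      have h3 : y = 0 := by
        have := Int.abs_lt_one_iff.1 h2
        omega
      rw [hw', h3]
      simp [GRat.val]

theorem GRat.isAlgebraic_val (g : GRat) : IsAlgebraic ℚ g.val := by
  have h1 := isAlgebraic_algebraMap (R := ℚ) (A := ℂ) 0
  have hI : IsAlgebraic ℚ Complex.I := ⟨Polynomial.X ^ 2 + 1, by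
    intro h
    have := congrArg (Polynomial.aeval (0 : ℂ)) h
    simp at this, by simp⟩
  have hz : ∀ k : ℤ, IsAlgebraic ℚ (k : ℂ) := fun k => by
    have := isAlgebraic_algebraMap (R := ℚ) (A := ℂ) (k : ℚ)
    simpa using this
  have hn : IsAlgebraic ℚ ((g.2.2 : ℂ) + 1) := by
    have := hz (g.2.2 + 1)
    simpa using this
  rw [val, div_eq_mul_inv]
  exact ((hz _).add ((hz _).mul hI)).mul hn.inv

/-! ### Frames: exactly orthonormal lists of Gaussian rational vectors -/

/-- The coordinate `i` of the vector number `a` in a list of vectors. -/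
def entry (w : List (List GRat)) (a i : ℕ) : GRat := (w.getD a []).getD i (0, 0, 0)

/-- The vectors of `w`, cut off to dimension `N`, are orthonormal. -/
def IsFrame (N : ℕ) (w : List (List GRat)) : Prop :=
  ∀ a < w.length, ∀ b < w.length,
    ∑ i : Fin N, star (entry w a i).val * (entry w b i).val = if a = b then 1 else 0

/-- The Boolean test for `IsFrame`. -/
def isFrameB (N : ℕ) (w : List (List GRat)) : Bool :=
  ball w.length fun a => ball w.length fun b =>
    ((GRat.sum N fun i => (entry w a i).conj.mul (entry w b i)).sub
      (bif eqB a b then GRat.ofInt 1 else GRat.ofInt 0)).isZero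

/-- The entry `(i, j)` of the projection onto the span of a frame. -/
def projEntry (w : List (List GRat)) (i j : ℕ) : GRat :=
  GRat.sum w.length fun a => (entry w a i).mul (entry w a j).conj

/-- A code of the set of vectors of a frame. -/
def frameCode (N : ℕ) (w : List (List GRat)) : List (List AlgCode) :=
  tabulate w.length fun a => tabulate N fun i => (entry w a i).toCode

section Computability
variable {β : Type*} [Primcodable β]

@[fun_prop]
theorem computable_toCode {g : β → GRat} (hg : Computable g) :
    Computable fun x => (g x).toCode := by
  unfold GRat.toCode; fun_prop

@[fun_prop]
theorem computable_entry {w : β → List (List GRat)} {a i : β → ℕ} (hw : Computable w)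
    (ha : Computable a) (hi : Computable i) : Computable fun x => entry (w x) (a x) (i x) := by
  unfold entry; fun_prop

@[fun_prop]
theorem computable_isFrameB {N : β → ℕ} {w : β → List (List GRat)} (hN : Computable N)
    (hw : Computable w) : Computable fun x => isFrameB (N x) (w x) := by
  unfold isFrameB; fun_prop

@[fun_prop]
theorem computable_projEntry {w : β → List (List GRat)} {i j : β → ℕ} (hw : Computable w)
    (hi : Computable i) (hj : Computable j) :
    Computable fun x => projEntry (w x) (i x) (j x) := by
  unfold projEntry; fun_prop

@[fun_prop]
theorem computable_frameCode {N : β → ℕ} {w : β → List (List GRat)} (hN : Computable N)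
    (hw : Computable w) : Computable fun x => frameCode (N x) (w x) := by
  unfold frameCode; fun_prop

end Computability

theorem isFrameB_eq_true {N : ℕ} {w : List (List GRat)} :
    isFrameB N w = true ↔ IsFrame N w := by
  simp only [isFrameB, ball_eq_true, IsFrame, GRat.isZero_eq_true, GRat.val_sub, GRat.val_sum,
    GRat.val_mul, GRat.val_conj, sub_eq_zero]
  refine forall₂_congr fun a _ => forall₂_congr fun b _ => ?_
  rw [Finset.sum_range]
  by_cases h : a = b
  · simp [h, eqB]
  · simp [h, eqB]

theorem length_tabulate {β : Type*} (n : ℕ) (f : ℕ → β) : (tabulate n f).length = n := by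
  simp [tabulate_eq]

theorem getD_tabulate {β : Type*} {n i : ℕ} (f : ℕ → β) (d : β) (hi : i < n) :
    (tabulate n f).getD i d = f i := by
  rw [tabulate_eq, List.getD_eq_getElem _ _ (by simpa using hi)]
  simp

/-- The vector number `a` of a frame. -/
noncomputable def frameVec (N : ℕ) (w : List (List GRat)) (a : ℕ) : EuclideanSpace ℂ (Fin N) :=
  WithLp.toLp 2 fun i => (entry w a i).val

theorem IsFrame.orthonormal {N : ℕ} {w : List (List GRat)} (hw : IsFrame N w) :
    Orthonormal ℂ fun a : Fin w.length => frameVec N w a := by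
  rw [orthonormal_iff_ite]
  intro a b
  have h := hw a a.2 b b.2
  rw [PiLp.inner_apply]
  simp only [Fin.ext_iff]
  rw [← h]
  refine Finset.sum_congr rfl fun i _ => ?_
  simp [frameVec, mul_comm]

theorem vecDenotes_frameCode (N : ℕ) (w : List (List GRat)) (a : ℕ) :
    VecDenotes (tabulate N fun i => (entry w a i).toCode) fun i => frameVec N w a i := by
  refine vecDenotes_iff.2 ⟨length_tabulate _ _, fun i => ?_⟩
  rw [getD_tabulate _ _ i.2]
  exact GRat.toCode_denotes _

open Classical in
/-- The set of vectors of a frame. -/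
noncomputable def frameSet (N : ℕ) (w : List (List GRat)) : Finset (EuclideanSpace ℂ (Fin N)) :=
  Finset.univ.image fun a : Fin w.length => frameVec N w a

theorem setDenotes_frameCode (N : ℕ) (w : List (List GRat)) :
    SetDenotes (frameCode N w) (frameSet N w) := by
  constructor
  · intro l hl
    rw [frameCode, tabulate_eq] at hl
    obtain ⟨a, ha, rfl⟩ := List.mem_map.1 hl
    exact ⟨frameVec N w a, Finset.mem_image.2 ⟨⟨a, List.mem_range.1 ha⟩, Finset.mem_univ _, rfl⟩,
      vecDenotes_frameCode N w a⟩
  · intro v hv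
    obtain ⟨a, -, rfl⟩ := Finset.mem_image.1 hv
    refine ⟨_, ?_, vecDenotes_frameCode N w a⟩
    rw [frameCode, tabulate_eq]
    exact List.mem_map.2 ⟨a, List.mem_range.2 a.2, rfl⟩

theorem IsFrame.card_frameSet {N : ℕ} {w : List (List GRat)} (hw : IsFrame N w) :
    (frameSet N w).card = w.length := by
  rw [frameSet, Finset.card_image_of_injective _ hw.orthonormal.linearIndependent.injective]
  simp

theorem IsFrame.orthonormal_frameSet {N : ℕ} {w : List (List GRat)} (hw : IsFrame N w) :
    Orthonormal ℂ fun v : frameSet N w => (v : EuclideanSpace ℂ (Fin N)) := by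
  have h := hw.orthonormal.toSubtypeRange
  have e : Set.range (fun a : Fin w.length => frameVec N w a) = (frameSet N w : Set _) := by
    simp [frameSet]
  rw [e] at h
  exact h

/-- The matrix of the projection onto the span of a frame. -/
noncomputable def projMat (N : ℕ) (w : List (List GRat)) : Matrix (Fin N) (Fin N) ℂ :=
  fun i j => ∑ a : Fin w.length, (entry w a i).val * star (entry w a j).val

theorem val_projEntry (w : List (List GRat)) (N : ℕ) (i j : Fin N) :
    (projEntry w i j).val = projMat N w i j := by
  simp [projEntry, projMat, Finset.sum_range]

theorem trace_mul_projMat {N : ℕ} (A : Matrix (Fin N) (Fin N) ℂ) (w : List (List GRat)) :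
    (A * projMat N w).trace =
      ∑ a : Fin w.length, star (frameVec N w a).ofLp ⬝ᵥ A.mulVec (frameVec N w a).ofLp := by
  simp only [Matrix.trace, Matrix.diag_apply, Matrix.mul_apply, projMat, dotProduct,
    Matrix.mulVec, Finset.mul_sum]
  have : ∀ i : Fin N, ∑ j : Fin N, ∑ a : Fin w.length,
      A i j * ((entry w a j).val * star (entry w a i).val) =
      ∑ a : Fin w.length, ∑ j : Fin N,
        A i j * ((entry w a j).val * star (entry w a i).val) := fun i => Finset.sum_comm
  simp only [this]
  rw [Finset.sum_comm]
  refine Finset.sum_congr rfl fun a _ => Finset.sum_congr rfl fun i _ =>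
    Finset.sum_congr rfl fun j _ => ?_
  simp only [Pi.star_apply, frameVec]
  ring

theorem IsFrame.trace_projMat {N : ℕ} {w : List (List GRat)} (hw : IsFrame N w) :
    (projMat N w).trace = w.length := by
  simp only [Matrix.trace, Matrix.diag_apply, projMat]
  rw [Finset.sum_comm]
  have : ∀ a : Fin w.length, ∑ i : Fin N, (entry w a i).val * star (entry w a i).val = 1 := by
    intro a
    have h := hw a a.2 a a.2
    simp only [if_true] at h
    rw [← h]
    exact Finset.sum_congr rfl fun i _ => mul_comm _ _
  rw [Finset.sum_congr rfl fun a _ => this a]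
  simp

theorem tracialState_measure (S : SpecialProjection) :
    tracialState.measure S = S.mat.trace.re / 2 ^ S.qubits := by
  have h : ((2 : ℂ) ^ S.qubits)⁻¹ = (((2 : ℝ) ^ S.qubits)⁻¹ : ℝ) := by push_cast; rfl
  simp only [QState.measure, tracialState, Matrix.smul_mul, one_mul, Matrix.trace_smul,
    smul_eq_mul]
  rw [h, Complex.re_ofReal_mul]
  ring

/-! ### Estimates for density matrices -/

/-- The entries of a density matrix are at most one in absolute value. -/
theorem norm_entry_le_one {N : ℕ} {A : Matrix (Fin N) (Fin N) ℂ} (hA : A.PosSemidef)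
    (htr : A.trace = 1) (i j : Fin N) : ‖A i j‖ ≤ 1 := by
  obtain ⟨B, rfl⟩ : ∃ B : Matrix (Fin N) (Fin N) ℂ, A = B.conjTranspose * B := by
    open scoped MatrixOrder in
    exact CStarAlgebra.nonneg_iff_eq_star_mul_self.1 hA.nonneg
  have htr' : ∑ k, ∑ l, ‖B l k‖ ^ 2 = 1 := by
    have h := congrArg Complex.re htr
    simp only [Matrix.trace, Matrix.diag_apply, Matrix.mul_apply, Matrix.conjTranspose_apply,
      Complex.re_sum, Complex.one_re] at h
    rw [← h]
    refine Finset.sum_congr rfl fun k _ => Finset.sum_congr rfl fun l _ => ?_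
    have := Complex.conj_mul' (B l k)
    have h2 := congrArg Complex.re this
    rw [← Complex.ofReal_pow, Complex.ofReal_re] at h2
    exact h2.symm
  have hcol : ∀ k, ∑ l, ‖B l k‖ ^ 2 ≤ 1 := by
    intro k
    rw [← htr']
    exact Finset.single_le_sum (f := fun k => ∑ l, ‖B l k‖ ^ 2)
      (fun k _ => Finset.sum_nonneg fun l _ => by positivity) (Finset.mem_univ k)
  rw [Matrix.mul_apply]
  refine (norm_sum_le _ _).trans ?_
  have h : ∀ l, ‖B.conjTranspose i l * B l j‖ ≤ (‖B l i‖ ^ 2 + ‖B l j‖ ^ 2) / 2 := by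
    intro l
    rw [norm_mul, Matrix.conjTranspose_apply, norm_star]
    nlinarith [sq_nonneg (‖B l i‖ - ‖B l j‖)]
  refine (Finset.sum_le_sum fun l _ => h l).trans ?_
  rw [← Finset.sum_div, Finset.sum_add_distrib]
  linarith [hcol i, hcol j]

/-- Expectations in a density matrix depend continuously on the observable. -/
theorem abs_re_trace_sub_le {N : ℕ} {A : Matrix (Fin N) (Fin N) ℂ} (hA : A.PosSemidef)
    (htr : A.trace = 1) {M M' : Matrix (Fin N) (Fin N) ℂ} {η : ℝ}
    (h : ∀ i j, ‖M i j - M' i j‖ ≤ η) :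
    |(A * M).trace.re - (A * M').trace.re| ≤ N * N * η := by
  have e : (A * M).trace.re - (A * M').trace.re = (∑ i, ∑ j, A i j * (M j i - M' j i)).re := by
    rw [← Complex.sub_re, ← Matrix.trace_sub, ← Matrix.mul_sub]
    simp [Matrix.trace, Matrix.mul_apply]
  rw [e]
  refine (Complex.abs_re_le_norm _).trans ((norm_sum_le _ _).trans ?_)
  have : ∀ i, ‖∑ j, A i j * (M j i - M' j i)‖ ≤ N * η := by
    intro i
    refine (norm_sum_le _ _).trans ?_
    have : ∀ j, ‖A i j * (M j i - M' j i)‖ ≤ η := by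
      intro j
      rw [norm_mul]
      calc _ ≤ 1 * η :=
            mul_le_mul (norm_entry_le_one hA htr i j) (h j i) (norm_nonneg _) zero_le_one
        _ = η := one_mul _
    refine (Finset.sum_le_sum fun j _ => this j).trans ?_
    simp
  refine (Finset.sum_le_sum fun j _ => this j).trans ?_
  simp [mul_assoc]

/-- A Hermitian projection is the sum of the rank-one projections given by an orthonormal basis of
its range. -/
theorem exists_orthonormal_of_projection {N : ℕ} {S : Matrix (Fin N) (Fin N) ℂ}
    (hS : S.IsHermitian) (hS2 : IsIdempotentElem S) :
    ∃ (ι : Type) (_ : Fintype ι) (_ : DecidableEq ι) (v : ι → EuclideanSpace ℂ (Fin N)),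
      Orthonormal ℂ v ∧ ∀ i j, S i j = ∑ a, v a i * star (v a j) := by
  classical
  have hev : ∀ k, hS.eigenvalues k = 0 ∨ hS.eigenvalues k = 1 := by
    intro k
    have h1 := hS.mulVec_eigenvectorBasis k
    have h2 : S.mulVec (S.mulVec (hS.eigenvectorBasis k).ofLp) =
        S.mulVec (hS.eigenvectorBasis k).ofLp := by rw [Matrix.mulVec_mulVec, hS2.eq]
    rw [h1, Matrix.mulVec_smul, h1, smul_smul] at h2
    have hne : (hS.eigenvectorBasis k).ofLp ≠ 0 := by
      intro h0
      have := hS.eigenvectorBasis.orthonormal.ne_zero k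
      exact this ((WithLp.ofLp_eq_zero 2).1 h0)
    have h3 : hS.eigenvalues k * hS.eigenvalues k = hS.eigenvalues k := smul_left_injective ℝ hne h2
    have h4 : hS.eigenvalues k * (hS.eigenvalues k - 1) = 0 := by rw [mul_sub, h3]; ring
    rcases mul_eq_zero.1 h4 with h | h
    · exact Or.inl h
    · exact Or.inr (by linarith)
  refine ⟨{k // hS.eigenvalues k = 1}, inferInstance, inferInstance,
    fun k => hS.eigenvectorBasis k, hS.eigenvectorBasis.orthonormal.comp _ Subtype.val_injective,
    fun i j => ?_⟩
  have h := congrFun (congrFun hS.spectral_theorem i) j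
  rw [Unitary.conjStarAlgAut_apply, Matrix.mul_apply] at h
  rw [h]
  simp only [Matrix.mul_diagonal, Matrix.IsHermitian.eigenvectorUnitary_apply, Matrix.star_apply,
    Function.comp_apply]
  rw [← Finset.sum_filter_add_sum_filter_not Finset.univ fun k => hS.eigenvalues k = 1]
  have h0 : ∀ k ∈ Finset.univ.filter fun k => ¬ hS.eigenvalues k = 1,
      (hS.eigenvectorBasis k).ofLp i * (RCLike.ofReal (hS.eigenvalues k) : ℂ) *
        star ((hS.eigenvectorBasis k).ofLp j) = 0 := by
    intro k hk
    rw [((hev k).resolve_right (Finset.mem_filter.1 hk).2)]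
    simp
  rw [Finset.sum_eq_zero h0, add_zero,
    Finset.sum_subtype _ (p := fun k => hS.eigenvalues k = 1) (fun k => by simp)]
  refine Finset.sum_congr rfl fun k _ => ?_
  rw [k.2]
  simp

/-! ### Computable reals as sums of computable series -/

/-- A real sequence given by a computable sequence of formal Gaussian rationals. -/
def IsGRatSeq (a : ℕ → ℝ) : Prop :=
  ∃ g : ℕ → GRat, Computable g ∧ ∀ m, (g m).val = (a m : ℂ)

theorem IsComputableRatSeq.isGRatSeq {f : ℕ → ℚ} (hf : IsComputableRatSeq f) :
    IsGRatSeq fun n => (f n : ℝ) := by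
  obtain ⟨p, q, hp, hq, h⟩ := hf
  refine ⟨fun n => (p n, 0, q n), by fun_prop, fun m => ?_⟩
  have h1 := h m
  simp only [h1]
  simp [GRat.val]

theorem IsGRatSeq.isComputableReal {a : ℕ → ℝ} (ha : IsGRatSeq a) {r : ℝ}
    (h : ∀ n, |a n - r| < (2⁻¹ : ℝ) ^ n) : IsComputableReal r := by
  obtain ⟨g, hg, hga⟩ := ha
  have hval : ∀ n, a n = ((g n).1 : ℝ) / (((g n).2.2 : ℝ) + 1) := by
    intro n
    have h1 := congrArg Complex.re (hga n)
    have h2 : (((g n).2.2 : ℂ) + 1) = ((((g n).2.2 : ℝ) + 1 : ℝ) : ℂ) := by push_cast; rfl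
    rw [GRat.val, h2, Complex.div_ofReal_re, Complex.ofReal_re] at h1
    rw [← h1]
    simp
  refine ⟨fun n => ((g n).1 : ℚ) / (((g n).2.2 : ℚ) + 1),
    ⟨fun n => (g n).1, fun n => (g n).2.2, by fun_prop, by fun_prop, fun n => rfl⟩, fun n => ?_⟩
  have := h n
  rw [hval n] at this
  push_cast
  exact this

theorem IsGRatSeq.comp {a : ℕ → ℝ} (ha : IsGRatSeq a) {N : ℕ → ℕ} (hN : Computable N) :
    IsGRatSeq fun n => a (N n) := by
  obtain ⟨g, hg, hga⟩ := ha
  exact ⟨fun n => g (N n), by fun_prop, fun m => hga _⟩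

theorem IsGRatSeq.partialSum {a : ℕ → ℝ} (ha : IsGRatSeq a) :
    IsGRatSeq fun M => ∑ i ∈ Finset.range M, a i := by
  obtain ⟨g, hg, hga⟩ := ha
  refine ⟨fun M => GRat.sum M fun i => g i, by fun_prop, fun m => ?_⟩
  simp [hga]

/-- The tails of a series of nonnegative computable rationals with computable sum can be
controlled computably. -/
theorem exists_computable_modulus {b : ℕ → ℝ} (hb : IsGRatSeq b) {B : ℝ}
    (hsum : HasSum b B) (hB : IsComputableReal B) :
    ∃ N : ℕ → ℕ, Computable N ∧ ∀ k, B - ∑ i ∈ Finset.range (N k), b i ≤ (2⁻¹ : ℝ) ^ k := by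
  obtain ⟨f, hf, hfB⟩ := hB
  obtain ⟨g, hg, hgf⟩ := hf.isGRatSeq
  obtain ⟨s, hs, hsb⟩ := hb.partialSum
  have hval : ∀ k M : ℕ, ‖((g (k + 2)).sub (s M)).val‖ =
      |(f (k + 2) : ℝ) - ∑ i ∈ Finset.range M, b i| := by
    intro k M
    rw [GRat.val_sub, hgf, hsb, ← Complex.ofReal_sub, Complex.norm_real, Real.norm_eq_abs]
  obtain ⟨N, hN, hNs⟩ := Computable.exists_search (α := ℕ)
    (p := fun k M => ((g (k + 2)).sub (s M)).small (2 ^ (k + 1))) (by fun_prop) (by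
      intro k
      have ht := hsum.tendsto_sum_nat
      have hpos : (0 : ℝ) < (2⁻¹ : ℝ) ^ (k + 2) := by positivity
      obtain ⟨M, hM⟩ := (Metric.tendsto_atTop.1 ht _ hpos)
      refine ⟨M, GRat.small_eq_true.2 ?_⟩
      have h1 := hM M le_rfl
      rw [Real.dist_eq] at h1
      have h2 := hfB (k + 2)
      rw [hval]
      have h3 : |(f (k + 2) : ℝ) - ∑ i ∈ Finset.range M, b i| < (2⁻¹ : ℝ) ^ (k + 1) := by
        have e : (2⁻¹ : ℝ) ^ (k + 1) = (2⁻¹ : ℝ) ^ (k + 2) + (2⁻¹ : ℝ) ^ (k + 2) := by ring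
        rw [abs_lt] at h1 h2
        rw [e, abs_lt]
        constructor <;> linarith [h1.1, h1.2, h2.1, h2.2]
      calc _ < (2⁻¹ : ℝ) ^ (k + 1) * ((2 ^ (k + 1) : ℕ) : ℝ) := by gcongr
        _ = 1 := by push_cast; rw [← mul_pow]; norm_num)
  refine ⟨N, hN, fun k => ?_⟩
  have h1 := GRat.small_eq_true.1 (hNs k)
  rw [hval] at h1
  have h2 := hfB (k + 2)
  have h3 : |(f (k + 2) : ℝ) - ∑ i ∈ Finset.range (N k), b i| < (2⁻¹ : ℝ) ^ (k + 1) := by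
    rw [inv_pow, ← one_div, lt_div_iff₀ (by positivity)]
    exact_mod_cast h1
  have e : (2⁻¹ : ℝ) ^ k = (2⁻¹ : ℝ) ^ (k + 2) * 4 := by ring
  have e' : (2⁻¹ : ℝ) ^ (k + 1) = (2⁻¹ : ℝ) ^ (k + 2) * 2 := by ring
  have hpos : (0 : ℝ) < (2⁻¹ : ℝ) ^ (k + 2) := by positivity
  rw [abs_lt] at h2 h3
  rw [e'] at h3
  rw [e]
  linarith [h2.1, h2.2, h3.1, h3.2]

/-- A series of nonnegative computable rationals has a computable sum if its tails can be
controlled computably. -/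
theorem isComputableReal_of_modulus {a : ℕ → ℝ} (ha : IsGRatSeq a) (h0 : ∀ m, 0 ≤ a m) {A : ℝ}
    (hsum : HasSum a A) {N : ℕ → ℕ} (hN : Computable N)
    (h : ∀ k, A - ∑ i ∈ Finset.range (N k), a i ≤ (2⁻¹ : ℝ) ^ k) : IsComputableReal A := by
  refine (ha.partialSum.comp (N := fun k => N (k + 1)) (by fun_prop)).isComputableReal
    fun k => ?_
  have h1 := h (k + 1)
  have h2 := sum_le_hasSum (Finset.range (N (k + 1))) (fun i _ => h0 i) hsum
  have h3 : (2⁻¹ : ℝ) ^ (k + 1) < (2⁻¹ : ℝ) ^ k :=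
    pow_lt_pow_right_of_lt_one₀ (by norm_num) (by norm_num) (Nat.lt_succ_self k)
  rw [abs_sub_comm, abs_of_nonneg (by linarith)]
  linarith

/-- The tail of a dominated series is dominated. -/
theorem tail_le_tail {a b : ℕ → ℝ} {A B : ℝ} (hab : ∀ m, a m ≤ b m) (ha : HasSum a A)
    (hb : HasSum b B) (M : ℕ) :
    A - ∑ i ∈ Finset.range M, a i ≤ B - ∑ i ∈ Finset.range M, b i := by
  have h1 := (hasSum_nat_add_iff' M).2 ha
  have h2 := (hasSum_nat_add_iff' M).2 hb
  exact hasSum_le (fun i => hab (i + M)) h1 h2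

/-! ### The measure of the domain of a prefix-free machine -/

/-- The infinite bitstrings extending `σ`. -/
def cylinder (σ : List Bool) : Set (ℕ → Bool) :=
  {X | ∀ (i : ℕ) (h : i < σ.length), X i = σ[i]}

theorem cylinder_eq_pi (σ : List Bool) :
    cylinder σ = Set.pi (Finset.range σ.length) fun i => {σ.getD i false} := by
  ext X
  simp only [cylinder, Set.mem_ofPred_eq, Set.mem_pi, Finset.coe_range, Set.mem_Iio,
    Set.mem_singleton_iff]
  refine forall_congr' fun i => forall_congr' fun h => ?_
  rw [List.getD_eq_getElem _ _ h]

theorem measurableSet_cylinder (σ : List Bool) : MeasurableSet (cylinder σ) := by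
  rw [cylinder_eq_pi]
  exact MeasurableSet.pi (Finset.countable_toSet _) fun _ _ => MeasurableSet.of_discrete

theorem cantorMeasure_cylinder (σ : List Bool) :
    cantorMeasure (cylinder σ) = (2⁻¹ : ENNReal) ^ σ.length := by
  rw [cylinder_eq_pi, cantorMeasure, Measure.infinitePi_pi]
  · simp
  · exact fun _ _ => MeasurableSet.of_discrete

instance : IsProbabilityMeasure cantorMeasure := by
  unfold cantorMeasure; infer_instance

theorem prefix_or_prefix_of_mem_cylinder {σ τ : List Bool} {X : ℕ → Bool} (hσ : X ∈ cylinder σ)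
    (hτ : X ∈ cylinder τ) : σ <+: τ ∨ τ <+: σ := by
  have key : ∀ {σ τ : List Bool}, X ∈ cylinder σ → X ∈ cylinder τ → σ.length ≤ τ.length →
      σ <+: τ := by
    intro σ τ hσ hτ hle
    rw [List.prefix_iff_eq_take]
    refine List.ext_getElem (by simp [hle]) fun i h1 h2 => ?_
    rw [List.getElem_take, ← hσ i h1, ← hτ i (by omega)]
  rcases le_total σ.length τ.length with h | h
  · exact Or.inl (key hσ hτ h)
  · exact Or.inr (key hτ hσ h)

/-- The weight `2 ^ (-|σ|)` of an optional bitstring. -/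
noncomputable def weight (o : Option (List Bool)) : ℝ :=
  o.elim 0 fun σ => (2⁻¹ : ℝ) ^ σ.length

/-- The measure of the domain is the sum of the weights of its elements, in any enumeration without
repetitions. -/
theorem hasSum_weight (C : PrefixFreeMachine) {s : ℕ → Option (List Bool)}
    (hinj : ∀ m m' σ, s m = some σ → s m' = some σ → m = m')
    (hdom : ∀ σ, (C.run σ).Dom ↔ ∃ m, s m = some σ) :
    HasSum (fun m => weight (s m)) (cantorMeasure.real C.domainOpen) := by
  let A : ℕ → Set (ℕ → Bool) := fun m => (s m).elim ∅ cylinder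
  have hA : C.domainOpen = ⋃ m, A m := by
    ext X
    simp only [PrefixFreeMachine.domainOpen, Set.mem_ofPred_eq, Set.mem_iUnion]
    constructor
    · rintro ⟨σ, hσ, hX⟩
      obtain ⟨m, hm⟩ := (hdom σ).1 hσ
      exact ⟨m, by simp only [A, hm, Option.elim_some]; exact hX⟩
    · rintro ⟨m, hm⟩
      cases hs : s m with
      | none => simp [A, hs] at hm
      | some σ =>
        simp only [A, hs, Option.elim_some] at hm
        exact ⟨σ, (hdom σ).2 ⟨m, hs⟩, hm⟩
  have hmeas : ∀ m, MeasurableSet (A m) := by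
    intro m
    cases hs : s m with
    | none => simp [A, hs]
    | some σ => simp only [A, hs, Option.elim_some]; exact measurableSet_cylinder σ
  have hdisj : Pairwise (Function.onFun Disjoint A) := by
    intro m m' hne
    rw [Function.onFun, Set.disjoint_left]
    intro X hX hX'
    cases hs : s m with
    | none => simp [A, hs] at hX
    | some σ =>
      cases hs' : s m' with
      | none => simp [A, hs'] at hX'
      | some τ =>
        simp only [A, hs, hs', Option.elim_some] at hX hX'
        have dσ := (hdom σ).2 ⟨m, hs⟩
        have dτ := (hdom τ).2 ⟨m', hs'⟩
        have : σ = τ := by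
          rcases prefix_or_prefix_of_mem_cylinder hX hX' with h | h
          · exact C.prefixFree _ _ dσ dτ h
          · exact (C.prefixFree _ _ dτ dσ h).symm
        exact hne (hinj m m' σ hs (this ▸ hs'))
  have hw : ∀ m, weight (s m) = cantorMeasure.real (A m) := by
    intro m
    cases hs : s m with
    | none => simp [A, hs, weight]
    | some σ =>
      simp only [A, hs, Option.elim_some, weight, Measure.real, cantorMeasure_cylinder]
      simp
  simp only [hw, hA]
  have h := measure_iUnion hdisj hmeas (μ := cantorMeasure)
  have hne : ∑' m, cantorMeasure (A m) ≠ ⊤ := by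
    rw [← h]; exact measure_ne_top _ _
  rw [Measure.real, h, ENNReal.tsum_toReal_eq (fun m => measure_ne_top _ _)]
  exact (ENNReal.summable_toReal hne).hasSum

/-! ### Halting computations -/

/-- The halting computations of a partial computable function can be enumerated without
repetitions: `h σ t` is the output of the computation on `σ` if it halts at stage `t` exactly. -/
theorem exists_halting_stages {f : List Bool →. ℕ} (hf : Partrec f) :
    ∃ h : List Bool → ℕ → Option ℕ, (Computable fun p : List Bool × ℕ => h p.1 p.2) ∧
      (∀ σ k, k ∈ f σ ↔ ∃ t, h σ t = some k) ∧
      ∀ σ t t' k k', h σ t = some k → h σ t' = some k' → t = t' := by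
  obtain ⟨c, hc⟩ := Nat.Partrec.Code.exists_code.1 hf
  let h0 : List Bool → ℕ → Option ℕ := fun σ t =>
    Nat.Partrec.Code.evaln t c (Encodable.encode σ)
  have h0c : Computable fun p : List Bool × ℕ => h0 p.1 p.2 := by
    have h1 := Nat.Partrec.Code.primrec_evaln.to_comp
    have h2 : Computable fun p : List Bool × ℕ => ((p.2, c), Encodable.encode p.1) := by fun_prop
    exact h1.comp h2
  have hmono : ∀ σ t t' k, t ≤ t' → h0 σ t = some k → h0 σ t' = some k := fun σ t t' k htt hk =>
    Nat.Partrec.Code.evaln_mono htt hk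
  have hmem : ∀ σ k, k ∈ f σ ↔ ∃ t, h0 σ t = some k := by
    intro σ k
    have h1 : k ∈ Nat.Partrec.Code.eval c (Encodable.encode σ) ↔ k ∈ f σ := by
      rw [hc]
      simp
    rw [← h1, Nat.Partrec.Code.evaln_complete]
    rfl
  have hz : ∀ σ, h0 σ 0 = none := fun σ => by simp [h0, Nat.Partrec.Code.evaln]
  have key : ∀ {σ : List Bool} {t k : ℕ},
      (bif (h0 σ t).isSome && !(h0 σ (t - 1)).isSome then h0 σ t else none) =
      some k → h0 σ t = some k ∧ h0 σ (t - 1) = none := by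
    intro σ t k ht
    cases hc' : (h0 σ t).isSome && !(h0 σ (t - 1)).isSome with
    | true =>
      rw [hc', cond_true] at ht
      refine ⟨ht, ?_⟩
      simp only [Bool.and_eq_true, Bool.not_eq_true'] at hc'
      simpa using hc'.2
    | false => rw [hc', cond_false] at ht; cases ht
  refine ⟨fun σ t => bif (h0 σ t).isSome && !(h0 σ (t - 1)).isSome then h0 σ t else none, ?_, ?_,
    ?_⟩
  · have h1 : Computable fun p : List Bool × ℕ => h0 p.1 (p.2 - 1) :=
      h0c.comp (by fun_prop : Computable fun p : List Bool × ℕ => (p.1, p.2 - 1))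
    fun_prop
  · intro σ k
    rw [hmem]
    constructor
    · intro hex
      have hfind := Nat.find_spec hex
      refine ⟨Nat.find hex, ?_⟩
      have hpos : Nat.find hex ≠ 0 := by
        intro h00
        rw [h00, hz] at hfind
        cases hfind
      have hprev : h0 σ (Nat.find hex - 1) = none := by
        by_contra hne
        obtain ⟨k', hk'⟩ := Option.ne_none_iff_exists'.1 hne
        have h2 := hmono σ _ (Nat.find hex) k' (Nat.sub_le _ _) hk'
        rw [hfind] at h2
        cases h2
        exact Nat.find_min hex (Nat.sub_lt (Nat.pos_of_ne_zero hpos) one_pos) hk'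
      simp [hfind, hprev]
    · rintro ⟨t, ht⟩
      exact ⟨t, (key ht).1⟩
  · intro σ t t' k k' ht ht'
    obtain ⟨a1, a2⟩ := key ht
    obtain ⟨b1, b2⟩ := key ht'
    by_contra hne
    rcases lt_or_gt_of_ne hne with hlt | hlt
    · rw [hmono σ t (t' - 1) k (by omega) a1] at b2
      cases b2
    · rw [hmono σ t' (t - 1) k' (by omega) b1] at a2
      cases a2

/-! ### Frames near orthonormal families -/

/-- Density of frames among finite orthonormal families. -/
theorem exists_frame_near {N : ℕ} {ι : Type*} [Fintype ι] (v : ι → EuclideanSpace ℂ (Fin N))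
    (hv : Orthonormal ℂ v) {ε : ℝ} (hε : 0 < ε) :
    ∃ w : List (List GRat), IsFrame N w ∧ ∃ e : ι ≃ Fin w.length,
      ∀ a (i : Fin N), ‖(entry w (e a) i).val - v a i‖ < ε := by
  classical
  obtain ⟨g, hg, hgv⟩ := exists_gaussianRational_orthonormal v hv hε
  let f := Fintype.equivFin ι
  let w : List (List GRat) := List.ofFn fun a : Fin (Fintype.card ι) =>
    List.ofFn fun i : Fin N => g (f.symm a) i
  have hlen : w.length = Fintype.card ι := by simp [w]
  have hentry : ∀ (a : ℕ) (ha : a < Fintype.card ι) (i : Fin N),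
      entry w a i = g (f.symm ⟨a, ha⟩) i := by
    intro a ha i
    have h1 : w.getD a [] = List.ofFn fun i : Fin N => g (f.symm ⟨a, ha⟩) i := by
      rw [List.getD_eq_getElem _ _ (by rw [hlen]; exact ha)]
      simp [w]
    rw [entry, h1, List.getD_eq_getElem _ _ (by simp)]
    simp
  refine ⟨w, ?_, f.trans (finCongr hlen.symm), fun a i => ?_⟩
  · intro a ha b hb
    rw [hlen] at ha hb
    have := hg (f.symm ⟨a, ha⟩) (f.symm ⟨b, hb⟩)
    simp only [hentry a ha, hentry b hb]
    rw [this]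
    by_cases hab : a = b
    · simp [hab]
    · rw [if_neg hab, if_neg]
      intro h
      exact hab (congrArg Fin.val (f.symm.injective h))
  · have hlt : ((f.trans (finCongr hlen.symm)) a : ℕ) < Fintype.card ι := (f a).2
    rw [hentry _ hlt]
    have : f.symm ⟨((f.trans (finCongr hlen.symm)) a : ℕ), hlt⟩ = a := by
      rw [Equiv.symm_apply_eq]
      rfl
    rw [this]
    exact hgv a i

theorem norm_coord_le_one {N : ℕ} {v : EuclideanSpace ℂ (Fin N)} (hv : ‖v‖ = 1) (i : Fin N) :
    ‖v i‖ ≤ 1 :=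
  hv ▸ PiLp.norm_apply_le v i

theorem IsFrame.norm_frameVec {N : ℕ} {w : List (List GRat)} (hw : IsFrame N w)
    (a : Fin w.length) : ‖frameVec N w a‖ = 1 :=
  hw.orthonormal.norm_eq_one a

theorem norm_mul_star_sub_le {x y x' y' : ℂ} {ε : ℝ} (hy : ‖y‖ ≤ 1) (hx' : ‖x'‖ ≤ 1)
    (hx : ‖x - x'‖ ≤ ε) (hyy : ‖y - y'‖ ≤ ε) : ‖x * star y - x' * star y'‖ ≤ 2 * ε := by
  have e : x * star y - x' * star y' = (x - x') * star y + x' * star (y - y') := by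
    rw [star_sub]; ring
  rw [e]
  refine (norm_add_le _ _).trans ?_
  rw [norm_mul, norm_mul, norm_star, norm_star]
  have h1 : ‖x - x'‖ * ‖y‖ ≤ ε * 1 := by gcongr; exact (norm_nonneg _).trans hx
  have h2 : ‖x'‖ * ‖y - y'‖ ≤ 1 * ε := by gcongr
  linarith

theorem norm_projMat_sub_le {N : ℕ} {ι : Type*} [Fintype ι] {v : ι → EuclideanSpace ℂ (Fin N)}
    (hv : Orthonormal ℂ v) {w : List (List GRat)} (hw : IsFrame N w) (e : ι ≃ Fin w.length)
    {ε : ℝ} (h : ∀ a (i : Fin N), ‖(entry w (e a) i).val - v a i‖ ≤ ε) (i j : Fin N) :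
    ‖projMat N w i j - ∑ a, v a i * star (v a j)‖ ≤ Fintype.card ι * (2 * ε) := by
  rw [projMat, ← e.sum_comp, ← Finset.sum_sub_distrib]
  refine (norm_sum_le _ _).trans ?_
  refine (Finset.sum_le_sum fun a _ => norm_mul_star_sub_le
    (norm_coord_le_one (hw.norm_frameVec (e a)) j) (norm_coord_le_one (hv.norm_eq_one a) i)
    (h a i) (h a j)).trans ?_
  simp

/-! ### Replacing the projections of a test by projections onto frames -/

/-- The precision to which the projection with index `m` on `N`-dimensional space is
approximated. -/
def testPrecision (N m : ℕ) : ℕ := 4 * (N * N) * (m + 1)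

/-- The projection onto the frame `w` approximates the matrix with code `c`. -/
def nearMatB (c : List (List AlgCode)) (N T : ℕ) (w : List (List GRat)) : Bool :=
  ball N fun i => ball N fun j =>
    ((projEntry w i j).sub (AlgCode.approx ((c.getD i []).getD j ([], 0, 0, 0)) (2 * T))).small T

@[fun_prop]
theorem computable_testPrecision {β : Type*} [Primcodable β] {N m : β → ℕ} (hN : Computable N)
    (hm : Computable m) : Computable fun x => testPrecision (N x) (m x) := by
  unfold testPrecision; fun_prop

@[fun_prop]
theorem computable_nearMatB {β : Type*} [Primcodable β] {c : β → List (List AlgCode)}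
    {N T : β → ℕ} {w : β → List (List GRat)} (hc : Computable c) (hN : Computable N)
    (hT : Computable T) (hw : Computable w) :
    Computable fun x => nearMatB (c x) (N x) (T x) (w x) := by
  unfold nearMatB; fun_prop

/-- The projections of a computable sequence are approximated, effectively and arbitrarily well,
by projections of the same rank onto frames. -/
theorem exists_computable_frames {S : ℕ → SpecialProjection} (hS : IsComputableProjSeq S) :
    ∃ w : ℕ → List (List GRat), Computable w ∧ (Computable fun m => (S m).qubits) ∧
      ∀ m, IsFrame (2 ^ (S m).qubits) (w m) ∧ (S m).mat.trace = (w m).length ∧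
        ∀ i j, ‖projMat (2 ^ (S m).qubits) (w m) i j - (S m).mat i j‖ ≤
          2 / testPrecision (2 ^ (S m).qubits) m := by
  obtain ⟨f, hf, hfS⟩ := hS
  choose c hc hcS using hfS
  have hcc : Computable c := by
    have h1 : Computable fun m =>
        (Encodable.decode (f m) : Option (List (List AlgCode))).getD [] := by fun_prop
    refine h1.of_eq fun m => ?_
    rw [hc]; rfl
  have hlen : ∀ m, (c m).length = 2 ^ (S m).qubits := fun m => (matDenotes_iff.1 (hcS m)).1
  have hden : ∀ m (i j : Fin (2 ^ (S m).qubits)),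
      (((c m).getD i []).getD j ([], 0, 0, 0)).Denotes ((S m).mat i j) := fun m i j =>
    (vecDenotes_iff.1 ((matDenotes_iff.1 (hcS m)).2 i)).2 j
  have hTpos : ∀ m, (0 : ℝ) < testPrecision (2 ^ (S m).qubits) m := by
    intro m
    have : 0 < testPrecision (2 ^ (S m).qubits) m := by unfold testPrecision; positivity
    exact_mod_cast this
  have happrox : ∀ m (i j : Fin (2 ^ (S m).qubits)),
      ‖(AlgCode.approx (((c m).getD i []).getD j ([], 0, 0, 0))
        (2 * testPrecision (2 ^ (S m).qubits) m)).val - (S m).mat i j‖ <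
        1 / (2 * testPrecision (2 ^ (S m).qubits) m) := by
    intro m i j
    have h := AlgCode.norm_approx_sub_lt (hden m i j) (2 * testPrecision (2 ^ (S m).qubits) m)
    have h2 := hTpos m
    rw [lt_div_iff₀ (by positivity)]
    refine lt_of_le_of_lt ?_ h
    push_cast
    gcongr
    linarith
  -- the search runs over the number of qubits and the frame
  obtain ⟨s, hs, hsp⟩ := Computable.exists_search (α := ℕ) (p := fun m q =>
      eqB (2 ^ ((Encodable.decode q : Option (ℕ × List (List GRat))).getD (0, [])).1)
        (c m).length &&
      (isFrameB (c m).length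
        ((Encodable.decode q : Option (ℕ × List (List GRat))).getD (0, [])).2 &&
      nearMatB (c m) (c m).length (testPrecision (c m).length m)
        ((Encodable.decode q : Option (ℕ × List (List GRat))).getD (0, [])).2))
      (by fun_prop) (by
    intro m
    obtain ⟨ι, _, _, v, hv, hvS⟩ :=
      exists_orthonormal_of_projection (S m).isHermitian (S m).isIdempotentElem
    have hT := hTpos m
    set T := testPrecision (2 ^ (S m).qubits) m with hTdef
    obtain ⟨w, hw, e, hwe⟩ := exists_frame_near v hv
      (ε := 1 / (4 * T * (Fintype.card ι + 1))) (by positivity)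
    refine ⟨Encodable.encode ((S m).qubits, w), ?_⟩
    simp only [Encodable.encodek, Option.getD_some, Bool.and_eq_true, eqB_eq_true,
      isFrameB_eq_true, hlen m]
    refine ⟨trivial, hw, ?_⟩
    simp only [nearMatB, ball_eq_true, ← hTdef]
    intro i hi j hj
    rw [GRat.small_eq_true, GRat.val_sub, val_projEntry w _ ⟨i, hi⟩ ⟨j, hj⟩, ← lt_div_iff₀ hT]
    have h1 := happrox m ⟨i, hi⟩ ⟨j, hj⟩
    have h2 := norm_projMat_sub_le hv hw e (fun a i => (hwe a i).le) ⟨i, hi⟩ ⟨j, hj⟩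
    rw [← hvS] at h2
    have h3 : (Fintype.card ι : ℝ) * (2 * (1 / (4 * T * (Fintype.card ι + 1)))) ≤ 1 / (2 * T) := by
      have : (Fintype.card ι : ℝ) * (2 * (1 / (4 * T * (Fintype.card ι + 1)))) =
        (Fintype.card ι / (Fintype.card ι + 1)) * (1 / (2 * T)) := by field_simp; ring
      rw [this]
      refine mul_le_of_le_one_left (by positivity) ?_
      rw [div_le_one (by positivity)]
      linarith
    have h4 := norm_sub_le_norm_sub_add_norm_sub
      (projMat (2 ^ (S m).qubits) w ⟨i, hi⟩ ⟨j, hj⟩) ((S m).mat ⟨i, hi⟩ ⟨j, hj⟩)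
      (AlgCode.approx (((c m).getD i []).getD j ([], 0, 0, 0)) (2 * T)).val
    rw [norm_sub_rev ((S m).mat ⟨i, hi⟩ ⟨j, hj⟩)] at h4
    have h5 : (1 : ℝ) / (2 * T) + 1 / (2 * T) = 1 / T := by field_simp; norm_num
    linarith)
  let w : ℕ → List (List GRat) := fun m =>
    ((Encodable.decode (s m) : Option (ℕ × List (List GRat))).getD (0, [])).2
  have hnq : ∀ m, ((Encodable.decode (s m) : Option (ℕ × List (List GRat))).getD (0, [])).1 =
      (S m).qubits := by
    intro m
    have h := hsp m
    simp only [Bool.and_eq_true, eqB_eq_true, hlen] at h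
    exact Nat.pow_right_injective le_rfl h.1
  have hframe : ∀ m, IsFrame (2 ^ (S m).qubits) (w m) := by
    intro m
    have h := hsp m
    simp only [Bool.and_eq_true, isFrameB_eq_true, hlen] at h
    exact h.2.1
  have hclose : ∀ m i j, ‖projMat (2 ^ (S m).qubits) (w m) i j - (S m).mat i j‖ ≤
      2 / testPrecision (2 ^ (S m).qubits) m := by
    intro m i j
    have h := hsp m
    simp only [Bool.and_eq_true, hlen] at h
    have h1 := h.2.2
    simp only [nearMatB, ball_eq_true] at h1
    have h2 := GRat.small_eq_true.1 (h1 i i.2 j j.2)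
    rw [GRat.val_sub, val_projEntry, ← lt_div_iff₀ (hTpos m)] at h2
    have h3 := happrox m i j
    have h4 := norm_sub_le_norm_sub_add_norm_sub (projMat (2 ^ (S m).qubits) (w m) i j)
      (AlgCode.approx (((c m).getD i []).getD j ([], 0, 0, 0))
        (2 * testPrecision (2 ^ (S m).qubits) m)).val ((S m).mat i j)
    have h5 : (1 : ℝ) / (2 * testPrecision (2 ^ (S m).qubits) m) ≤
        1 / testPrecision (2 ^ (S m).qubits) m := by
      have := hTpos m
      gcongr
      linarith
    have h6 : (2 : ℝ) / testPrecision (2 ^ (S m).qubits) m =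
      1 / testPrecision (2 ^ (S m).qubits) m + 1 / testPrecision (2 ^ (S m).qubits) m := by ring
    rw [h6]
    have h2' : ‖projMat (2 ^ (S m).qubits) (w m) i j -
      (AlgCode.approx (((c m).getD i []).getD j ([], 0, 0, 0))
        (2 * testPrecision (2 ^ (S m).qubits) m)).val‖ <
        1 / testPrecision (2 ^ (S m).qubits) m := h2
    linarith
  refine ⟨w, by fun_prop, ?_, fun m => ⟨hframe m, ?_, hclose m⟩⟩
  · have : Computable fun m =>
      ((Encodable.decode (s m) : Option (ℕ × List (List GRat))).getD (0, [])).1 := by fun_prop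
    exact this.of_eq hnq
  · -- both traces are natural numbers, and they differ by less than one
    obtain ⟨ι, _, _, v, hv, hvS⟩ :=
      exists_orthonormal_of_projection (S m).isHermitian (S m).isIdempotentElem
    have htr : (S m).mat.trace = (Fintype.card ι : ℕ) := by
      simp only [Matrix.trace, Matrix.diag_apply, hvS]
      rw [Finset.sum_comm]
      have h1 : ∀ a : ι, ∑ i, v a i * star (v a i) = 1 := by
        intro a
        have := inner_self_eq_one_of_norm_eq_one (𝕜 := ℂ) (hv.norm_eq_one a)
        rw [PiLp.inner_apply] at this
        rw [← this]
        exact Finset.sum_congr rfl fun i _ => rfl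
      rw [Finset.sum_congr rfl fun a _ => h1 a]
      simp
    have hdiff : ‖(projMat (2 ^ (S m).qubits) (w m)).trace - (S m).mat.trace‖ < 1 := by
      rw [← Matrix.trace_sub, Matrix.trace]
      refine lt_of_le_of_lt (norm_sum_le _ _) ?_
      refine lt_of_le_of_lt (Finset.sum_le_sum fun i _ => hclose m i i) ?_
      simp only [Finset.sum_const, Finset.card_univ, Fintype.card_fin, nsmul_eq_mul]
      rw [mul_div_assoc', div_lt_one (hTpos m)]
      have : (2 ^ (S m).qubits) * 2 < testPrecision (2 ^ (S m).qubits) m := by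
        unfold testPrecision
        have h1 : 0 < 2 ^ (S m).qubits := by positivity
        nlinarith [Nat.zero_le m, Nat.mul_pos h1 h1]
      exact_mod_cast this
    rw [(hframe m).trace_projMat, htr] at hdiff
    have h2 : ‖((((w m).length : ℤ) - (Fintype.card ι : ℤ) : ℤ) : ℂ)‖ < 1 := by
      push_cast
      exact hdiff
    rw [Complex.norm_intCast] at h2
    have h3 : |((w m).length : ℤ) - (Fintype.card ι : ℤ)| < 1 := by exact_mod_cast h2
    rw [Int.abs_lt_one_iff] at h3
    rw [htr]
    have h4 : Fintype.card ι = (w m).length := by omega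
    rw [h4]

/-! ### Slowly growing weights for convergent series -/

theorem sum_range_le_of_le_geometric {f : ℕ → ℝ} {A : ℝ} (hA : 0 ≤ A) (h1 : ∀ j, f j ≤ A)
    (h2 : ∀ j, f j ≤ (2⁻¹ : ℝ) ^ (j + 1)) (L K : ℕ) :
    ∑ j ∈ Finset.range L, f j ≤ K * A + (2⁻¹ : ℝ) ^ K := by
  have key : ∀ L K : ℕ, ∑ j ∈ Finset.range L, f (K + j) ≤ (2⁻¹ : ℝ) ^ K - (2⁻¹ : ℝ) ^ (K + L) := by
    intro L K
    induction L with
    | zero => simp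
    | succ L ih =>
      rw [Finset.sum_range_succ]
      have h3 := h2 (K + L)
      have e : (2⁻¹ : ℝ) ^ (K + L) = (2⁻¹ : ℝ) ^ (K + L + 1) + (2⁻¹ : ℝ) ^ (K + L + 1) := by ring
      have e' : (2⁻¹ : ℝ) ^ (K + (L + 1)) = (2⁻¹ : ℝ) ^ (K + L + 1) := rfl
      rw [e']
      linarith
  have hK : ∀ K : ℕ, ∑ j ∈ Finset.range K, f j ≤ K * A := fun K => by
    simpa using Finset.sum_le_card_nsmul (Finset.range K) f A fun j _ => h1 j
  have hpos : ∀ j : ℕ, (0 : ℝ) ≤ (2⁻¹ : ℝ) ^ j := fun j => by positivity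
  rcases le_total L K with h | h
  · have h3 : (L : ℝ) * A ≤ K * A := by gcongr
    linarith [hK L, hpos K]
  · obtain ⟨M, rfl⟩ := Nat.exists_eq_add_of_le h
    rw [Finset.sum_range_add]
    linarith [hK K, key M K, hpos (K + M)]

/-- A convergent series of nonnegative computable rationals whose sum is computable still has these
properties after its terms are multiplied by suitable computable weights tending to infinity. -/
theorem exists_slow_weights {b : ℕ → ℝ} (hb : IsGRatSeq b) (h0 : ∀ m, 0 ≤ b m) {B : ℝ}
    (hsum : HasSum b B) (hB : IsComputableReal B) :
    ∃ g : ℕ → ℕ, Computable g ∧ Tendsto g atTop atTop ∧ ∃ A ≤ (1 : ℝ),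
      HasSum (fun m => g m * b m) A ∧ ∃ N : ℕ → ℕ, Computable N ∧
        ∀ k, A - ∑ i ∈ Finset.range (N k), g i * b i ≤ (2⁻¹ : ℝ) ^ k := by
  obtain ⟨N, hN, hNB⟩ := exists_computable_modulus hb hsum hB
  -- the tail after `N (j + 1)` is at most `2 ^ (-(j + 1))`, so each term may be counted once more
  -- beyond each of these thresholds
  let g : ℕ → ℕ := fun m => natSum (m + 1) fun j => bif leB (N (j + 1)) m then 1 else 0
  have hg : Computable g := by fun_prop
  have hgeq : ∀ m, g m = ∑ j ∈ Finset.range (m + 1), if N (j + 1) ≤ m then 1 else 0 := by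
    intro m
    simp only [g, natSum_eq]
    refine Finset.sum_congr rfl fun j _ => ?_
    by_cases h : N (j + 1) ≤ m
    · rw [leB_eq_true.2 h, if_pos h]; rfl
    · rw [Bool.eq_false_iff.2 (fun h' => h (leB_eq_true.1 h')), if_neg h]; rfl
  have htail : ∀ M M' : ℕ, ∑ m ∈ Finset.Ico M M', b m ≤ B - ∑ i ∈ Finset.range M, b i := by
    intro M M'
    rcases le_total M M' with h | h
    · rw [Finset.sum_Ico_eq_sub _ h]
      linarith [sum_le_hasSum (Finset.range M') (fun i _ => h0 i) hsum]
    · rw [Finset.Ico_eq_empty_of_le h, Finset.sum_empty]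
      linarith [sum_le_hasSum (Finset.range M) (fun i _ => h0 i) hsum]
  -- the weighted sums are rearranged by the threshold that contributes to the weight
  have hmain : ∀ M M' K : ℕ, ∑ m ∈ Finset.Ico M M', g m * b m ≤
      K * (B - ∑ i ∈ Finset.range M, b i) + (2⁻¹ : ℝ) ^ K := by
    intro M M' K
    have h1 : ∑ m ∈ Finset.Ico M M', g m * b m ≤
        ∑ j ∈ Finset.range M', ∑ m ∈ Finset.Ico M M', if N (j + 1) ≤ m then b m else 0 := by
      rw [Finset.sum_comm]
      refine Finset.sum_le_sum fun m hm => ?_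
      rw [hgeq, Nat.cast_sum, Finset.sum_mul]
      have hle : m + 1 ≤ M' := (Finset.mem_Ico.1 hm).2
      refine le_trans (le_of_eq (Finset.sum_congr rfl fun j _ => ?_))
        (Finset.sum_le_sum_of_subset_of_nonneg (Finset.range_subset_range.2 hle)
          fun j _ _ => ?_)
      · split_ifs <;> simp
      · split_ifs
        · exact h0 m
        · exact le_rfl
    refine h1.trans (sum_range_le_of_le_geometric ?_ (fun j => ?_) (fun j => ?_) M' K)
    · simpa using htail M M
    · refine (Finset.sum_le_sum fun m _ => ?_).trans (htail M M')
      split_ifs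
      · exact le_rfl
      · exact h0 m
    · refine le_trans ?_ ((htail (N (j + 1)) M').trans (hNB (j + 1)))
      rw [← Finset.sum_filter]
      refine Finset.sum_le_sum_of_subset_of_nonneg (fun m hm => ?_) fun m _ _ => h0 m
      simp only [Finset.mem_filter, Finset.mem_Ico] at hm ⊢
      omega
  have hnn : ∀ m, 0 ≤ g m * b m := fun m => mul_nonneg (Nat.cast_nonneg _) (h0 m)
  have hbd : ∀ M, ∑ m ∈ Finset.range M, g m * b m ≤ 1 := by
    intro M
    have := hmain 0 M 0
    simpa using this
  have hsummable : Summable fun m => g m * b m := summable_of_sum_range_le hnn hbd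
  refine ⟨g, hg, ?_, _, hsummable.tsum_le_of_sum_range_le hbd, hsummable.hasSum,
    fun k => N (2 * (k + 1)), by fun_prop, fun k => ?_⟩
  · refine tendsto_atTop.2 fun L => ?_
    have hev : ∀ᶠ m in atTop, ∀ j ∈ Finset.range L, N (j + 1) ≤ m :=
      (Finset.eventually_all _).2 fun j _ => eventually_ge_atTop _
    filter_upwards [hev, eventually_ge_atTop L] with m hm hmL
    rw [hgeq]
    calc L = ∑ j ∈ Finset.range L, 1 := by simp
      _ = ∑ j ∈ Finset.range L, (if N (j + 1) ≤ m then 1 else 0) :=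
        Finset.sum_congr rfl fun j hj => (if_pos (hm j hj)).symm
      _ ≤ _ := Finset.sum_le_sum_of_subset_of_nonneg
        (Finset.range_subset_range.2 (by omega)) fun _ _ _ => Nat.zero_le _
  · set M := N (2 * (k + 1))
    have h1 : ∀ M', ∑ m ∈ Finset.range M', g m * b m ≤
        (2⁻¹ : ℝ) ^ k + ∑ m ∈ Finset.range M, g m * b m := by
      intro M'
      have hK : ((k + 1 : ℕ) : ℝ) * (B - ∑ i ∈ Finset.range M, b i) + (2⁻¹ : ℝ) ^ (k + 1) ≤
          (2⁻¹ : ℝ) ^ k := by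
        have h2 := hNB (2 * (k + 1))
        have h3 : ((k + 1 : ℕ) : ℝ) ≤ 2 ^ (k + 1) := by exact_mod_cast Nat.lt_two_pow_self.le
        have h4 : ((k + 1 : ℕ) : ℝ) * (B - ∑ i ∈ Finset.range M, b i) ≤
            2 ^ (k + 1) * (2⁻¹ : ℝ) ^ (2 * (k + 1)) := by
          refine mul_le_mul h3 h2 ?_ (by positivity)
          simpa using htail M M
        have h5 : (2 : ℝ) ^ (k + 1) * (2⁻¹ : ℝ) ^ (2 * (k + 1)) = (2⁻¹ : ℝ) ^ (k + 1) := by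
          rw [two_mul, pow_add (2⁻¹ : ℝ), ← mul_assoc, ← mul_pow]; norm_num
        have h6 : (2⁻¹ : ℝ) ^ k = (2⁻¹ : ℝ) ^ (k + 1) + (2⁻¹ : ℝ) ^ (k + 1) := by ring
        linarith
      have h2 := hmain M M' (k + 1)
      rcases le_total M M' with h | h
      · rw [Finset.sum_Ico_eq_sub _ h] at h2
        linarith
      · have h3 : ∑ m ∈ Finset.range M', g m * b m ≤ ∑ m ∈ Finset.range M, g m * b m :=
          Finset.sum_le_sum_of_subset_of_nonneg (Finset.range_subset_range.2 h)
            fun m _ _ => hnn m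
        have : (0 : ℝ) ≤ (2⁻¹ : ℝ) ^ k := by positivity
        linarith
    have := hsummable.tsum_le_of_sum_range_le h1
    linarith

/-! ### Bitstrings as dyadic intervals -/

/-- The number with binary expansion `σ`, most significant digit first. -/
def bitsVal (σ : List Bool) : ℕ := σ.foldl (fun acc b => 2 * acc + bif b then 1 else 0) 0

theorem foldl_bits (σ : List Bool) (a : ℕ) :
    σ.foldl (fun acc b => 2 * acc + bif b then 1 else 0) a = a * 2 ^ σ.length + bitsVal σ := by
  induction σ generalizing a with
  | nil => simp [bitsVal]
  | cons b σ ih =>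
    rw [bitsVal, List.foldl_cons, List.foldl_cons, ih, ih (2 * 0 + _), List.length_cons, pow_succ]
    ring

theorem bitsVal_append (σ τ : List Bool) :
    bitsVal (σ ++ τ) = bitsVal σ * 2 ^ τ.length + bitsVal τ := by
  rw [bitsVal, List.foldl_append, foldl_bits]; rfl

theorem bitsVal_cons (b : Bool) (σ : List Bool) :
    bitsVal (b :: σ) = (bif b then 1 else 0) * 2 ^ σ.length + bitsVal σ := by
  rw [bitsVal, List.foldl_cons, foldl_bits]; simp

theorem bitsVal_lt (σ : List Bool) : bitsVal σ < 2 ^ σ.length := by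
  induction σ with
  | nil => simp [bitsVal]
  | cons b σ ih =>
    rw [bitsVal_cons, List.length_cons, pow_succ]
    cases b <;> simp <;> omega

theorem exists_bitsVal_eq (l : ℕ) : ∀ k < 2 ^ l, ∃ σ : List Bool, σ.length = l ∧ bitsVal σ = k := by
  induction l with
  | zero =>
    intro k hk
    exact ⟨[], rfl, by simp [bitsVal]; omega⟩
  | succ l ih =>
    intro k hk
    rw [pow_succ] at hk
    by_cases h : k < 2 ^ l
    · obtain ⟨σ, h1, h2⟩ := ih k h
      exact ⟨false :: σ, by simp [h1], by simp [bitsVal_cons, h2]⟩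
    · obtain ⟨σ, h1, h2⟩ := ih (k - 2 ^ l) (by omega)
      exact ⟨true :: σ, by simp [h1], by simp [bitsVal_cons, h1, h2]; omega⟩

theorem bitsVal_injective : ∀ {σ τ : List Bool}, σ.length = τ.length → bitsVal σ = bitsVal τ → σ = τ
  | [], [], _, _ => rfl
  | b :: σ, c :: τ, hl, hv => by
    simp only [List.length_cons, Nat.add_right_cancel_iff] at hl
    rw [bitsVal_cons, bitsVal_cons, hl] at hv
    have h1 := bitsVal_lt σ
    have h2 := bitsVal_lt τ
    rw [hl] at h1
    have hbc : b = c := by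
      cases b <;> cases c <;> simp at hv ⊢ <;> omega
    subst hbc
    rw [bitsVal_injective hl (by omega)]

@[fun_prop]
theorem computable_bitsVal {β : Type*} [Primcodable β] {s : β → List Bool} (hs : Computable s) :
    Computable fun x => bitsVal (s x) := by
  have h : Primrec bitsVal := by
    have h1 : Primrec₂ fun (_ : List Bool) (p : ℕ × Bool) => 2 * p.1 + bif p.2 then 1 else 0 := by
      have h2 : Primrec fun p : List Bool × ℕ × Bool => 2 * p.2.1 :=
        Primrec.nat_mul.comp (Primrec.const 2) (Primrec.fst.comp Primrec.snd)
      exact Primrec.nat_add.comp h2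
        (Primrec.cond (Primrec.snd.comp Primrec.snd) (Primrec.const 1) (Primrec.const 0))
    exact Primrec.list_foldl Primrec.id (Primrec.const 0) h1
  exact h.to_comp.comp hs

/-- The left end point of the dyadic interval coded by `σ`. -/
noncomputable def leftEnd (σ : List Bool) : ℝ := bitsVal σ / 2 ^ σ.length

theorem leftEnd_of_prefix {σ τ : List Bool} (h : σ <+: τ) :
    leftEnd σ ≤ leftEnd τ ∧ leftEnd τ < leftEnd σ + (2⁻¹ : ℝ) ^ σ.length := by
  obtain ⟨υ, rfl⟩ := h
  have h1 : leftEnd (σ ++ υ) = leftEnd σ + (bitsVal υ / 2 ^ υ.length) * (2⁻¹ : ℝ) ^ σ.length := by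
    rw [leftEnd, leftEnd, bitsVal_append, List.length_append, pow_add]
    push_cast
    rw [inv_pow]
    field_simp
  have h2 : (bitsVal υ : ℝ) / 2 ^ υ.length < 1 := by
    rw [div_lt_one (by positivity)]
    exact_mod_cast bitsVal_lt υ
  have h3 : (0 : ℝ) < (2⁻¹ : ℝ) ^ σ.length := by positivity
  rw [h1]
  constructor
  · have : (0 : ℝ) ≤ (bitsVal υ : ℝ) / 2 ^ υ.length * (2⁻¹ : ℝ) ^ σ.length := by positivity
    linarith
  · have : (bitsVal υ : ℝ) / 2 ^ υ.length * (2⁻¹ : ℝ) ^ σ.length < 1 * (2⁻¹ : ℝ) ^ σ.length := by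
      gcongr
    linarith

/-! ### Machines with prescribed code lengths -/

/-- The length of the code word for the weight `g`: the least `l` with `2 * 2 ^ (-l) ≤ g`. -/
def codeLength (g : GRat) : ℕ :=
  firstBelow (g.2.2 + 3) fun l => leB (2 * (g.2.2 + 1)) (2 ^ l * g.1.natAbs)

/-- `σ` is the code word for the weight `g` given that the preceding weights sum to `a`: it codes
the leftmost dyadic interval of the appropriate length whose left end point is at least `a`. -/
def isCodeWord (g a : GRat) (σ : List Bool) : Bool :=
  leB 1 g.1.natAbs && (eqB σ.length (codeLength g) &&
    (leB (a.1.natAbs * 2 ^ σ.length) (bitsVal σ * (a.2.2 + 1)) &&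
      leB (bitsVal σ * (a.2.2 + 1) + 1) (a.1.natAbs * 2 ^ σ.length + (a.2.2 + 1))))

@[fun_prop]
theorem computable_codeLength {β : Type*} [Primcodable β] {g : β → GRat} (hg : Computable g) :
    Computable fun x => codeLength (g x) := by
  unfold codeLength; fun_prop

@[fun_prop]
theorem computable_isCodeWord {β : Type*} [Primcodable β] {g a : β → GRat} {σ : β → List Bool}
    (hg : Computable g) (ha : Computable a) (hσ : Computable σ) :
    Computable fun x => isCodeWord (g x) (a x) (σ x) := by
  unfold isCodeWord; fun_prop

theorem GRat.eq_natAbs_div {g : GRat} {x : ℝ} (hx : 0 ≤ x) (h : g.val = (x : ℂ)) :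
    x = (g.1.natAbs : ℝ) / ((g.2.2 : ℝ) + 1) := by
  have h1 := congrArg Complex.re h
  have h2 : ((g.2.2 : ℂ) + 1) = (((g.2.2 : ℝ) + 1 : ℝ) : ℂ) := by push_cast; rfl
  rw [GRat.val, h2, Complex.div_ofReal_re, Complex.ofReal_re] at h1
  have h3 : x = (g.1 : ℝ) / ((g.2.2 : ℝ) + 1) := by
    rw [← h1]; simp
  have h4 : (0 : ℝ) ≤ g.1 := by
    rw [h3] at hx
    by_contra hneg
    exact absurd hx (not_le.2 (div_neg_of_neg_of_pos (not_le.1 hneg) (by positivity)))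
  rw [h3, Nat.cast_natAbs, Int.cast_abs, abs_of_nonneg h4]

theorem codeLength_spec {g : GRat} {x : ℝ} (hx : 0 < x) (hx1 : x ≤ 1) (h : g.val = (x : ℂ)) :
    2 * (2⁻¹ : ℝ) ^ codeLength g ≤ x ∧ x < 4 * (2⁻¹ : ℝ) ^ codeLength g := by
  have hxe := GRat.eq_natAbs_div hx.le h
  have hd : (0 : ℝ) < (g.2.2 : ℝ) + 1 := by positivity
  have key : ∀ l : ℕ, leB (2 * (g.2.2 + 1)) (2 ^ l * g.1.natAbs) = true ↔
      2 * (2⁻¹ : ℝ) ^ l ≤ x := by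
    intro l
    rw [leB_eq_true, hxe, le_div_iff₀ hd, inv_pow, ← div_eq_mul_inv, div_mul_eq_mul_div,
      div_le_iff₀ (by positivity), mul_comm ((g.1.natAbs : ℝ))]
    exact_mod_cast Iff.rfl
  have hpos : 1 ≤ g.1.natAbs := by
    by_contra hc
    have : g.1.natAbs = 0 := by omega
    rw [this] at hxe
    simp at hxe
    linarith
  have hbound : leB (2 * (g.2.2 + 1)) (2 ^ (g.2.2 + 1) * g.1.natAbs) = true := by
    rw [leB_eq_true, pow_succ]
    have := Nat.lt_two_pow_self (n := g.2.2)
    nlinarith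
  have h1 := firstBelow_lt (n := g.2.2 + 3) (i := g.2.2 + 1)
    (f := fun l => leB (2 * (g.2.2 + 1)) (2 ^ l * g.1.natAbs)) (by omega) hbound
  have h2 : 2 * (2⁻¹ : ℝ) ^ codeLength g ≤ x := (key _).1 h1.2.1
  refine ⟨h2, ?_⟩
  by_contra hc
  rw [not_lt] at hc
  -- otherwise the preceding length would do as well
  rcases Nat.eq_zero_or_pos (codeLength g) with h0 | h0
  · rw [h0] at hc
    norm_num at hc
    linarith
  · obtain ⟨l, hl⟩ := Nat.exists_eq_succ_of_ne_zero h0.ne'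
    rw [hl, Nat.succ_eq_add_one, pow_succ] at hc
    have h3 : l ≤ g.2.2 + 1 := by
      have h5 : codeLength g ≤ g.2.2 + 1 := h1.2.2
      omega
    have h4 := firstBelow_lt (n := g.2.2 + 3) (i := l)
      (f := fun l => leB (2 * (g.2.2 + 1)) (2 ^ l * g.1.natAbs)) (by omega)
      ((key l).2 (by linarith))
    have h5 : codeLength g ≤ l := h4.2.2
    omega

theorem isCodeWord_eq_true {g a : GRat} {x y : ℝ} (hx : 0 ≤ x) (hg : g.val = (x : ℂ)) (hy : 0 ≤ y)
    (ha : a.val = (y : ℂ)) {σ : List Bool} :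
    isCodeWord g a σ = true ↔ 0 < x ∧ σ.length = codeLength g ∧ y ≤ leftEnd σ ∧
      leftEnd σ < y + (2⁻¹ : ℝ) ^ σ.length := by
  have hxe := GRat.eq_natAbs_div hx hg
  have hye := GRat.eq_natAbs_div hy ha
  have hd : (0 : ℝ) < (g.2.2 : ℝ) + 1 := by positivity
  have hd' : (0 : ℝ) < (a.2.2 : ℝ) + 1 := by positivity
  have h1 : 1 ≤ g.1.natAbs ↔ 0 < x := by
    rw [hxe, div_pos_iff_of_pos_right hd, Nat.cast_pos]
    rfl
  have h2 : a.1.natAbs * 2 ^ σ.length ≤ bitsVal σ * (a.2.2 + 1) ↔ y ≤ leftEnd σ := by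
    rw [hye, leftEnd, div_le_div_iff₀ hd' (by positivity)]
    exact_mod_cast Iff.rfl
  have h3 : bitsVal σ * (a.2.2 + 1) + 1 ≤ a.1.natAbs * 2 ^ σ.length + (a.2.2 + 1) ↔
      leftEnd σ < y + (2⁻¹ : ℝ) ^ σ.length := by
    have e : (a.1.natAbs : ℝ) / ((a.2.2 : ℝ) + 1) + (2⁻¹ : ℝ) ^ σ.length =
        (a.1.natAbs * 2 ^ σ.length + (a.2.2 + 1)) / (((a.2.2 : ℝ) + 1) * 2 ^ σ.length) := by
      rw [inv_pow]; field_simp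
    rw [hye, leftEnd, e, div_lt_div_iff₀ (by positivity) (by positivity), ← mul_assoc,
      mul_lt_mul_iff_left₀ (by positivity), Nat.add_one_le_iff]
    exact_mod_cast Iff.rfl
  rw [isCodeWord]
  simp only [Bool.and_eq_true, leB_eq_true, eqB_eq_true, h1, h2, h3]

/-- An effective Kraft inequality: given computable rational weights with computable sum at most
one, there is a computable measure machine that has the prescribed outputs and uses, for each
positive weight, a code word whose measure is within a factor of four of the weight. -/
theorem exists_machine {W : ℕ → ℝ} (hW : IsGRatSeq W) (h0 : ∀ m, 0 ≤ W m) {A : ℝ} (hA : A ≤ 1)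
    (hsum : HasSum W A) {N : ℕ → ℕ} (hN : Computable N)
    (hmod : ∀ k, A - ∑ i ∈ Finset.range (N k), W i ≤ (2⁻¹ : ℝ) ^ k)
    {out : ℕ → ℕ} (hout : Computable out) :
    ∃ C : PrefixFreeMachine, C.IsComputableMeasure ∧ ∀ m, 0 < W m →
      ∃ σ, out m ∈ C.run σ ∧ W m < 4 * (2⁻¹ : ℝ) ^ σ.length := by
  obtain ⟨s, hs, hsW⟩ := hW.partialSum
  obtain ⟨g, hg, hgW⟩ := hW
  set S : ℕ → ℝ := fun M => ∑ i ∈ Finset.range M, W i with hS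
  have hSmono : Monotone S := fun M M' h =>
    Finset.sum_le_sum_of_subset_of_nonneg (Finset.range_subset_range.2 h) fun i _ _ => h0 i
  have hS0 : ∀ M, 0 ≤ S M := fun M => Finset.sum_nonneg fun i _ => h0 i
  have hS1 : ∀ M, S M ≤ 1 := fun M => (sum_le_hasSum _ (fun i _ => h0 i) hsum).trans hA
  have hSs : ∀ M, S (M + 1) = S M + W M := fun M => Finset.sum_range_succ _ _
  have hW1 : ∀ m, W m ≤ 1 := fun m => by linarith [hS0 m, hS1 (m + 1), hSs m]
  have hacc : ∀ σ m, isCodeWord (g m) (s m) σ = true ↔ 0 < W m ∧ σ.length = codeLength (g m) ∧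
      S m ≤ leftEnd σ ∧ leftEnd σ < S m + (2⁻¹ : ℝ) ^ σ.length := fun σ m =>
    isCodeWord_eq_true (h0 m) (hgW m) (hS0 m) (hsW m)
  have hupper : ∀ σ m, isCodeWord (g m) (s m) σ = true →
      leftEnd σ + (2⁻¹ : ℝ) ^ σ.length < S (m + 1) := by
    intro σ m h
    obtain ⟨h1, h2, h3, h4⟩ := (hacc σ m).1 h
    have h5 := (codeLength_spec h1 (hW1 m) (hgW m)).1
    rw [← h2] at h5
    linarith [hSs m]
  -- code words for different indices code disjoint intervals
  have huniq : ∀ σ τ m m', isCodeWord (g m) (s m) σ = true → isCodeWord (g m') (s m') τ = true →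
      σ <+: τ → m = m' := by
    intro σ τ m m' h h' hp
    obtain ⟨h1, h2⟩ := leftEnd_of_prefix hp
    have h3 := ((hacc σ m).1 h).2.2.1
    have h4 := hupper σ m h
    have h5 := ((hacc τ m').1 h').2.2.1
    have h6 := hupper τ m' h'
    have h7 : (0 : ℝ) < (2⁻¹ : ℝ) ^ τ.length := by positivity
    by_contra hne
    rcases lt_or_gt_of_ne hne with hlt | hlt
    · have := hSmono (Nat.succ_le_of_lt hlt)
      simp only [Nat.succ_eq_add_one] at this
      linarith
    · have := hSmono (Nat.succ_le_of_lt hlt)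
      simp only [Nat.succ_eq_add_one] at this
      linarith
  have hex : ∀ m, 0 < W m → ∃ σ, isCodeWord (g m) (s m) σ = true := by
    intro m hm
    have h1 := (codeLength_spec hm (hW1 m) (hgW m)).1
    set l := codeLength (g m) with hl
    have hpow : (0 : ℝ) < (2⁻¹ : ℝ) ^ l := by positivity
    have e : (2⁻¹ : ℝ) ^ l * 2 ^ l = 1 := by rw [← mul_pow]; norm_num
    have hc1 := Nat.le_ceil (S m * 2 ^ l)
    have hc2 := Nat.ceil_lt_add_one (mul_nonneg (hS0 m) (by positivity : (0 : ℝ) ≤ 2 ^ l))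
    have hlt : ⌈S m * 2 ^ l⌉₊ < 2 ^ l := by
      have h2 : (⌈S m * 2 ^ l⌉₊ : ℝ) < 2 ^ l := by
        have h3 : S m + 2 * (2⁻¹ : ℝ) ^ l ≤ 1 := by linarith [hS1 (m + 1), hSs m]
        have h4 : (S m + 2 * (2⁻¹ : ℝ) ^ l) * 2 ^ l ≤ 1 * 2 ^ l := by gcongr
        have h5 : (S m + 2 * (2⁻¹ : ℝ) ^ l) * 2 ^ l = S m * 2 ^ l + 2 := by
          rw [add_mul, mul_assoc 2, e, mul_one]
        linarith
      exact_mod_cast h2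
    obtain ⟨σ, hσ1, hσ2⟩ := exists_bitsVal_eq l _ hlt
    refine ⟨σ, (hacc σ m).2 ⟨hm, hσ1, ?_, ?_⟩⟩
    · rw [leftEnd, hσ2, hσ1, le_div_iff₀ (by positivity)]
      exact hc1
    · rw [leftEnd, hσ2, hσ1, div_lt_iff₀ (by positivity), add_mul, e]
      exact hc2
  have hinj : ∀ σ τ m, isCodeWord (g m) (s m) σ = true → isCodeWord (g m) (s m) τ = true →
      σ = τ := by
    intro σ τ m h h'
    obtain ⟨_, h2, h3, h4⟩ := (hacc σ m).1 h
    obtain ⟨_, h2', h3', h4'⟩ := (hacc τ m).1 h'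
    have hlen : σ.length = τ.length := h2.trans h2'.symm
    refine bitsVal_injective hlen ?_
    have e : (2⁻¹ : ℝ) ^ τ.length * 2 ^ τ.length = 1 := by rw [← mul_pow]; norm_num
    have hp : (0 : ℝ) < 2 ^ τ.length := by positivity
    rw [leftEnd, hlen] at h3 h4
    rw [leftEnd] at h3' h4'
    rw [le_div_iff₀ hp] at h3 h3'
    rw [div_lt_iff₀ hp, add_mul, e] at h4 h4'
    have h5 : (bitsVal σ : ℝ) < bitsVal τ + 1 := by linarith
    have h6 : (bitsVal τ : ℝ) < bitsVal σ + 1 := by linarith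
    have h5' : bitsVal σ < bitsVal τ + 1 := by exact_mod_cast h5
    have h6' : bitsVal τ < bitsVal σ + 1 := by exact_mod_cast h6
    omega
  let f : List Bool →. ℕ := fun σ =>
    (Nat.rfind fun m => Part.some (isCodeWord (g m) (s m) σ)).map out
  have hf : Partrec f := by
    refine Partrec.map (Partrec.rfind ?_) ?_
    · have : Computable fun p : List Bool × ℕ => isCodeWord (g p.2) (s p.2) p.1 := by fun_prop
      exact this.partrec
    · have : Computable fun p : List Bool × ℕ => out p.2 := by fun_prop
      exact this
  have hmem : ∀ σ k, k ∈ f σ ↔ ∃ m, isCodeWord (g m) (s m) σ = true ∧ out m = k := by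
    intro σ k
    have hfind : ∀ m, m ∈ Nat.rfind (fun m => Part.some (isCodeWord (g m) (s m) σ)) ↔
        isCodeWord (g m) (s m) σ = true ∧ ∀ j < m, isCodeWord (g j) (s j) σ = false := by
      intro m
      refine Nat.mem_rfind.trans (and_congr ?_ (forall_congr' fun j => imp_congr Iff.rfl ?_)) <;>
        exact Part.mem_some_iff.trans eq_comm
    simp only [f, Part.mem_map_iff, hfind]
    constructor
    · rintro ⟨m, ⟨h1, _⟩, h2⟩
      exact ⟨m, h1, h2⟩
    · rintro ⟨m, h1, h2⟩
      refine ⟨m, ⟨h1, fun j hj => ?_⟩, h2⟩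
      by_contra hne
      exact hj.ne (huniq σ σ j m (Bool.eq_true_of_not_eq_false hne) h1 List.prefix_rfl)
  have hdom : ∀ σ, (f σ).Dom ↔ ∃ m, isCodeWord (g m) (s m) σ = true := by
    intro σ
    rw [Part.dom_iff_mem]
    simp only [hmem]
    constructor
    · rintro ⟨k, m, h, _⟩
      exact ⟨m, h⟩
    · rintro ⟨m, h⟩
      exact ⟨_, m, h, rfl⟩
  let C : PrefixFreeMachine := ⟨f, hf, fun σ τ hσ hτ hp => by
    obtain ⟨m, hm⟩ := (hdom σ).1 hσ
    obtain ⟨m', hm'⟩ := (hdom τ).1 hτ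
    obtain rfl := huniq σ τ m m' hm hm' hp
    exact hinj σ τ m hm hm'⟩
  refine ⟨C, ?_, fun m hm => ?_⟩
  · classical
    let o : ℕ → Option (List Bool) := fun m =>
      if h : 0 < W m then some (hex m h).choose else none
    have ho : ∀ m σ, o m = some σ ↔ isCodeWord (g m) (s m) σ = true := by
      intro m σ
      constructor
      · intro h
        by_cases hm : 0 < W m
        · simp only [o, dif_pos hm, Option.some.injEq] at h
          rw [← h]
          exact (hex m hm).choose_spec
        · simp [o, hm] at h
      · intro h
        have hm := ((hacc σ m).1 h).1
        simp only [o, dif_pos hm, Option.some.injEq]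
        exact hinj _ _ m (hex m hm).choose_spec h
    have hsumw := hasSum_weight C (s := o) (fun m m' σ h h' =>
        huniq σ σ m m' ((ho m σ).1 h) ((ho m' σ).1 h') List.prefix_rfl) (fun σ => by
      simp only [ho]; exact hdom σ)
    have hwo : ∀ m, weight (o m) = if 0 < W m then (2⁻¹ : ℝ) ^ codeLength (g m) else 0 := by
      intro m
      by_cases hm : 0 < W m
      · have h1 := (hacc _ m).1 (hex m hm).choose_spec
        simp only [o, dif_pos hm, if_pos hm, weight, Option.elim_some, h1.2.1]
      · simp [o, hm, weight]
    have hle : ∀ m, weight (o m) ≤ W m := by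
      intro m
      rw [hwo]
      split_ifs with hm
      · have h1 := (codeLength_spec hm (hW1 m) (hgW m)).1
        have h2 : (0 : ℝ) < (2⁻¹ : ℝ) ^ codeLength (g m) := by positivity
        linarith
      · exact h0 m
    refine isComputableReal_of_modulus ?_ (fun m => ?_) hsumw hN
      fun k => (tail_le_tail hle hsumw hsum (N k)).trans (hmod k)
    · refine ⟨fun m => bif leB 1 (g m).1.natAbs then (1, 0, 2 ^ codeLength (g m) - 1)
        else GRat.ofInt 0, by fun_prop, fun m => ?_⟩
      have hd : (0 : ℝ) < ((g m).2.2 : ℝ) + 1 := by positivity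
      have hiff : leB 1 (g m).1.natAbs = true ↔ 0 < W m := by
        rw [leB_eq_true, GRat.eq_natAbs_div (h0 m) (hgW m), div_pos_iff_of_pos_right hd,
          Nat.cast_pos]
        rfl
      simp only [hwo]
      by_cases hm : 0 < W m
      · rw [hiff.2 hm, cond_true, if_pos hm, GRat.val]
        have h1 : 1 ≤ 2 ^ codeLength (g m) := Nat.one_le_two_pow
        push_cast [Nat.cast_sub h1]
        simp
      · rw [Bool.eq_false_iff.2 fun h => hm (hiff.1 h), cond_false, if_neg hm]
        simp
    · simp only [hwo]
      split_ifs <;> positivity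
  · obtain ⟨σ, hσ⟩ := hex m hm
    refine ⟨σ, (hmem σ _).2 ⟨m, hσ, rfl⟩, ?_⟩
    rw [((hacc σ m).1 hσ).2.1]
    exact (codeLength_spec hm (hW1 m) (hgW m)).2

/-! ### Incompressible states are random -/

theorem isGRatSeq_nat_div_two_pow {a q : ℕ → ℕ} (ha : Computable a) (hq : Computable q) :
    IsGRatSeq fun m => (a m : ℝ) / 2 ^ q m := by
  refine ⟨fun m => ((a m : ℤ), 0, 2 ^ q m - 1), by fun_prop, fun m => ?_⟩
  have h1 : 1 ≤ 2 ^ q m := Nat.one_le_two_pow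
  rw [GRat.val]
  push_cast [Nat.cast_sub h1]
  simp

/-- The measure of the projection onto a frame is a sum over the members of the frame. -/
theorem sum_frameSet {N : ℕ} {w : List (List GRat)} (hw : IsFrame N w)
    (A : Matrix (Fin N) (Fin N) ℂ) :
    ∑ v ∈ frameSet N w, (star v.ofLp ⬝ᵥ A.mulVec v.ofLp).re =
      (A * projMat N w).trace.re := by
  classical
  rw [trace_mul_projMat, Complex.re_sum, frameSet, Finset.sum_image]
  intro a _ b _ hab
  exact hw.orthonormal.linearIndependent.injective hab

/-- An index of a frame bounds the complexity of every matrix to which the projection onto the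
frame gives a large value. -/
theorem QK_le_of_frame {C : PrefixFreeMachine} {n : ℕ} {w : List (List GRat)}
    (hw : IsFrame (2 ^ n) w) {σ : List Bool}
    (hσ : Encodable.encode (frameCode (2 ^ n) w) ∈ C.run σ) {ε : ℝ}
    {A : Matrix (Fin (2 ^ n)) (Fin (2 ^ n)) ℂ} (hA : ε < (A * projMat (2 ^ n) w).trace.re) :
    C.QK ε A ≤ (((σ.length : ℝ) + Real.logb 2 w.length : ℝ) : EReal) := by
  refine sInf_le ⟨σ, _, frameSet (2 ^ n) w, hσ, ⟨_, Encodable.encodek _, setDenotes_frameCode ..⟩,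
    hw.orthonormal_frameSet, ?_, ?_⟩
  · rw [sum_frameSet hw]
    exact hA
  · rw [hw.card_frameSet]

/-- A state whose initial segments are incompressible for all computable measure machines is random:
a failed test, with its terms weighted, would give a machine that compresses. -/
theorem isQuantumSchnorrRandom_of_forall_QK {ρ : QState}
    (h : ∀ C : PrefixFreeMachine, C.IsComputableMeasure → ∀ ε : ℝ, 0 < ε →
      ∃ d : ℝ, 0 < d ∧ ∀ n : ℕ, C.QK ε (ρ.mat n) > (((n : ℝ) - d : ℝ) : EReal)) :
    ρ.IsQuantumSchnorrRandom := by
  rintro S ⟨⟨hS, hsum⟩, hcomp⟩ δ hδ hfail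
  obtain ⟨w, hw, hq, hwS⟩ := exists_computable_frames hS
  have hb : ∀ m, tracialState.measure (S m) = ((w m).length : ℝ) / 2 ^ (S m).qubits := by
    intro m
    rw [tracialState_measure, (hwS m).2.1, Complex.natCast_re]
  simp only [hb] at hsum hcomp
  obtain ⟨g, hg, hgtop, A, hA, hgsum, N, hN, hmod⟩ :=
    exists_slow_weights (isGRatSeq_nat_div_two_pow (by fun_prop) hq) (fun m => by positivity)
      hsum.hasSum hcomp
  have hW : IsGRatSeq fun m => (g m : ℝ) * (((w m).length : ℝ) / 2 ^ (S m).qubits) := by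
    have h1 := isGRatSeq_nat_div_two_pow (a := fun m => g m * (w m).length)
      (q := fun m => (S m).qubits) (by fun_prop) hq
    simpa [mul_div_assoc] using h1
  obtain ⟨C, hC, hCout⟩ := exists_machine hW (fun m => by positivity) hA hgsum hN hmod
    (out := fun m => Encodable.encode (frameCode (2 ^ (S m).qubits) (w m))) (by fun_prop)
  obtain ⟨d, hd, hdn⟩ := h C hC (δ / 2) (by positivity)
  have hev : ∀ᶠ m in atTop, ⌈(2 : ℝ) ^ (d + 2)⌉₊ + 1 ≤ g m ∧ ⌈1 / δ⌉₊ ≤ m :=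
    (hgtop.eventually_ge_atTop _).and (eventually_ge_atTop _)
  obtain ⟨m, hm, hgm, hmδ⟩ := (hfail.and_eventually hev).exists
  obtain ⟨hfr, -, hclose⟩ := hwS m
  set n := (S m).qubits with hn
  -- the frame inherits most of the measure of the projection
  have hmeas : δ / 2 < (ρ.mat n * projMat (2 ^ n) (w m)).trace.re := by
    have h1 := abs_re_trace_sub_le (ρ.posSemidef n) (ρ.trace_eq_one n) hclose
    have h2 : ((2 ^ n : ℕ) : ℝ) * (2 ^ n : ℕ) * (2 / testPrecision (2 ^ n) m) ≤ δ / 2 := by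
      rw [testPrecision]
      have h3 : (1 : ℝ) / δ ≤ m := (Nat.le_ceil _).trans (by exact_mod_cast hmδ)
      have h4 : (1 : ℝ) ≤ δ * (m + 1) := by
        rw [div_le_iff₀ hδ] at h3
        nlinarith
      push_cast
      have h5 : (2 : ℝ) ^ n * 2 ^ n * (2 / (4 * (2 ^ n * 2 ^ n) * (m + 1))) =
        (1 / 2) * (1 / (m + 1)) := by field_simp; norm_num
      rw [h5]
      have h6 : (1 : ℝ) / (m + 1) ≤ δ := by
        rw [div_le_iff₀ (by positivity)]; exact h4
      linarith
    have h3 : δ < (ρ.mat n * (S m).mat).trace.re := hm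
    linarith [(abs_le.1 h1).1]
  have hlen : 0 < (w m).length := by
    by_contra hc
    have h0 : w m = [] := List.length_eq_zero_iff.1 (by omega)
    rw [trace_mul_projMat, h0] at hmeas
    simp at hmeas
    linarith
  have hgpos : 0 < g m := by omega
  obtain ⟨σ, hσ, hlt⟩ := hCout m (by positivity)
  have hQK := (hdn n).trans_le (QK_le_of_frame hfr hσ hmeas)
  rw [EReal.coe_lt_coe_iff] at hQK
  -- take logarithms in `g * |w| * 2 ^ |σ| < 4 * 2 ^ n`
  have h1 : (2 : ℝ) ^ (d + 2) < g m := by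
    have h2 := Nat.le_ceil ((2 : ℝ) ^ (d + 2))
    have h3 : ((⌈(2 : ℝ) ^ (d + 2)⌉₊ : ℕ) : ℝ) + 1 ≤ g m := by exact_mod_cast hgm
    linarith
  have h2 : (2 : ℝ) ^ (d + 2) * ((w m).length * 2 ^ σ.length) ≤ 4 * 2 ^ n := by
    have h3 : (g m : ℝ) * ((w m).length * 2 ^ σ.length) < 4 * 2 ^ n := by
      rw [inv_pow, ← div_eq_mul_inv, lt_div_iff₀ (by positivity), mul_div_assoc',
        div_mul_eq_mul_div, div_lt_iff₀ (by positivity)] at hlt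
      linarith
    refine le_trans ?_ h3.le
    gcongr
  have hlen' : (0 : ℝ) < (w m).length := by exact_mod_cast hlen
  have h3 := Real.logb_le_logb_of_le (b := 2) one_lt_two (by positivity) h2
  rw [Real.logb_mul (by positivity) (by positivity), Real.logb_mul (by positivity) (by positivity),
    Real.logb_mul (by positivity) (by positivity), Real.logb_rpow two_pos (by norm_num),
    ← Real.rpow_natCast, Real.logb_rpow two_pos (by norm_num), ← Real.rpow_natCast,
    Real.logb_rpow two_pos (by norm_num)] at h3
  have h4 : Real.logb 2 4 = 2 := by
    have : (4 : ℝ) = 2 ^ (2 : ℝ) := by norm_num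
    rw [this, Real.logb_rpow two_pos (by norm_num)]
  linarith

/-! ### Projections onto spans of Gaussian rational vectors -/

/-- The projection onto the span of finitely many Gaussian rational vectors has Gaussian rational
entries. This is the Gram–Schmidt process without normalization. -/
theorem exists_gaussianRational_projection {N : ℕ} {ι : Type*} [DecidableEq ι]
    (q : ι → Fin N → ℂ) (hq : ∀ a i, q a i ∈ gaussianRationals) (s : Finset ι) :
    ∃ P : Matrix (Fin N) (Fin N) ℂ, P.IsHermitian ∧ IsIdempotentElem P ∧
      (∀ i j, P i j ∈ gaussianRationals) ∧ (∀ a ∈ s, P.mulVec (q a) = q a) ∧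
      ∃ t : ℕ, t ≤ s.card ∧ P.trace = t := by
  induction s using Finset.induction_on with
  | empty =>
    exact ⟨0, Matrix.isHermitian_zero, IsIdempotentElem.zero, fun _ _ => zero_mem _, by simp,
      0, le_rfl, by simp⟩
  | insert a s has ih =>
    obtain ⟨P, hP, hP2, hPq, hPs, t, ht, htr⟩ := ih
    by_cases hu : P.mulVec (q a) = q a
    · refine ⟨P, hP, hP2, hPq, fun b hb => ?_, t, ht.trans (Finset.card_le_card
        (Finset.subset_insert _ _)), htr⟩
      rcases Finset.mem_insert.1 hb with rfl | hb
      · exact hu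
      · exact hPs b hb
    set u : Fin N → ℂ := q a - P.mulVec (q a) with hudef
    have hu0 : u ≠ 0 := fun h => hu (sub_eq_zero.1 h).symm
    set c : ℂ := u ⬝ᵥ star u with hc
    have hc0 : c ≠ 0 := fun h => hu0 (dotProduct_self_star_eq_zero.1 h)
    have hcs : star c = c := by
      simp [hc, dotProduct, mul_comm]
    have hPu : P.mulVec u = 0 := by
      rw [hudef, Matrix.mulVec_sub, Matrix.mulVec_mulVec, hP2.eq, sub_self]
    set R : Matrix (Fin N) (Fin N) ℂ := c⁻¹ • Matrix.vecMulVec u (star u) with hR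
    have hRH : R.IsHermitian := by
      rw [Matrix.IsHermitian, hR, Matrix.conjTranspose_smul, Matrix.conjTranspose_vecMulVec,
        star_star, star_inv₀, hcs]
    have hPR : P * R = 0 := by
      rw [hR, Matrix.mul_smul, Matrix.mul_vecMulVec, hPu, Matrix.zero_vecMulVec, smul_zero]
    have hRP : R * P = 0 := by
      have := congrArg Matrix.conjTranspose hPR
      rwa [Matrix.conjTranspose_mul, hP.eq, hRH.eq, Matrix.conjTranspose_zero] at this
    have hRu : R.mulVec u = u := by
      rw [hR, Matrix.smul_mulVec, Matrix.vecMulVec_mulVec, dotProduct_comm, ← hc]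
      ext i
      simp [hc0]
    have hRR : R * R = R := by
      conv_lhs => rw [hR, Matrix.mul_smul]
      rw [Matrix.mul_vecMulVec, ← hR, hRu]
    refine ⟨P + R, hP.add hRH, ?_, fun i j => ?_, fun b hb => ?_, t + 1, ?_, ?_⟩
    · rw [IsIdempotentElem, add_mul, mul_add, mul_add, hP2.eq, hPR, hRP, hRR]
      simp
    · have hum : ∀ i, u i ∈ gaussianRationals := fun i => by
        rw [hudef, Pi.sub_apply, Matrix.mulVec, dotProduct]
        exact sub_mem (hq a i) (sum_mem fun j _ => mul_mem (hPq i j) (hq a j))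
      exact add_mem (hPq i j) (mul_mem (inv_mem (sum_mem fun k _ =>
        mul_mem (hum k) (star_mem_gaussianRationals (hum k))))
        (mul_mem (hum i) (star_mem_gaussianRationals (hum j))))
    · rcases Finset.mem_insert.1 hb with rfl | hb
      · have e : q b = u + P.mulVec (q b) := by simp [hudef]
        have h1 : R.mulVec (q b) = u := by
          conv_lhs => rw [e]
          rw [Matrix.mulVec_add, hRu, Matrix.mulVec_mulVec, hRP, Matrix.zero_mulVec, add_zero]
        rw [Matrix.add_mulVec, h1, hudef]
        simp
      · have h1 : R.mulVec (q b) = 0 := by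
          rw [← hPs b hb, Matrix.mulVec_mulVec, hRP, Matrix.zero_mulVec]
        rw [Matrix.add_mulVec, hPs b hb, h1, add_zero]
    · rw [Finset.card_insert_of_notMem has]
      omega
    · rw [Matrix.trace_add, htr, hR, Matrix.trace_smul, Matrix.trace_vecMulVec, ← hc, smul_eq_mul,
        inv_mul_cancel₀ hc0]
      push_cast
      ring

/-- The approximation to precision `1 / (T + 1)` of the coordinate `i` of the vector number `a` in
a list of codes. -/
def approxEntry (c : List (List AlgCode)) (T a i : ℕ) : GRat :=
  AlgCode.approx ((c.getD a []).getD i ([], 0, 0, 0)) T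

/-- The approximate vector number `a` is nearly orthogonal to all the preceding ones. When the
members of `c` denote members of an orthonormal set, this discards exactly the repetitions. -/
def isFirstB (c : List (List AlgCode)) (N T a : ℕ) : Bool :=
  ball a fun b => (GRat.sum N fun i => (approxEntry c T b i).conj.mul (approxEntry c T a i)).small 2

/-- The `N × N` matrix whose entries are listed in `P`. -/
noncomputable def listMat (N : ℕ) (P : List (List GRat)) : Matrix (Fin N) (Fin N) ℂ :=
  fun i j => (entry P i j).val

/-- A code of the matrix `listMat N P`. -/
def listMatCode (N : ℕ) (P : List (List GRat)) : List (List AlgCode) :=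
  tabulate N fun i => tabulate N fun j => (entry P i j).toCode

/-- The number of approximate vectors that remain after repetitions are discarded. -/
def firstCount (c : List (List AlgCode)) (N T : ℕ) : ℕ :=
  natSum c.length fun a => bif isFirstB c N T a then 1 else 0

/-- The Boolean test that `P` lists the entries of a Hermitian projection. -/
def isProjB (N : ℕ) (P : List (List GRat)) : Bool :=
  ball N fun i => ball N fun j => ((entry P j i).conj.sub (entry P i j)).isZero &&
    ((GRat.sum N fun k => (entry P i k).mul (entry P k j)).sub (entry P i j)).isZero

/-- The Boolean test that `P` fixes the approximate vectors, except for the repetitions. -/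
def isFixingB (c : List (List AlgCode)) (N T : ℕ) (P : List (List GRat)) : Bool :=
  ball c.length fun a => !isFirstB c N T a || ball N fun i =>
    ((GRat.sum N fun j => (entry P i j).mul (approxEntry c T a j)).sub
      (approxEntry c T a i)).isZero

/-- The Boolean test that `t` is the trace of `P`. -/
def isTraceB (N : ℕ) (P : List (List GRat)) (t : ℕ) : Bool :=
  ((GRat.sum N fun i => entry P i i).sub (GRat.ofInt t)).isZero

section Computability
variable {β : Type*} [Primcodable β]

@[fun_prop]
theorem computable_approxEntry {c : β → List (List AlgCode)} {T a i : β → ℕ} (hc : Computable c)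
    (hT : Computable T) (ha : Computable a) (hi : Computable i) :
    Computable fun x => approxEntry (c x) (T x) (a x) (i x) := by
  unfold approxEntry; fun_prop

@[fun_prop]
theorem computable_isFirstB {c : β → List (List AlgCode)} {N T a : β → ℕ} (hc : Computable c)
    (hN : Computable N) (hT : Computable T) (ha : Computable a) :
    Computable fun x => isFirstB (c x) (N x) (T x) (a x) := by
  unfold isFirstB; fun_prop

@[fun_prop]
theorem computable_listMatCode {N : β → ℕ} {P : β → List (List GRat)} (hN : Computable N)
    (hP : Computable P) : Computable fun x => listMatCode (N x) (P x) := by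
  unfold listMatCode; fun_prop

@[fun_prop]
theorem computable_firstCount {c : β → List (List AlgCode)} {N T : β → ℕ} (hc : Computable c)
    (hN : Computable N) (hT : Computable T) : Computable fun x => firstCount (c x) (N x) (T x) := by
  unfold firstCount; fun_prop

@[fun_prop]
theorem computable_isProjB {N : β → ℕ} {P : β → List (List GRat)} (hN : Computable N)
    (hP : Computable P) : Computable fun x => isProjB (N x) (P x) := by
  unfold isProjB; fun_prop

@[fun_prop]
theorem computable_isFixingB {c : β → List (List AlgCode)} {N T : β → ℕ}
    {P : β → List (List GRat)} (hc : Computable c) (hN : Computable N) (hT : Computable T)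
    (hP : Computable P) : Computable fun x => isFixingB (c x) (N x) (T x) (P x) := by
  unfold isFixingB; fun_prop

@[fun_prop]
theorem computable_isTraceB {N t : β → ℕ} {P : β → List (List GRat)} (hN : Computable N)
    (hP : Computable P) (ht : Computable t) : Computable fun x => isTraceB (N x) (P x) (t x) := by
  unfold isTraceB; fun_prop

end Computability

theorem isProjB_eq_true {N : ℕ} {P : List (List GRat)} :
    isProjB N P = true ↔ (listMat N P).IsHermitian ∧ IsIdempotentElem (listMat N P) := by
  simp only [isProjB, ball_eq_true, Bool.and_eq_true, GRat.isZero_eq_true, GRat.val_sub,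
    GRat.val_conj, GRat.val_sum, GRat.val_mul, sub_eq_zero]
  constructor
  · intro h
    refine ⟨?_, ?_⟩
    · ext i j
      exact (h i i.2 j j.2).1
    · ext i j
      rw [Matrix.mul_apply]
      have := (h i i.2 j j.2).2
      rw [Finset.sum_range] at this
      exact this
  · rintro ⟨h1, h2⟩ i hi j hj
    refine ⟨congrFun (congrFun h1 ⟨i, hi⟩) ⟨j, hj⟩, ?_⟩
    have := congrFun (congrFun h2 ⟨i, hi⟩) ⟨j, hj⟩
    rw [Matrix.mul_apply] at this
    rw [Finset.sum_range]
    exact this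

theorem isFixingB_eq_true {c : List (List AlgCode)} {N T : ℕ} {P : List (List GRat)} :
    isFixingB c N T P = true ↔ ∀ a < c.length, isFirstB c N T a = true →
      (listMat N P).mulVec (fun i : Fin N => (approxEntry c T a i).val) =
        fun i : Fin N => (approxEntry c T a i).val := by
  simp only [isFixingB, ball_eq_true, Bool.or_eq_true, GRat.isZero_eq_true, GRat.val_sub,
    GRat.val_sum, GRat.val_mul, sub_eq_zero, Bool.not_eq_true', ← Bool.not_eq_true,
    ← imp_iff_not_or]
  refine forall₃_congr fun a _ _ => ?_
  constructor
  · intro h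
    ext i
    have := h i i.2
    rw [Finset.sum_range] at this
    exact this
  · intro h i hi
    rw [Finset.sum_range]
    exact congrFun h ⟨i, hi⟩

theorem isTraceB_eq_true {N t : ℕ} {P : List (List GRat)} :
    isTraceB N P t = true ↔ (listMat N P).trace = t := by
  simp [isTraceB, GRat.isZero_eq_true, sub_eq_zero, Finset.sum_range, Matrix.trace, listMat]

theorem firstCount_eq (c : List (List AlgCode)) (N T : ℕ) :
    firstCount c N T = ((Finset.range c.length).filter fun a => isFirstB c N T a = true).card := by
  rw [firstCount, natSum_eq, Finset.card_filter]
  refine Finset.sum_congr rfl fun a _ => ?_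
  cases isFirstB c N T a <;> simp

/-- A projection onto the span of the approximate vectors, and its trace, can be computed. This
makes sense for every list of codes, whatever it denotes. -/
theorem exists_computable_span :
    ∃ f : List (List AlgCode) × ℕ × ℕ → List (List GRat) × ℕ, Computable f ∧
      ∀ c N T, isProjB N (f (c, N, T)).1 = true ∧ isFixingB c N T (f (c, N, T)).1 = true ∧
        isTraceB N (f (c, N, T)).1 (f (c, N, T)).2 = true ∧
        (f (c, N, T)).2 ≤ firstCount c N T := by
  classical
  obtain ⟨s, hs, hsp⟩ := Computable.exists_search (α := List (List AlgCode) × ℕ × ℕ)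
    (p := fun x q =>
      isProjB x.2.1 ((Encodable.decode q : Option (List (List GRat) × ℕ)).getD ([], 0)).1 &&
      (isFixingB x.1 x.2.1 x.2.2
        ((Encodable.decode q : Option (List (List GRat) × ℕ)).getD ([], 0)).1 &&
      (isTraceB x.2.1 ((Encodable.decode q : Option (List (List GRat) × ℕ)).getD ([], 0)).1
        ((Encodable.decode q : Option (List (List GRat) × ℕ)).getD ([], 0)).2 &&
      leB ((Encodable.decode q : Option (List (List GRat) × ℕ)).getD ([], 0)).2
        (firstCount x.1 x.2.1 x.2.2)))) (by fun_prop) (by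
    rintro ⟨c, N, T⟩
    have hmem : ∀ g : GRat, g.val ∈ gaussianRationals := fun g =>
      div_mem (add_mem (intCast_mem _ _) (mul_mem (intCast_mem _ _)
        (show Complex.I ∈ gaussianRationals from ⟨0, 1, by simp⟩)))
        (add_mem (natCast_mem _ _) (one_mem _))
    obtain ⟨P, h1, h2, h3, h4, t, h5, h6⟩ := exists_gaussianRational_projection (N := N)
      (fun (a : ℕ) i => (approxEntry c T a i).val) (fun _ _ => hmem _)
      ((Finset.range c.length).filter fun a => isFirstB c N T a = true)
    choose G hG using fun i j => exists_val_of_mem (h3 i j)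
    let w : List (List GRat) := List.ofFn fun i => List.ofFn fun j => G i j
    have hw : listMat N w = P := by
      ext i j
      have h7 : w.getD i [] = List.ofFn fun j => G i j := by
        rw [List.getD_eq_getElem _ _ (by simp [w])]
        simp [w]
      rw [listMat, entry, h7, List.getD_eq_getElem _ _ (by simp)]
      simp [hG]
    refine ⟨Encodable.encode (w, t), ?_⟩
    simp only [Encodable.encodek, Option.getD_some, Bool.and_eq_true, isProjB_eq_true,
      isFixingB_eq_true, isTraceB_eq_true, leB_eq_true, hw, firstCount_eq]
    exact ⟨⟨h1, h2⟩, fun a ha hf => h4 a (Finset.mem_filter.2 ⟨Finset.mem_range.2 ha, hf⟩),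
      h6, h5⟩)
  refine ⟨fun x => (Encodable.decode (s x) : Option (List (List GRat) × ℕ)).getD ([], 0),
    by fun_prop, fun c N T => ?_⟩
  have := hsp (c, N, T)
  simpa only [Bool.and_eq_true, leB_eq_true] using this

theorem matDenotes_listMatCode (N : ℕ) (P : List (List GRat)) :
    MatDenotes (listMatCode N P) (listMat N P) := by
  refine matDenotes_iff.2 ⟨length_tabulate _ _, fun i => ?_⟩
  rw [listMatCode, getD_tabulate _ _ i.2]
  refine vecDenotes_iff.2 ⟨length_tabulate _ _, fun j => ?_⟩
  rw [getD_tabulate _ _ j.2]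
  exact GRat.toCode_denotes _

/-- The special projection with the entries listed in `P`. -/
noncomputable def listProjection (n : ℕ) (P : List (List GRat)) (hP : isProjB (2 ^ n) P = true) :
    SpecialProjection where
  qubits := n
  mat := listMat (2 ^ n) P
  isHermitian := (isProjB_eq_true.1 hP).1
  isIdempotentElem := (isProjB_eq_true.1 hP).2
  isAlgebraic _ _ := GRat.isAlgebraic_val _

/-! ### The span of approximations to an orthonormal set -/

/-- Bessel's inequality for a positive semidefinite observable. -/
theorem sum_re_dotProduct_mulVec_le_trace {N : ℕ} {B : Matrix (Fin N) (Fin N) ℂ}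
    (hB : B.PosSemidef) {F : Finset (EuclideanSpace ℂ (Fin N))}
    (hF : Orthonormal ℂ fun v : F => (v : EuclideanSpace ℂ (Fin N))) :
    ∑ v ∈ F, (star v.ofLp ⬝ᵥ B.mulVec v.ofLp).re ≤ B.trace.re := by
  obtain ⟨M, rfl⟩ : ∃ M : Matrix (Fin N) (Fin N) ℂ, B = M.conjTranspose * M := by
    open scoped MatrixOrder in
    exact CStarAlgebra.nonneg_iff_eq_star_mul_self.1 hB.nonneg
  let m : Fin N → EuclideanSpace ℂ (Fin N) := fun i => WithLp.toLp 2 (star (M i))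
  have h1 : ∀ v : EuclideanSpace ℂ (Fin N),
      (star v.ofLp ⬝ᵥ (M.conjTranspose * M).mulVec v.ofLp).re = ∑ i, ‖inner ℂ v (m i)‖ ^ 2 := by
    intro v
    rw [← Matrix.mulVec_mulVec, Matrix.dotProduct_mulVec, ← Matrix.star_mulVec, dotProduct,
      Complex.re_sum]
    refine Finset.sum_congr rfl fun i _ => ?_
    have e : inner ℂ v (m i) = star ((M.mulVec v.ofLp) i) := by
      rw [PiLp.inner_apply, Matrix.mulVec, dotProduct, star_sum]
      refine Finset.sum_congr rfl fun j _ => ?_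
      simp [m]
    rw [e, norm_star, Pi.star_apply, Complex.star_def, ← Complex.normSq_eq_conj_mul_self,
      Complex.ofReal_re, Complex.normSq_eq_norm_sq]
  have h2 : (M.conjTranspose * M).trace.re = ∑ i, ‖m i‖ ^ 2 := by
    rw [Matrix.trace_mul_comm, Matrix.trace, Complex.re_sum]
    refine Finset.sum_congr rfl fun i _ => ?_
    rw [Matrix.diag_apply, Matrix.mul_apply, Complex.re_sum, EuclideanSpace.norm_sq_eq]
    refine Finset.sum_congr rfl fun j _ => ?_
    simp [m, Complex.mul_conj, Complex.normSq_eq_norm_sq, -Complex.ofReal_pow]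
  rw [h2, Finset.sum_congr rfl fun v _ => h1 v, Finset.sum_comm]
  refine Finset.sum_le_sum fun i _ => ?_
  have h3 := hF.sum_inner_products_le (m i) (s := Finset.univ)
  rwa [Finset.sum_coe_sort F fun v => ‖inner ℂ v (m i)‖ ^ 2] at h3

theorem norm_entry_le_one_of_projection {N : ℕ} {Q : Matrix (Fin N) (Fin N) ℂ}
    (hQ : Q.IsHermitian) (hQ2 : IsIdempotentElem Q) (i j : Fin N) : ‖Q i j‖ ≤ 1 := by
  have h1 : ∀ i, ∑ j, ‖Q i j‖ ^ 2 = (Q i i).re := by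
    intro i
    conv_rhs => rw [← hQ2.eq, Matrix.mul_apply, Complex.re_sum]
    refine Finset.sum_congr rfl fun j _ => ?_
    rw [← hQ.apply i j, Complex.star_def, ← Complex.normSq_eq_conj_mul_self, Complex.ofReal_re,
      ← Complex.normSq_eq_norm_sq, Complex.normSq_conj]
  have h2 : ∀ j, ‖Q i j‖ ^ 2 ≤ (Q i i).re := fun j =>
    (Finset.single_le_sum (f := fun j => ‖Q i j‖ ^ 2) (fun _ _ => by positivity)
      (Finset.mem_univ j)).trans (h1 i).le
  have h3 : (Q i i).re ≤ ‖Q i i‖ := Complex.re_le_norm _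
  have h4 : ‖Q i i‖ ≤ 1 := by
    by_contra hc
    nlinarith [h2 i]
  have := h2 j
  by_contra hc
  nlinarith

theorem norm_mul_star_sub_le_three {x y x' y' : ℂ} {ε : ℝ} (hx1 : ‖x‖ ≤ 1) (hy1 : ‖y‖ ≤ 1)
    (hε : ε ≤ 1) (hx : ‖x - x'‖ ≤ ε) (hy : ‖y - y'‖ ≤ ε) :
    ‖x * star y - x' * star y'‖ ≤ 3 * ε := by
  have e : x * star y - x' * star y' = (x - x') * star y + x * star (y - y') -
      (x - x') * star (y - y') := by
    rw [star_sub]; ring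
  have h0 : 0 ≤ ε := (norm_nonneg _).trans hx
  rw [e]
  refine (norm_sub_le _ _).trans ((add_le_add_left (norm_add_le _ _) _).trans ?_)
  rw [norm_mul, norm_mul, norm_mul, norm_star, norm_star]
  have h1 : ‖x - x'‖ * ‖y‖ ≤ ε * 1 := by gcongr
  have h2 : ‖x‖ * ‖y - y'‖ ≤ 1 * ε := by gcongr
  have h3 : ‖x - x'‖ * ‖y - y'‖ ≤ ε * 1 := by gcongr; exact hy.trans hε
  linarith

theorem norm_approxEntry_sub_le {c : List (List AlgCode)} {N T a : ℕ}
    {v : EuclideanSpace ℂ (Fin N)} (h : VecDenotes (c.getD a []) fun i => v i) (i : Fin N) :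
    ‖v i - (approxEntry c T a i).val‖ ≤ 1 / (T + 1) := by
  have h1 := AlgCode.norm_approx_sub_lt ((vecDenotes_iff.1 h).2 i) T
  rw [le_div_iff₀ (by positivity), norm_sub_rev]
  exact h1.le

/-- Approximate orthogonality distinguishes equal and distinct members of an orthonormal set. -/
theorem small_gram_iff {c : List (List AlgCode)} {N T a b : ℕ} (hT : 6 * N ≤ T)
    {F : Finset (EuclideanSpace ℂ (Fin N))}
    (hF : Orthonormal ℂ fun v : F => (v : EuclideanSpace ℂ (Fin N)))
    {v u : EuclideanSpace ℂ (Fin N)} (hv : v ∈ F) (hu : u ∈ F)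
    (hva : VecDenotes (c.getD a []) fun i => v i) (hub : VecDenotes (c.getD b []) fun i => u i) :
    (GRat.sum N fun i => (approxEntry c T b i).conj.mul (approxEntry c T a i)).small 2 = true ↔
      u ≠ v := by
  classical
  have hε : (1 : ℝ) / (T + 1) ≤ 1 := by
    rw [div_le_one (by positivity)]; linarith [(Nat.cast_nonneg T : (0 : ℝ) ≤ T)]
  have hn : ∀ x ∈ F, ‖x‖ = 1 := fun x hx => hF.norm_eq_one ⟨x, hx⟩
  have hdist : ‖inner ℂ u v -
      (GRat.sum N fun i => (approxEntry c T b i).conj.mul (approxEntry c T a i)).val‖ < 1 / 2 := by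
    rw [GRat.val_sum, Finset.sum_range, PiLp.inner_apply, ← Finset.sum_sub_distrib]
    refine lt_of_le_of_lt ((norm_sum_le _ _).trans (Finset.sum_le_sum
      (g := fun _ => 3 * (1 / ((T : ℝ) + 1))) fun i _ => ?_)) ?_
    · have h1 := norm_mul_star_sub_le_three (norm_coord_le_one (hn v hv) i)
        (norm_coord_le_one (hn u hu) i) hε (norm_approxEntry_sub_le (T := T) hva i)
        (norm_approxEntry_sub_le (T := T) hub i)
      rw [GRat.val_mul, GRat.val_conj, mul_comm (star _)]
      exact h1
    · have h2 : (6 : ℝ) * N ≤ T := by exact_mod_cast hT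
      simp only [Finset.sum_const, Finset.card_univ, Fintype.card_fin, nsmul_eq_mul]
      rw [← mul_assoc, mul_one_div, div_lt_div_iff₀ (by positivity) two_pos]
      linarith
  have hin : inner ℂ u v = if u = v then (1 : ℂ) else 0 := by
    have := (orthonormal_iff_ite.1 hF) ⟨u, hu⟩ ⟨v, hv⟩
    simpa only [Subtype.mk.injEq] using this
  rw [GRat.small_eq_true]
  rw [hin] at hdist
  set z := (GRat.sum N fun i => (approxEntry c T b i).conj.mul (approxEntry c T a i)).val
  push_cast
  by_cases huv : u = v
  · rw [if_pos huv] at hdist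
    simp only [huv, ne_eq, not_true_eq_false, iff_false, not_lt]
    have := norm_sub_norm_le (1 : ℂ) z
    rw [norm_one] at this
    linarith
  · rw [if_neg huv, zero_sub, norm_neg] at hdist
    simp only [ne_eq, huv, not_false_eq_true, iff_true]
    linarith

theorem SetDenotes.exists_of_lt {N : ℕ} {c : List (List AlgCode)}
    {F : Finset (EuclideanSpace ℂ (Fin N))} (h : SetDenotes c F) {a : ℕ} (ha : a < c.length) :
    ∃ v ∈ F, VecDenotes (c.getD a []) fun i => v i := by
  rw [List.getD_eq_getElem _ _ ha]
  exact h.1 _ (List.getElem_mem ha)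

theorem SetDenotes.exists_lt {N : ℕ} {c : List (List AlgCode)}
    {F : Finset (EuclideanSpace ℂ (Fin N))} (h : SetDenotes c F) {v : EuclideanSpace ℂ (Fin N)}
    (hv : v ∈ F) : ∃ a < c.length, VecDenotes (c.getD a []) fun i => v i := by
  obtain ⟨l, hl, hlv⟩ := h.2 v hv
  obtain ⟨a, ha, rfl⟩ := List.getElem_of_mem hl
  refine ⟨a, ha, ?_⟩
  rwa [List.getD_eq_getElem _ _ ha]

theorem firstCount_le_card {c : List (List AlgCode)} {N T : ℕ} (hT : 6 * N ≤ T)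
    {F : Finset (EuclideanSpace ℂ (Fin N))} (hc : SetDenotes c F)
    (hF : Orthonormal ℂ fun v : F => (v : EuclideanSpace ℂ (Fin N))) :
    firstCount c N T ≤ F.card := by
  rw [firstCount_eq]
  have h1 : ∀ a : ℕ, ∃ v : EuclideanSpace ℂ (Fin N), a < c.length →
      v ∈ F ∧ VecDenotes (c.getD a []) fun i => v i := by
    intro a
    by_cases ha : a < c.length
    · obtain ⟨v, hv⟩ := hc.exists_of_lt ha
      exact ⟨v, fun _ => hv⟩
    · exact ⟨0, fun h => absurd h ha⟩
  choose V hV using h1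
  have key : ∀ a b, a < c.length → isFirstB c N T a = true → b < a → V b ≠ V a := by
    intro a b ha h hba
    rw [isFirstB, ball_eq_true] at h
    have hb := hba.trans ha
    exact (small_gram_iff hT hF (hV a ha).1 (hV b hb).1 (hV a ha).2 (hV b hb).2).1 (h b hba)
  refine Finset.card_le_card_of_injOn V (fun a ha => (hV a ?_).1) fun a ha b hb hab => ?_
  · exact Finset.mem_range.1 (Finset.mem_filter.1 (Finset.mem_coe.1 ha)).1
  · obtain ⟨ha1, ha2⟩ := Finset.mem_filter.1 (Finset.mem_coe.1 ha)
    obtain ⟨hb1, hb2⟩ := Finset.mem_filter.1 (Finset.mem_coe.1 hb)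
    by_contra hne
    rcases lt_or_gt_of_ne hne with h | h
    · exact key b a (Finset.mem_range.1 hb1) hb2 h hab
    · exact key a b (Finset.mem_range.1 ha1) ha2 h hab.symm

theorem SetDenotes.exists_isFirst {c : List (List AlgCode)} {N T : ℕ} (hT : 6 * N ≤ T)
    {F : Finset (EuclideanSpace ℂ (Fin N))} (hc : SetDenotes c F)
    (hF : Orthonormal ℂ fun v : F => (v : EuclideanSpace ℂ (Fin N)))
    {v : EuclideanSpace ℂ (Fin N)} (hv : v ∈ F) :
    ∃ a < c.length, isFirstB c N T a = true ∧ VecDenotes (c.getD a []) fun i => v i := by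
  classical
  have hex := hc.exists_lt hv
  obtain ⟨h1, h2⟩ := Nat.find_spec hex
  refine ⟨Nat.find hex, h1, ?_, h2⟩
  rw [isFirstB, ball_eq_true]
  intro b hb
  have hb1 := hb.trans h1
  obtain ⟨u, hu, hub⟩ := hc.exists_of_lt hb1
  refine (small_gram_iff hT hF hv hu h2 hub).2 ?_
  rintro rfl
  exact Nat.find_min hex hb ⟨hb1, hub⟩

/-- A projection that fixes good approximations of the members of an orthonormal set has, in every
density matrix, an expectation not much less than that of the set. -/
theorem sum_le_trace_mul_listMat {c : List (List AlgCode)} {N T K : ℕ} (hN : 0 < N) (hK : 0 < K)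
    (hT : 12 * N ^ 4 * K ≤ T) {F : Finset (EuclideanSpace ℂ (Fin N))} (hc : SetDenotes c F)
    (hF : Orthonormal ℂ fun v : F => (v : EuclideanSpace ℂ (Fin N))) {P : List (List GRat)}
    (hP : isProjB N P = true) (hfix : isFixingB c N T P = true) {A : Matrix (Fin N) (Fin N) ℂ}
    (hA : A.PosSemidef) (htr : A.trace = 1) :
    ∑ v ∈ F, (star v.ofLp ⬝ᵥ A.mulVec v.ofLp).re ≤
      (A * listMat N P).trace.re + 1 / (2 * K) := by
  obtain ⟨hQ, hQ2⟩ := isProjB_eq_true.1 hP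
  have hfix := isFixingB_eq_true.1 hfix
  set Q := listMat N P
  have hN1 : (1 : ℝ) ≤ N := by exact_mod_cast hN
  have hK1 : (1 : ℝ) ≤ K := by exact_mod_cast hK
  have hTR : (12 : ℝ) * N ^ 4 * K ≤ T := by exact_mod_cast hT
  have hN4 : (N : ℝ) ≤ N ^ 4 := le_self_pow₀ hN1 (by norm_num)
  have hN4K : (N : ℝ) ^ 4 ≤ N ^ 4 * K := le_mul_of_one_le_right (by positivity) hK1
  have hT6 : 6 * N ≤ T := by
    have : (6 : ℝ) * N ≤ T := by linarith
    exact_mod_cast this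
  set η : ℝ := 1 / (T + 1) with hη
  have hη0 : 0 < η := by positivity
  have hη1 : (N + 1) * η ≤ 1 := by
    rw [hη, mul_one_div, div_le_one (by positivity)]
    linarith
  have hBtr : (Q * A * Q).trace = (A * Q).trace := by
    rw [Matrix.mul_assoc, Matrix.trace_mul_comm, Matrix.mul_assoc, hQ2.eq]
  have hB : (Q * A * Q).PosSemidef := by
    have := hA.mul_mul_conjTranspose_same Q
    rwa [hQ.eq] at this
  have htrace : ∀ x : Fin N → ℂ, (A * Matrix.vecMulVec x (star x)).trace =
      star x ⬝ᵥ A.mulVec x := fun x => by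
    rw [Matrix.mul_vecMulVec, Matrix.trace_vecMulVec, dotProduct_comm]
  -- each member is close to its image under the projection
  have hstep : ∀ v ∈ F, (star v.ofLp ⬝ᵥ A.mulVec v.ofLp).re ≤
      (star v.ofLp ⬝ᵥ (Q * A * Q).mulVec v.ofLp).re + N * N * (3 * ((N + 1) * η)) := by
    intro v hv
    obtain ⟨a, ha, hfirst, hav⟩ := hc.exists_isFirst hT6 hF hv
    have hq := hfix a ha hfirst
    set q : Fin N → ℂ := fun i => (approxEntry c T a i).val
    have hvq : ∀ i, ‖v.ofLp i - q i‖ ≤ η := fun i => norm_approxEntry_sub_le hav i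
    have hclose : ∀ i, ‖v.ofLp i - Q.mulVec v.ofLp i‖ ≤ (N + 1) * η := by
      intro i
      have e : v.ofLp i - Q.mulVec v.ofLp i = (v.ofLp i - q i) - Q.mulVec (v.ofLp - q) i := by
        rw [Matrix.mulVec_sub, hq, Pi.sub_apply]; ring
      have h1 : ‖Q.mulVec (v.ofLp - q) i‖ ≤ N * η := by
        rw [Matrix.mulVec, dotProduct]
        refine (norm_sum_le _ _).trans ((Finset.sum_le_sum (g := fun _ => η) fun j _ => ?_).trans
          (by simp))
        rw [norm_mul]
        calc _ ≤ 1 * η := mul_le_mul (norm_entry_le_one_of_projection hQ hQ2 i j) (hvq j)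
              (norm_nonneg _) zero_le_one
          _ = η := one_mul _
      rw [e]
      have h2 := norm_sub_le (v.ofLp i - q i) (Q.mulVec (v.ofLp - q) i)
      linarith [hvq i]
    have hn : ‖v‖ = 1 := hF.norm_eq_one ⟨v, hv⟩
    have h1 := abs_re_trace_sub_le hA htr (M := Matrix.vecMulVec v.ofLp (star v.ofLp))
      (M' := Matrix.vecMulVec (Q.mulVec v.ofLp) (star (Q.mulVec v.ofLp)))
      (η := 3 * ((N + 1) * η)) fun i j => norm_mul_star_sub_le_three (norm_coord_le_one hn i)
        (norm_coord_le_one hn j) hη1 (hclose i) (hclose j)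
    rw [htrace, htrace] at h1
    have h2 : star (Q.mulVec v.ofLp) ⬝ᵥ A.mulVec (Q.mulVec v.ofLp) =
        star v.ofLp ⬝ᵥ (Q * A * Q).mulVec v.ofLp := by
      rw [Matrix.star_mulVec, hQ.eq, ← Matrix.dotProduct_mulVec, Matrix.mulVec_mulVec,
        Matrix.mulVec_mulVec, Matrix.mul_assoc]
    rw [h2] at h1
    linarith [(abs_le.1 h1).2]
  have hcard : (F.card : ℝ) ≤ N := by
    have := hF.linearIndependent.fintype_card_le_finrank
    simp only [Fintype.card_coe, finrank_euclideanSpace_fin] at this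
    exact_mod_cast this
  have h1 := (Finset.sum_le_sum hstep).trans_eq Finset.sum_add_distrib
  rw [Finset.sum_const, nsmul_eq_mul] at h1
  have h2 := sum_re_dotProduct_mulVec_le_trace hB hF
  rw [hBtr] at h2
  have h3 : (F.card : ℝ) * (N * N * (3 * ((N + 1) * η))) ≤ 1 / (2 * K) := by
    calc (F.card : ℝ) * (N * N * (3 * ((N + 1) * η)))
        ≤ N * (N * N * (3 * ((N + N) * η))) := by gcongr
      _ = 6 * N ^ 4 / (T + 1) := by rw [hη]; ring
      _ ≤ 1 / (2 * K) := by
          rw [div_le_div_iff₀ (by positivity) (by positivity)]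
          linarith
  linarith

/-! ### Random states are incompressible -/

theorem tracialState_measure_listProjection {n t : ℕ} {P : List (List GRat)}
    (hP : isProjB (2 ^ n) P = true) (ht : isTraceB (2 ^ n) P t = true) :
    tracialState.measure (listProjection n P hP) = t / 2 ^ n := by
  rw [tracialState_measure]
  change (listMat (2 ^ n) P).trace.re / 2 ^ n = _
  rw [isTraceB_eq_true.1 ht, Complex.natCast_re]

/-- The projections onto the spans of the sets of vectors that a computable measure machine outputs
with short programs form a quantum Schnorr test. -/
theorem exists_quantumSchnorrTest {C : PrefixFreeMachine} (hC : C.IsComputableMeasure) {K : ℕ}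
    (hK : 0 < K) :
    ∃ S, IsQuantumSchnorrTest S ∧
      ∀ (n : ℕ) (σ : List Bool) (k : ℕ) (F : Finset (EuclideanSpace ℂ (Fin (2 ^ n)))),
        k ∈ C.run σ → IsSetIndex k F →
        Orthonormal ℂ (fun v : F => (v : EuclideanSpace ℂ (Fin (2 ^ n)))) → F.Nonempty →
        F.card * 2 ^ σ.length ≤ 2 ^ n → ∃ m, (S m).qubits = n ∧ ∀ ρ : QState,
          ∑ v ∈ F, (star v.ofLp ⬝ᵥ (ρ.mat n).mulVec v.ofLp).re ≤
            ρ.measure (S m) + 1 / (2 * K) := by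
  obtain ⟨h, hh, hmem, huniq⟩ := exists_halting_stages C.partrec
  obtain ⟨f, hf, hfP⟩ := exists_computable_span
  -- the index `m` is read as a program `σ m` and a stage at which it may halt
  let p : ℕ → List Bool × ℕ := fun m => (Encodable.decode m).getD ([], 0)
  have hp : Computable p := by fun_prop
  let o : ℕ → Option ℕ := fun m => h (p m).1 (p m).2
  have ho : Computable o := hh.comp hp
  let good : ℕ → Bool := fun m => eqB (Encodable.encode (p m)) m && (o m).isSome
  have hgood : Computable good := by fun_prop
  let c : ℕ → List (List AlgCode) := fun m => (Encodable.decode ((o m).getD 0)).getD []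
  have hc : Computable c := by fun_prop
  let n : ℕ → ℕ := fun m => firstBelow (((c m).getD 0 []).length + 1)
    fun i => eqB (2 ^ i) ((c m).getD 0 []).length
  have hn : Computable n := by fun_prop
  let G : ℕ → List (List GRat) × ℕ := fun m => f (c m, 2 ^ n m, 12 * (2 ^ n m) ^ 4 * K)
  have hG : Computable G := hf.comp (by fun_prop)
  let incl : ℕ → Bool := fun m => good m && leB ((G m).2 * 2 ^ (p m).1.length) (2 ^ n m)
  have hincl : Computable incl := by fun_prop
  let q : ℕ → ℕ := fun m => bif incl m then n m else 0
  have hq : Computable q := by fun_prop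
  let P : ℕ → List (List GRat) := fun m => bif incl m then (G m).1 else []
  have hPc : Computable P := by fun_prop
  let t : ℕ → ℕ := fun m => bif incl m then (G m).2 else 0
  have ht : Computable t := by fun_prop
  have hPt : ∀ m, isProjB (2 ^ q m) (P m) = true ∧ isTraceB (2 ^ q m) (P m) (t m) = true := by
    intro m
    obtain ⟨h1, -, h2, -⟩ := hfP (c m) (2 ^ n m) (12 * (2 ^ n m) ^ 4 * K)
    cases hi : incl m with
    | true =>
      simp only [q, P, t, hi, cond_true]
      exact ⟨h1, h2⟩
    | false =>
      have h0 : listMat (2 ^ 0) [] = 0 := by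
        ext i j
        simp [listMat, entry, GRat.val]
      simp only [q, P, t, hi, cond_false]
      -- excluded outputs contribute the zero projection on no qubits
      rw [isProjB_eq_true, isTraceB_eq_true, h0]
      exact ⟨⟨Matrix.isHermitian_zero, IsIdempotentElem.zero⟩, by simp⟩
  let S : ℕ → SpecialProjection := fun m => listProjection (q m) (P m) (hPt m).1
  have hτ : ∀ m, tracialState.measure (S m) = (t m : ℝ) / 2 ^ q m := fun m =>
    tracialState_measure_listProjection (hPt m).1 (hPt m).2
  -- the domain of the machine, enumerated without repetitions
  let s : ℕ → Option (List Bool) := fun m => bif good m then some (p m).1 else none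
  have hs : ∀ m σ, s m = some σ ↔ good m = true ∧ (p m).1 = σ := by
    intro m σ
    cases hg : good m <;> simp [s, hg]
  have hgm : ∀ m, good m = true ↔ Encodable.encode (p m) = m ∧ ∃ k, o m = some k := by
    intro m
    simp only [good, Bool.and_eq_true, eqB_eq_true, Option.isSome_iff_exists]
  have hdec : ∀ σ u, p (Encodable.encode (σ, u)) = (σ, u) := by
    intro σ u
    simp [p]
  have hsum := hasSum_weight C (s := s) (by
      intro m m' σ h1 h2
      obtain ⟨g1, e1⟩ := (hs m σ).1 h1
      obtain ⟨g2, e2⟩ := (hs m' σ).1 h2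
      obtain ⟨i1, k, h4⟩ := (hgm m).1 g1
      obtain ⟨i2, k', h5⟩ := (hgm m').1 g2
      simp only [o, e1, e2] at h4 h5
      rw [← i1, ← i2]
      exact congrArg _ (Prod.ext (e1.trans e2.symm) (huniq _ _ _ _ _ h4 h5))) (by
      intro σ
      rw [Part.dom_iff_mem]
      constructor
      · rintro ⟨k, hk⟩
        obtain ⟨u, hu⟩ := (hmem σ k).1 hk
        refine ⟨Encodable.encode (σ, u), (hs _ _).2 ⟨(hgm _).2 ⟨?_, k, ?_⟩, ?_⟩⟩
        · rw [hdec]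
        · simp only [o, hdec, hu]
        · rw [hdec]
      · rintro ⟨m, hm⟩
        obtain ⟨h1, rfl⟩ := (hs m σ).1 hm
        obtain ⟨-, k, h4⟩ := (hgm m).1 h1
        exact ⟨k, (hmem _ k).2 ⟨_, h4⟩⟩)
  have hw : ∀ m, weight (s m) =
      ((bif good m then 1 else 0 : ℕ) : ℝ) / 2 ^ (p m).1.length := by
    intro m
    cases hg : good m <;> simp [s, hg, weight]
  have hle : ∀ m, tracialState.measure (S m) ≤ weight (s m) := by
    intro m
    rw [hτ, hw]
    cases hi : incl m with
    | true =>
      simp only [incl, Bool.and_eq_true, leB_eq_true] at hi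
      have hi' : incl m = true := by simp only [incl, Bool.and_eq_true, leB_eq_true]; exact hi
      simp only [t, q, hi', hi.1, cond_true]
      rw [div_le_div_iff₀ (by positivity) (by positivity)]
      push_cast
      rw [one_mul]
      exact_mod_cast hi.2
    | false =>
      simp only [t, hi, cond_false, Nat.cast_zero, zero_div]
      positivity
  have h0 : ∀ m, 0 ≤ tracialState.measure (S m) := fun m => by rw [hτ]; positivity
  have hsummable : Summable fun m => tracialState.measure (S m) :=
    Summable.of_nonneg_of_le h0 hle hsum.summable
  have hwseq : IsGRatSeq fun m => weight (s m) := by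
    simp only [hw]
    exact isGRatSeq_nat_div_two_pow (by fun_prop) (by fun_prop)
  obtain ⟨N, hN, hNs⟩ := exists_computable_modulus hwseq hsum hC
  refine ⟨S, ⟨⟨⟨fun m => Encodable.encode (listMatCode (2 ^ q m) (P m)), by fun_prop, fun m =>
    ⟨_, Encodable.encodek _, matDenotes_listMatCode _ _⟩⟩, hsummable⟩, ?_⟩, ?_⟩
  · refine isComputableReal_of_modulus ?_ h0 hsummable.hasSum hN
      fun k => (tail_le_tail hle hsummable.hasSum hsum (N k)).trans (hNs k)
    simp only [hτ]
    exact isGRatSeq_nat_div_two_pow ht hq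
  · rintro n' σ k F hk ⟨d, hdk, hd⟩ hF hne hcard
    obtain ⟨u, hu⟩ := (hmem σ k).1 hk
    set m := Encodable.encode (σ, u) with hm
    have hom : o m = some k := by simp only [o, hm, hdec, hu]
    have hcm : c m = d := by simp only [c, hom, Option.getD_some, hdk]
    have hgoodm : good m = true := (hgm m).2 ⟨by rw [hm, hdec], k, hom⟩
    -- the number of qubits can be read off the first vector
    have hnm : n m = n' := by
      obtain ⟨v, hv⟩ := hne
      obtain ⟨a, ha, -⟩ := hd.exists_lt hv
      obtain ⟨v', -, hv'⟩ := hd.exists_of_lt (Nat.zero_lt_of_lt ha)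
      have hlen : ((c m).getD 0 []).length = 2 ^ n' := by
        rw [hcm]; exact (vecDenotes_iff.1 hv').1
      have hb := firstBelow_lt (n := ((c m).getD 0 []).length + 1) (i := n')
        (f := fun i => eqB (2 ^ i) ((c m).getD 0 []).length)
        (by rw [hlen]; exact Nat.lt_succ_of_lt Nat.lt_two_pow_self)
        (by rw [eqB_eq_true, hlen])
      exact Nat.pow_right_injective le_rfl ((eqB_eq_true.1 hb.2.1).trans hlen)
    subst hnm
    obtain ⟨h1, h2, h3, h4⟩ := hfP (c m) (2 ^ n m) (12 * (2 ^ n m) ^ 4 * K)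
    have hpos : 0 < 2 ^ n m := by positivity
    have hT6 : 6 * 2 ^ n m ≤ 12 * (2 ^ n m) ^ 4 * K := by
      have h5 : 2 ^ n m ≤ (2 ^ n m) ^ 4 := Nat.le_self_pow (by norm_num) _
      nlinarith [Nat.mul_le_mul_left ((2 ^ n m) ^ 4) hK]
    have hincm : incl m = true := by
      have h5 := h4.trans (firstCount_le_card hT6 (hcm ▸ hd) hF)
      simp only [incl, Bool.and_eq_true, leB_eq_true]
      refine ⟨hgoodm, le_trans ?_ hcard⟩
      have h6 : (p m).1 = σ := by rw [hm, hdec]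
      rw [h6]
      exact Nat.mul_le_mul_right _ h5
    have hqm : q m = n m := by simp only [q, hincm, cond_true]
    have hPm : P m = (G m).1 := by simp only [P, hincm, cond_true]
    refine ⟨m, hqm, fun ρ => ?_⟩
    have h5 := sum_le_trace_mul_listMat hpos hK le_rfl (hcm ▸ hd) hF h1 h2 (ρ.posSemidef (n m))
      (ρ.trace_eq_one (n m))
    refine h5.trans_eq ?_
    congr 1
    change _ = (ρ.mat (q m) * listMat (2 ^ q m) (P m)).trace.re
    rw [hqm, hPm]

/-- For a random state the compression by a computable measure machine is bounded: otherwise the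
test formed from the machine would be failed, as unbounded compression involves infinitely many of
its members. -/
theorem exists_QK_bound_of_isQuantumSchnorrRandom {ρ : QState} (h : ρ.IsQuantumSchnorrRandom)
    {C : PrefixFreeMachine} (hC : C.IsComputableMeasure) {ε : ℝ} (hε : 0 < ε) :
    ∃ d : ℝ, 0 < d ∧ ∀ n : ℕ, C.QK ε (ρ.mat n) > (((n : ℝ) - d : ℝ) : EReal) := by
  by_contra! hcon
  obtain ⟨K, hK⟩ := exists_nat_gt (1 / ε)
  have hK0 : 0 < K := by
    have : (0 : ℝ) < K := lt_trans (by positivity) hK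
    exact_mod_cast this
  have hKε : 1 / (2 * (K : ℝ)) < ε / 2 := by
    rw [div_lt_iff₀ hε] at hK
    rw [div_lt_div_iff₀ (by positivity) two_pos]
    linarith
  obtain ⟨S, hS, hSF⟩ := exists_quantumSchnorrTest hC hK0
  refine h S hS (ε / 2) (by positivity) ?_
  rw [QState.FailsAt, frequently_atTop]
  intro M
  -- the compression is taken to exceed the number of qubits of the first `M` projections
  obtain ⟨n, hn⟩ := hcon ((∑ m ∈ Finset.range M, (S m).qubits : ℕ) + 2) (by positivity)
  set D := ∑ m ∈ Finset.range M, (S m).qubits with hD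
  have hlt : C.QK ε (ρ.mat n) < (((n : ℝ) - (D + 1) : ℝ) : EReal) := by
    refine lt_of_le_of_lt hn ?_
    rw [EReal.coe_lt_coe_iff]
    linarith
  obtain ⟨_, ⟨σ, k, F, hk, hkF, hF, hsum, rfl⟩, hx⟩ := sInf_lt_iff.1 hlt
  rw [EReal.coe_lt_coe_iff] at hx
  have hne : F.Nonempty := by
    rw [Finset.nonempty_iff_ne_empty]
    rintro rfl
    simp at hsum
    linarith
  have hcard : (1 : ℝ) ≤ F.card := by exact_mod_cast hne.card_pos
  have hlog := Real.logb_nonneg one_lt_two hcard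
  have hσ : (0 : ℝ) ≤ σ.length := Nat.cast_nonneg _
  have hle : F.card * 2 ^ σ.length ≤ 2 ^ n := by
    have h1 : Real.logb 2 (F.card * 2 ^ σ.length) ≤ n := by
      rw [Real.logb_mul (by positivity) (by positivity), ← Real.rpow_natCast 2 σ.length,
        Real.logb_rpow two_pos (by norm_num)]
      have : (0 : ℝ) ≤ D := Nat.cast_nonneg _
      linarith
    rw [Real.logb_le_iff_le_rpow one_lt_two (by positivity), Real.rpow_natCast] at h1
    exact_mod_cast h1
  obtain ⟨m, hm, hmρ⟩ := hSF n σ k F hk hkF hF hne hle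
  refine ⟨m, ?_, by linarith [hmρ ρ]⟩
  by_contra hmM
  have h1 : (S m).qubits ≤ D := Finset.single_le_sum (f := fun m => (S m).qubits)
    (fun _ _ => Nat.zero_le _) (Finset.mem_range.2 (not_le.1 hmM))
  rw [hm] at h1
  have h2 : (n : ℝ) ≤ D := by exact_mod_cast h1
  linarith

end QuantumSchnorr

open QuantumSchnorr in
theorem mainTheorem3 (ρ : QState) :
    ρ.IsQuantumSchnorrRandom ↔
      ∀ C : PrefixFreeMachine, C.IsComputableMeasure → ∀ ε : ℝ, 0 < ε →
        ∃ d : ℝ, 0 < d ∧ ∀ n : ℕ, C.QK ε (ρ.mat n) > (((n : ℝ) - d : ℝ) : EReal) :=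
  ⟨fun h _ hC _ hε => exists_QK_bound_of_isQuantumSchnorrRandom h hC hε,
    isQuantumSchnorrRandom_of_forall_QK⟩
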